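/- **Lemma 4.2.** Let $c>0$ and, for $a\in(0,\tfrac{27}{256}c^4)$, let $U(p)=-p^2+\dfrac{a}{(c-p)^2}$. On $(0,c)$ the equation $p(c-p)^3=a$ has exactly two roots $\phi_1\in(0,\tfrac c4)$ and $\phi_2\in(\tfrac c4,c)$, which are respectively a local maximum and a local minimum of $U$. Let $(a,b)$ belong to the existence region $$0<a<\tfrac{27}{256}c^4,\qquad U(\phi_2)<b<U(\phi_1),$$ and let $\phi_-\in(\phi_1,\phi_2)$ and $\phi_+\in(\phi_2,c)$ be the turning points, the unique solutions of $U(p)=b$ in these intervals. The period function is $$\mathfrak L(a,b):=2\int_{\phi_-}^{\phi_+}\frac{dp}{\sqrt{b-U(p)}} ,$$ and it is differentiable in $a$ (part of the claim). Let $\phi:\mathbb R\to\mathbb R$ be a $C^\infty$ periodic function with fundamental (least positive) period $L>0$, such that $c-\phi>0$ and $$(c-\phi)^2\bigl(\phi'^2-\phi^2-b\bigr)+a=0 .$$ Consider on the Hilbert space $L^2_{\rm per}$ of $L$-periodic square-integrable functions the bounded self-adjoint operator $$\mathcal L:=c-\phi-3c\,(4-\partial_x^2)^{-1}.$$ Then,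 counting eigenvalues with multiplicity, $\mathcal L$ admits * exactly two negative eigenvalues and a simple zero eigenvalue if $\partial_a\mathfrak L(a,b)>0$; * exactly one (simple) negative eigenvalue and a double zero eigenvalue if $\partial_a\mathfrak L(a,b)=0$; * exactly one (simple) negative eigenvalue and a simple zero eigenvalue if $\partial_a\mathfrak L(a,b)<0$. In all three cases the rest of the spectrum of $\mathcal L$ is strictly positive: there is $\delta>0$ such that every point of the spectrum other than $0$ and the negative eigenvalues lies in $[\delta,\infty)$. -/

import Mathlib

open MeasureTheory AddCircle
open scoped ENNReal ContDiff

noncomputable section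

namespace DPWave

/-! ### The existence region and the period function -/

/-- The potential `U(p) = -p² + a / (c - p)²`, so that the first-order invariant
`(c - φ)² (φ'² - φ² - b) + a = 0` reads `φ'² + U(φ) = b` wherever `φ < c`. -/
def potential (c a p : ℝ) : ℝ := -p ^ 2 + a / (c - p) ^ 2

/-- The local maximum `φ₁` of the potential: for `0 < a < 27 c⁴ / 256` the set below has exactly
one element, the root of `p (c - p)³ = a` in `(0, c/4)`. -/
def saddle (c a : ℝ) : ℝ := sInf {p | p ∈ Set.Ioo 0 (c / 4) ∧ p * (c - p) ^ 3 = a}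

/-- The local minimum `φ₂` of the potential: for `0 < a < 27 c⁴ / 256` the set below has exactly
one element, the root of `p (c - p)³ = a` in `(c/4, c)`. -/
def center (c a : ℝ) : ℝ := sInf {p | p ∈ Set.Ioo (c / 4) c ∧ p * (c - p) ^ 3 = a}

/-- The open region of parameters `(a, b)` for which smooth periodic waves exist:
`0 < a < 27 c⁴ / 256` and `U(φ₂) < b < U(φ₁)`. -/
def existenceRegion (c : ℝ) : Set (ℝ × ℝ) :=
  {q | 0 < q.1 ∧ q.1 < 27 / 256 * c ^ 4 ∧
    potential c q.1 (center c q.1) < q.2 ∧ q.2 < potential c q.1 (saddle c q.1)}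

/-- The lower turning point `φ₋`, the only solution of `U(p) = b` in `(φ₁, φ₂)` when `(a, b)`
lies in the existence region. -/
def turnLower (c a b : ℝ) : ℝ :=
  sInf {p | p ∈ Set.Ioo (saddle c a) (center c a) ∧ potential c a p = b}

/-- The upper turning point `φ₊`, the only solution of `U(p) = b` in `(φ₂, c)` when `(a, b)`
lies in the existence region. -/
def turnUpper (c a b : ℝ) : ℝ :=
  sInf {p | p ∈ Set.Ioo (center c a) c ∧ potential c a p = b}

/-- The period function `𝔏(a, b) = 2 ∫_{φ₋}^{φ₊} dp / √(b - U(p))`. -/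
def periodFn (c a b : ℝ) : ℝ :=
  2 * ∫ p in (turnLower c a b)..(turnUpper c a b), 1 / √(b - potential c a p)

/-- `φ` is a smooth periodic solution, of fundamental period `L`, of the first-order invariant
`(c - φ)² (φ'² - φ² - b) + a = 0` with `c - φ > 0`. Constant functions have no least positive
period, hence are not waves in this sense. -/
structure IsSmoothPeriodicWave (c a b L : ℝ) (φ : ℝ → ℝ) : Prop where
  smooth : ContDiff ℝ ∞ φ
  period : IsLeast {T : ℝ | 0 < T ∧ Function.Periodic φ T} L
  lt_speed : ∀ x, 0 < c - φ x
  invariant : ∀ x, (c - φ x) ^ 2 * ((deriv φ x) ^ 2 - (φ x) ^ 2 - b) + a = 0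

theorem IsSmoothPeriodicWave.periodic {c a b L : ℝ} {φ : ℝ → ℝ}
    (h : IsSmoothPeriodicWave c a b L φ) : Function.Periodic φ L := h.period.1.2

/-! ### The Hessian operator on `L²_per` -/

/-- The complex Hilbert space `L²_per` of square integrable `L`-periodic functions. -/
abbrev L2per (L : ℝ) [Fact (0 < L)] : Type := Lp ℂ 2 (@haarAddCircle L _)

/-- The continuous function on the circle `ℝ / Lℤ` induced by `c - φ`, for a continuous
`L`-periodic `φ`. -/
def speedMinus (c : ℝ) {L : ℝ} {φ : ℝ → ℝ} (hφ : Continuous φ) (hL : Function.Periodic φ L) :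
    C(AddCircle L, ℂ) where
  toFun x := ((c - hL.lift x : ℝ) : ℂ)
  continuous_toFun := by
    have h : Continuous (hL.lift : AddCircle L → ℝ) := hφ.quotient_liftOn' _
    exact Complex.continuous_ofReal.comp (continuous_const.sub h)

/-- The bounded operator `w ↦ V w` of multiplication by a continuous function on `L²_per`. -/
def mulOp {L : ℝ} [Fact (0 < L)] (V : C(AddCircle L, ℂ)) : L2per L →L[ℂ] L2per L :=
  (ContinuousLinearMap.mul ℂ ℂ).holderL haarAddCircle ∞ 2 2
    (ContinuousMap.toLp ∞ haarAddCircle ℂ V)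

theorem mulOp_coeFn {L : ℝ} [Fact (0 < L)] (V : C(AddCircle L, ℂ)) (w : L2per L) :
    mulOp V w =ᵐ[haarAddCircle] fun x => V x * w x := by
  have h1 : mulOp V w =ᵐ[haarAddCircle]
      fun x => (ContinuousMap.toLp ∞ haarAddCircle ℂ V : AddCircle L → ℂ) x * w x :=
    (ContinuousLinearMap.mul ℂ ℂ).coeFn_holder (r := 2) _ w
  filter_upwards [h1, ContinuousMap.coeFn_toLp (p := ∞) (𝕜 := ℂ) haarAddCircle V] with x h h'
  rw [h, h']

/-- The operator `(4 - ∂ₓ²)⁻¹` on `L²_per`, as a Fourier multiplier: on the orthonormal basis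
`eₙ(x) = exp (2 π i n x / L)` one has `(4 - ∂ₓ²) eₙ = (4 + (2 π n / L)²) eₙ`. The series of rank-one
operators converges absolutely in operator norm. -/
def resolventFour (L : ℝ) [Fact (0 < L)] : L2per L →L[ℂ] L2per L :=
  ∑' n : ℤ, ((1 / (4 + (2 * Real.pi * n / L) ^ 2) : ℝ) : ℂ) •
    InnerProductSpace.rankOne ℂ (fourierBasis (T := L) n) (fourierBasis (T := L) n)

/-- The series defining `(4 - ∂ₓ²)⁻¹` converges in operator norm. -/
theorem summable_resolventFour (L : ℝ) [Fact (0 < L)] :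
    Summable fun n : ℤ => ((1 / (4 + (2 * Real.pi * n / L) ^ 2) : ℝ) : ℂ) •
      InnerProductSpace.rankOne ℂ (fourierBasis (T := L) n) (fourierBasis (T := L) n) := by
  have hL : (0 : ℝ) < L := Fact.out
  have h2 : Summable fun n : ℤ => (L / (2 * Real.pi)) ^ 2 * (1 / (n : ℝ) ^ 2) :=
    (Real.summable_one_div_int_pow.mpr one_lt_two).mul_left _
  refine Summable.of_norm_bounded_eventually h2 ?_
  have hfin : ({0} : Set ℤ).Finite := Set.finite_singleton 0
  filter_upwards [hfin.compl_mem_cofinite] with n hn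
  have hn0 : (n : ℝ) ≠ 0 := by exact_mod_cast hn
  have hpos : 0 < (2 * Real.pi * n / L) ^ 2 := by
    have := Real.pi_pos
    positivity
  rw [norm_smul, InnerProductSpace.norm_rankOne, Complex.norm_real, Real.norm_eq_abs,
    (fourierBasis (T := L)).orthonormal.1 n, mul_one, mul_one, abs_of_pos (by positivity)]
  calc 1 / (4 + (2 * Real.pi * n / L) ^ 2) ≤ 1 / (2 * Real.pi * n / L) ^ 2 :=
        one_div_le_one_div_of_le hpos (by linarith)
    _ = (L / (2 * Real.pi)) ^ 2 * (1 / (n : ℝ) ^ 2) := by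
        have := Real.pi_pos.ne'
        field_simp

/-- On Fourier modes the operator `(4 - ∂ₓ²)⁻¹` acts by the factor `1 / (4 + (2 π n / L)²)`. -/
theorem resolventFour_fourierBasis (L : ℝ) [Fact (0 < L)] (m : ℤ) :
    resolventFour L (fourierBasis (T := L) m) =
      ((1 / (4 + (2 * Real.pi * m / L) ^ 2) : ℝ) : ℂ) • fourierBasis (T := L) m := by
  have h := (ContinuousLinearMap.apply ℂ (L2per L) (fourierBasis (T := L) m)).map_tsum
    (summable_resolventFour L)
  change resolventFour L (fourierBasis (T := L) m) = _ at h
  have ho := orthonormal_iff_ite.mp (fourierBasis (T := L)).orthonormal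
  rw [h, tsum_eq_single m]
  · rw [ContinuousLinearMap.apply_apply, smul_apply,
      InnerProductSpace.rankOne_apply, ho m m, if_pos rfl, one_smul]
  · intro n hn
    rw [ContinuousLinearMap.apply_apply, smul_apply,
      InnerProductSpace.rankOne_apply, ho n m, if_neg hn, zero_smul, smul_zero]

/-- The Hessian operator `𝓛 = c - φ - 3 c (4 - ∂ₓ²)⁻¹` on `L²_per`. -/
def hessian (c : ℝ) {L : ℝ} [Fact (0 < L)] {φ : ℝ → ℝ} (hφ : Continuous φ)
    (hL : Function.Periodic φ L) : L2per L →L[ℂ] L2per L :=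
  mulOp (speedMinus c hφ hL) - ((3 * c : ℝ) : ℂ) • resolventFour L

/-! ### Counting eigenvalues -/

/-- The multiplicity of `z` as an eigenvalue of `T`: the dimension of the eigenspace. -/
def eigMult {E : Type*} [NormedAddCommGroup E] [NormedSpace ℂ E] (T : E →L[ℂ] E) (z : ℂ) :
    Cardinal :=
  Module.rank ℂ (Module.End.eigenspace (T : E →ₗ[ℂ] E) z)

/-- The number of negative eigenvalues of `T` with their multiplicities: the dimension of the
(internal direct) sum of the eigenspaces for all real `μ < 0`. -/
def negEigCount {E : Type*} [NormedAddCommGroup E] [NormedSpace ℂ E] (T : E →L[ℂ] E) :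
    Cardinal :=
  Module.rank ℂ
    (⨆ μ : Set.Iio (0 : ℝ), Module.End.eigenspace (T : E →ₗ[ℂ] E) ((μ : ℝ) : ℂ) : Submodule ℂ E)

end DPWave

end

/-!
Write `w = c - φ`, `K = (4 - ∂ₓ²)⁻¹` and `u = K v`. Completing the square gives
`⟨v, 𝓛 v⟩ = ∫ w (v - 3 c u / w)² + 3 c ∫ (u'² + q u²)` with `q = 4 - 3 c / w`, so that `𝓛` has the
negative index and the nullity of the periodic Hill operator `-∂ₓ² + q`, while the compactness of
`K` separates the rest of the spectrum from zero. In the variable `w² / 2` the linearized wave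
equation is this Hill equation. Its periodic solution `ψ = w w'` comes from the translations of the
wave and has two zeros in a period. A second solution `y`, the Jacobi field, comes from varying the
wave in `a` at fixed `b`; after a period its derivative jumps by a multiple of `τ = ∂ₐ𝔏(a, b)`.
Hence `y` is periodic, and the kernel is two-dimensional, exactly if `τ = 0`. Between the zeros of
`ψ` the Hill form is nonnegative on functions vanishing there (Jacobi's identity), so its negative
index is one or two, and it is two exactly if the form is negative at `y`, that is if `τ > 0`.
-/

noncomputable section

namespace DPWave

/-! ### Compact perturbations of self-adjoint operators -/

section CompactPerturbation

open Module.End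

theorem eigenspace_sub_eq {𝕜 X : Type*} [NontriviallyNormedField 𝕜] [NormedAddCommGroup X]
    [NormedSpace 𝕜 X] {A K : X →L[𝕜] X} {z : 𝕜} {u : (X →L[𝕜] X)ˣ}
    (hu : (u : X →L[𝕜] X) = A - algebraMap 𝕜 (X →L[𝕜] X) z) :
    eigenspace (A - K).toLinearMap z = eigenspace ((↑u⁻¹ : X →L[𝕜] X) * K).toLinearMap 1 := by
  have hA (v : X) : A v = (u : X →L[𝕜] X) v + z • v := by
    simp [hu, Algebra.algebraMap_eq_smul_one]
  ext v
  simp only [mem_eigenspace_iff, ContinuousLinearMap.coe_coe, sub_apply, one_smul, hA,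
    mul_apply_eq_comp]
  constructor
  · intro h
    have huv : (u : X →L[𝕜] X) v = K v := by
      rw [add_sub_right_comm, add_eq_right] at h
      exact sub_eq_zero.mp h
    rw [← huv, ← mul_apply_eq_comp, u.inv_mul, one_apply_eq_self]
  · intro h
    have huv : K v = (u : X →L[𝕜] X) v := by
      conv_rhs => rw [← h]
      rw [← mul_apply_eq_comp, u.mul_inv, one_apply_eq_self]
    rw [huv, add_sub_cancel_left]

/-- Fredholm alternative: `A - K - z = (A - z) (1 - (A - z)⁻¹ K)`. -/
theorem hasEigenvalue_of_mem_spectrum_sub {𝕜 X : Type*} [NontriviallyNormedField 𝕜]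
    [NormedAddCommGroup X] [NormedSpace 𝕜 X] [CompleteSpace X] {A K : X →L[𝕜] X} {z : 𝕜}
    (hA : z ∉ spectrum 𝕜 A) (hK : IsCompactOperator K) (hz : z ∈ spectrum 𝕜 (A - K)) :
    HasEigenvalue (A - K).toLinearMap z := by
  obtain ⟨u, hu⟩ : IsUnit (A - algebraMap 𝕜 (X →L[𝕜] X) z) := by
    rw [← IsUnit.neg_iff, neg_sub]
    exact spectrum.notMem_iff.mp hA
  rw [hasEigenvalue_iff, eigenspace_sub_eq hu, ← hasEigenvalue_iff]
  have hcompact : IsCompactOperator ((↑u⁻¹ : X →L[𝕜] X) * K) := hK.clm_comp _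
  refine (hcompact.hasEigenvalue_or_mem_resolventSet one_ne_zero).resolve_right fun h => hz ?_
  have hfactor : algebraMap 𝕜 (X →L[𝕜] X) z - (A - K) =
      -(u * (algebraMap 𝕜 (X →L[𝕜] X) 1 - (↑u⁻¹ : X →L[𝕜] X) * K)) := by
    rw [mul_sub, u.mul_inv_cancel_left, hu, map_one, mul_one]
    abel
  rw [spectrum.mem_resolventSet_iff, hfactor, IsUnit.neg_iff]
  exact u.isUnit.mul h

theorem finiteDimensional_eigenspace_sub {𝕜 H : Type*} [RCLike 𝕜] [NormedAddCommGroup H]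
    [InnerProductSpace 𝕜 H] [CompleteSpace H] {A K : H →L[𝕜] H} {z : 𝕜}
    (hA : z ∉ spectrum 𝕜 A) (hK : IsCompactOperator K) :
    FiniteDimensional 𝕜 (eigenspace (A - K).toLinearMap z) := by
  obtain ⟨u, hu⟩ : IsUnit (A - algebraMap 𝕜 (H →L[𝕜] H) z) := by
    rw [← IsUnit.neg_iff, neg_sub]
    exact spectrum.notMem_iff.mp hA
  rw [eigenspace_sub_eq hu]
  exact ContinuousLinearMap.finite_dimensional_eigenspace (hK.clm_comp _) 1 one_ne_zero

theorem isCompactOperator_starProjection {𝕜 H : Type*} [RCLike 𝕜] [NormedAddCommGroup H]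
    [InnerProductSpace 𝕜 H] (E : Submodule 𝕜 H) [FiniteDimensional 𝕜 E] :
    IsCompactOperator E.starProjection := by
  have : ProperSpace E := FiniteDimensional.proper 𝕜 E
  exact (isCompactOperator_of_locallyCompactSpace_dom E.orthogonalProjectionOnto).clm_comp
    E.subtypeL

end CompactPerturbation

section SymmetricOperator

open Module.End

variable {𝕜 H : Type*} [RCLike 𝕜] [NormedAddCommGroup H] [InnerProductSpace 𝕜 H]
  {T : H →ₗ[𝕜] H}

theorem starProjection_apply_of_mem_invtSubmodule (hT : T.IsSymmetric) {E : Submodule 𝕜 H}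
    [E.HasOrthogonalProjection] (hE : E ∈ invtSubmodule T) (x : H) :
    E.starProjection (T x) = T (E.starProjection x) := by
  have hE' := hT.orthogonalComplement_mem_invtSubmodule hE
  refine Submodule.eq_starProjection_of_mem_orthogonal
    (hE (Submodule.starProjection_apply_mem E x)) ?_
  rw [← map_sub]
  exact hE' (Submodule.sub_starProjection_mem_orthogonal x)

theorem apply_of_add_smul_starProjection_apply_eq (hT : T.IsSymmetric) {E : Submodule 𝕜 H}
    [E.HasOrthogonalProjection] (hE : E ∈ invtSubmodule T) {r s : 𝕜} {x : H}
    (hx : T x + s • E.starProjection x = r • x) :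
    T (E.starProjection x) = (r - s) • E.starProjection x ∧
      T (x - E.starProjection x) = r • (x - E.starProjection x) := by
  have hproj : T (E.starProjection x) = (r - s) • E.starProjection x := by
    have h := congrArg E.starProjection hx
    rw [map_add, map_smul, map_smul, starProjection_apply_of_mem_invtSubmodule hT hE,
      Submodule.starProjection_eq_self_iff.mpr (Submodule.starProjection_apply_mem E x)] at h
    rw [sub_smul, eq_sub_iff_add_eq, h]
  refine ⟨hproj, ?_⟩
  rw [map_sub, hproj, eq_sub_of_add_eq hx, sub_smul, smul_sub]
  abel

theorem inner_sum_apply_sum_of_apply_eq_smul (hT : T.IsSymmetric) {ι : Type*} {μ : ι → ℝ}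
    (hμ : Function.Injective μ) {x : ι → H} (hx : ∀ i, T (x i) = (μ i : 𝕜) • x i) (s : Finset ι) :
    inner 𝕜 (∑ i ∈ s, x i) (T (∑ i ∈ s, x i)) = ∑ i ∈ s, ((μ i * ‖x i‖ ^ 2 : ℝ) : 𝕜) := by
  have horth := hT.orthogonalFamily_eigenspaces.comp (f := fun i => (μ i : 𝕜))
    (RCLike.ofReal_injective.comp hμ)
  have h := horth.inner_sum (fun i => ⟨x i, mem_eigenspace_iff.mpr (hx i)⟩)
    (fun i => (μ i : 𝕜) • ⟨x i, mem_eigenspace_iff.mpr (hx i)⟩) s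
  simp only [Submodule.coe_subtypeₗᵢ, Submodule.coe_subtype, Submodule.coe_smul, inner_smul_right,
    inner_self_eq_norm_sq_to_K] at h
  simp only [map_sum, hx, h]
  push_cast
  rfl

end SymmetricOperator

section NegativeSpace

open Module.End

variable {H : Type*} [NormedAddCommGroup H] [InnerProductSpace ℂ H]

/-- The sum of the eigenspaces of `T` for negative eigenvalues, whose dimension is
`negEigCount T`. -/
def negSpace (T : H →L[ℂ] H) : Submodule ℂ H :=
  ⨆ μ : Set.Iio (0 : ℝ), eigenspace (T : H →ₗ[ℂ] H) ((μ : ℝ) : ℂ)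

theorem negSpace_mem_invtSubmodule (T : H →L[ℂ] H) :
    negSpace T ∈ invtSubmodule T.toLinearMap := by
  rw [mem_invtSubmodule, negSpace, iSup_le_iff]
  intro μ
  exact (mem_invtSubmodule _).mp (eigenspace_mem_invtSubmodule _ _) |>.trans
    (Submodule.comap_mono (le_iSup (fun μ : Set.Iio (0 : ℝ) => eigenspace _ ((μ : ℝ) : ℂ)) μ))

variable [CompleteSpace H]

theorem re_inner_neg_of_mem_negSpace {T : H →L[ℂ] H} (hT : IsSelfAdjoint T) {v : H}
    (hv : v ∈ negSpace T) (hv0 : v ≠ 0) : (inner ℂ v (T v)).re < 0 := by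
  obtain ⟨x, hx, rfl⟩ := (Submodule.mem_iSup_iff_exists_finsupp _ v).mp hv
  have hform := inner_sum_apply_sum_of_apply_eq_smul hT.isSymmetric Subtype.val_injective
    (fun i => mem_eigenspace_iff.mp (hx i)) x.support
  simp only [Finsupp.sum] at hv0 ⊢
  have hsupp : x.support.Nonempty := Finset.nonempty_of_sum_ne_zero hv0
  rw [← ContinuousLinearMap.coe_coe T, hform, Complex.re_sum]
  refine Finset.sum_neg (fun i hi => ?_) hsupp
  have hxi : 0 < ‖x i‖ := norm_pos_iff.mpr (Finsupp.mem_support_iff.mp hi)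
  exact mul_neg_of_neg_of_pos i.2 (pow_pos hxi 2)

theorem isPositive_of_forall_neg_notMem_spectrum {T : H →L[ℂ] H} (hT : IsSelfAdjoint T)
    (h : ∀ r : ℝ, r < 0 → (r : ℂ) ∉ spectrum ℂ T) : T.IsPositive := by
  rw [← ContinuousLinearMap.nonneg_iff_isPositive,
    StarOrderedRing.nonneg_iff_spectrum_nonneg (R := ℝ) T hT]
  exact fun r hr => not_lt.mp fun hr0 => h r hr0 (hT.coe_mem_spectrum_complex.mpr hr)

variable {A K : H →L[ℂ] H}

theorem isPositive_add_norm_smul_starProjection_negSpace (hT : IsSelfAdjoint (A - K))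
    (hK : IsCompactOperator K) (hA : ∀ r : ℝ, r < 0 → (r : ℂ) ∉ spectrum ℂ A)
    [FiniteDimensional ℂ (negSpace (A - K))] :
    (A - K + ((‖A - K‖ : ℝ) : ℂ) • (negSpace (A - K)).starProjection).IsPositive := by
  set T := A - K with hTdef
  set P := (negSpace T).starProjection
  set C : ℂ := ((‖T‖ : ℝ) : ℂ)
  have hshift : T + C • P = A - (K - C • P) := by rw [hTdef]; abel
  have hadj : IsSelfAdjoint (T + C • P) :=
    hT.add (IsSelfAdjoint.smul (Complex.conj_ofReal _) (isSelfAdjoint_starProjection _))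
  refine isPositive_of_forall_neg_notMem_spectrum hadj fun r hr hmem => ?_
  rw [hshift] at hmem
  have hev := hasEigenvalue_of_mem_spectrum_sub (hA r hr)
    (hK.sub ((isCompactOperator_starProjection _).smul C)) hmem
  rw [← hshift] at hev
  obtain ⟨x, hx, hx0⟩ := hev.exists_hasEigenvector
  obtain ⟨hp, hy⟩ := apply_of_add_smul_starProjection_apply_eq hT.isSymmetric
    (negSpace_mem_invtSubmodule T) (mem_eigenspace_iff.mp hx)
  have hp0 : P x = 0 := by
    by_contra hp0
    have hle : ‖T (P x)‖ ≤ ‖T‖ * ‖P x‖ := T.le_opNorm _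
    rw [← ContinuousLinearMap.coe_coe T, hp, norm_smul, ← Complex.ofReal_sub, Complex.norm_real,
      Real.norm_eq_abs] at hle
    linarith [le_of_mul_le_mul_right hle (norm_pos_iff.mpr hp0), neg_le_abs (r - ‖T‖)]
  rw [hp0, sub_zero] at hy
  have hxneg : x ∈ negSpace T :=
    Submodule.mem_iSup_of_mem (⟨r, hr⟩ : Set.Iio (0 : ℝ)) (mem_eigenspace_iff.mpr hy)
  exact hx0 ((Submodule.starProjection_eq_self_iff.mpr hxneg).symm.trans hp0)

theorem re_inner_nonneg_of_mem_negSpace_orthogonal (hT : IsSelfAdjoint (A - K))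
    (hK : IsCompactOperator K) (hA : ∀ r : ℝ, r < 0 → (r : ℂ) ∉ spectrum ℂ A)
    [FiniteDimensional ℂ (negSpace (A - K))] {v : H} (hv : v ∈ (negSpace (A - K))ᗮ) :
    0 ≤ (inner ℂ v ((A - K) v)).re := by
  have h := (isPositive_add_norm_smul_starProjection_negSpace hT hK hA).re_inner_nonneg_right v
  rwa [add_apply, smul_apply, (Submodule.starProjection_apply_eq_zero_iff _).mpr hv, smul_zero,
    add_zero] at h

theorem rank_le_negEigCount (hT : IsSelfAdjoint (A - K)) (hK : IsCompactOperator K)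
    (hA : ∀ r : ℝ, r < 0 → (r : ℂ) ∉ spectrum ℂ A) {W : Submodule ℂ H} [FiniteDimensional ℂ W]
    (hW : ∀ v ∈ W, v ≠ 0 → (inner ℂ v ((A - K) v)).re < 0) :
    Module.rank ℂ W ≤ negEigCount (A - K) := by
  by_contra! hlt
  have hfin : FiniteDimensional ℂ (negSpace (A - K)) :=
    Module.rank_lt_aleph0_iff.mp (hlt.trans (Module.rank_lt_aleph0 ℂ W))
  refine hlt.not_ge (LinearMap.rank_le_of_injective
    ((negSpace (A - K)).orthogonalProjectionOnto.toLinearMap ∘ₗ W.subtype) ?_)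
  rw [← LinearMap.ker_eq_bot, Submodule.eq_bot_iff]
  intro x hx
  by_contra hx0
  have horth : (x : H) ∈ (negSpace (A - K))ᗮ := Submodule.orthogonalProjectionOnto_eq_zero_iff.mp hx
  exact (re_inner_nonneg_of_mem_negSpace_orthogonal hT hK hA horth).not_gt
    (hW x x.2 (Subtype.coe_ne_coe.mpr hx0))

theorem natCast_le_negEigCount (hT : IsSelfAdjoint (A - K)) (hK : IsCompactOperator K)
    (hA : ∀ r : ℝ, r < 0 → (r : ℂ) ∉ spectrum ℂ A) {n : ℕ} (f : (Fin n → ℂ) →ₗ[ℂ] H)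
    (hf : ∀ x, x ≠ 0 → (inner ℂ (f x) ((A - K) (f x))).re < 0) : n ≤ negEigCount (A - K) := by
  have hinj : Function.Injective f := by
    rw [← LinearMap.ker_eq_bot, Submodule.eq_bot_iff]
    intro x hx
    by_contra hx0
    have h := hf x hx0
    rw [LinearMap.mem_ker.mp hx, inner_zero_left, Complex.zero_re] at h
    exact h.false
  have hrange := rank_le_negEigCount hT hK hA (W := f.range) (by
    rintro _ ⟨x, rfl⟩ hx0
    exact hf x fun hx => hx0 (by rw [hx, map_zero]))
  rwa [← Module.finrank_eq_rank, LinearMap.finrank_range_of_inj hinj, Module.finrank_fin_fun]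
    at hrange

theorem negEigCount_le_natCast {T : H →L[ℂ] H} (hT : IsSelfAdjoint T) {n : ℕ}
    (F : H →ₗ[ℂ] (Fin n → ℂ)) (hF : ∀ v, F v = 0 → 0 ≤ (inner ℂ v (T v)).re) :
    negEigCount T ≤ n := by
  have hinj : Function.Injective (F ∘ₗ (negSpace T).subtype) := by
    rw [← LinearMap.ker_eq_bot, Submodule.eq_bot_iff]
    intro x hx
    by_contra hx0
    exact (hF x (LinearMap.mem_ker.mp hx)).not_gt
      (re_inner_neg_of_mem_negSpace hT x.2 (Subtype.coe_ne_coe.mpr hx0))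
  change Module.rank ℂ (negSpace T) ≤ n
  simpa using LinearMap.lift_rank_le_of_injective _ hinj

end NegativeSpace

section SpectralGap

open Module.End

variable {H : Type*} [NormedAddCommGroup H] [InnerProductSpace ℂ H] [CompleteSpace H]

theorem hasEigenvalue_add_starProjection_ker {T : H →L[ℂ] H} (hT : IsSelfAdjoint T)
    [T.ker.HasOrthogonalProjection] {z : ℂ} (hz : z ≠ 0) (h : HasEigenvalue T.toLinearMap z) :
    HasEigenvalue (T + T.ker.starProjection).toLinearMap z := by
  obtain ⟨x, hx, hx0⟩ := h.exists_hasEigenvector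
  have hTx : T x = z • x := mem_eigenspace_iff.mp hx
  have horth : x ∈ T.kerᗮ := by
    intro k (hk : T k = 0)
    have h0 : z * inner ℂ k x = 0 := by
      rw [← inner_smul_right, ← hTx, ← hT.isSymmetric.apply_clm, hk, inner_zero_left]
    exact (mul_eq_zero.mp h0).resolve_left hz
  refine hasEigenvalue_of_hasEigenvector (x := x) ⟨mem_eigenspace_iff.mpr ?_, hx0⟩
  rw [ContinuousLinearMap.coe_coe, add_apply,
    (Submodule.starProjection_apply_eq_zero_iff _).mpr horth, add_zero, hTx]

variable {A K : H →L[ℂ] H}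

theorem zero_notMem_spectrum_add_starProjection_ker (hT : IsSelfAdjoint (A - K))
    (hK : IsCompactOperator K) (hA : (0 : ℂ) ∉ spectrum ℂ A) [FiniteDimensional ℂ (A - K).ker] :
    (0 : ℂ) ∉ spectrum ℂ (A - K + (A - K).ker.starProjection) := by
  set T := A - K with hTdef
  set P := T.ker.starProjection
  have hshift : T + P = A - (K - P) := by rw [hTdef]; abel
  intro hmem
  rw [hshift] at hmem
  have hev := hasEigenvalue_of_mem_spectrum_sub hA
    (hK.sub (isCompactOperator_starProjection _)) hmem
  rw [← hshift] at hev
  obtain ⟨x, hx, hx0⟩ := hev.exists_hasEigenvector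
  have hinvt : T.ker ∈ invtSubmodule T.toLinearMap := by
    intro v hv
    simp_all
  obtain ⟨hp, hy⟩ := apply_of_add_smul_starProjection_apply_eq hT.isSymmetric hinvt
    (r := 0) (s := 1) (x := x) (by simpa using mem_eigenspace_iff.mp hx)
  have hp0 : P x = 0 := by
    have hker : T (P x) = 0 := Submodule.starProjection_apply_mem T.ker x
    rw [← ContinuousLinearMap.coe_coe T, hp, zero_sub, neg_one_smul, neg_eq_zero] at hker
    exact hker
  rw [hp0, sub_zero, zero_smul] at hy
  exact hx0 ((Submodule.starProjection_eq_self_iff.mpr hy).symm.trans hp0)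

theorem exists_spectral_gap (hT : IsSelfAdjoint (A - K)) (hK : IsCompactOperator K) {w₀ : ℝ}
    (hw₀ : 0 < w₀) (hA : ∀ r : ℝ, r < w₀ → (r : ℂ) ∉ spectrum ℂ A) :
    ∃ δ : ℝ, 0 < δ ∧ ∀ z ∈ spectrum ℂ (A - K), z = 0 ∨
      (∃ r : ℝ, r < 0 ∧ z = (r : ℂ) ∧ HasEigenvalue (A - K).toLinearMap z) ∨
      ∃ r : ℝ, δ ≤ r ∧ z = (r : ℂ) := by
  have hA0 : (0 : ℂ) ∉ spectrum ℂ A := by simpa using hA 0 hw₀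
  have hfin : FiniteDimensional ℂ (A - K).ker := by
    have h := finiteDimensional_eigenspace_sub hA0 hK
    rwa [eigenspace_zero] at h
  obtain ⟨ε, hε, hball⟩ := Metric.isOpen_iff.mp (spectrum.isClosed _).isOpen_compl 0
    (zero_notMem_spectrum_add_starProjection_ker hT hK hA0)
  refine ⟨min ε w₀, lt_min hε hw₀, fun z hz => ?_⟩
  obtain ⟨r, rfl⟩ : ∃ r : ℝ, z = r := ⟨z.re, hT.mem_spectrum_eq_re hz⟩
  rcases le_or_gt (min ε w₀) r with hr | hr
  · exact Or.inr (Or.inr ⟨r, hr, rfl⟩)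
  have hev := hasEigenvalue_of_mem_spectrum_sub (hA r (hr.trans_le (min_le_right _ _))) hK hz
  rcases lt_trichotomy r 0 with hr0 | rfl | hr0
  · exact Or.inr (Or.inl ⟨r, hr0, rfl, hev⟩)
  · exact Or.inl Complex.ofReal_zero
  · have hmem : (r : ℂ) ∈ spectrum ℂ (A - K + (A - K).ker.starProjection) := by
      rw [ContinuousLinearMap.spectrum_eq]
      exact (hasEigenvalue_add_starProjection_ker hT
        (Complex.ofReal_ne_zero.mpr hr0.ne') hev).mem_spectrum
    refine absurd hmem (hball ?_)
    rw [mem_ball_zero_iff, Complex.norm_real, Real.norm_eq_abs, abs_of_pos hr0]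
    exact hr.trans_le (min_le_left _ _)

end SpectralGap

/-! ### Periodic Sobolev functions -/

section FourierSeries

variable {L : ℝ}

/-- The wave number `2 π n / L` of the `n`-th Fourier mode of period `L`. -/
def waveNumber (L : ℝ) (n : ℤ) : ℝ := 2 * Real.pi * n / L

theorem summable_one_div_four_add_waveNumber_sq (hL : L ≠ 0) :
    Summable fun n : ℤ => 1 / (4 + waveNumber L n ^ 2) := by
  have hsq : Summable fun n : ℤ => (L / (2 * Real.pi)) ^ 2 * (1 / (n : ℝ) ^ 2) :=
    (Real.summable_one_div_int_pow.mpr one_lt_two).mul_left _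
  refine Summable.of_norm_bounded_eventually hsq ?_
  filter_upwards [(Set.finite_singleton (0 : ℤ)).compl_mem_cofinite] with n hn
  have hn0 : (n : ℝ) ≠ 0 := Int.cast_ne_zero.mpr hn
  have hpi := Real.pi_ne_zero
  have hpos : 0 < waveNumber L n ^ 2 := by unfold waveNumber; positivity
  rw [Real.norm_eq_abs, abs_of_pos (by positivity)]
  calc 1 / (4 + waveNumber L n ^ 2) ≤ 1 / waveNumber L n ^ 2 :=
        one_div_le_one_div_of_le hpos (by linarith)
    _ = (L / (2 * Real.pi)) ^ 2 * (1 / (n : ℝ) ^ 2) := by unfold waveNumber; field_simp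

theorem hasDerivAt_fourier_waveNumber (n : ℤ) (x : ℝ) :
    HasDerivAt (fun y : ℝ => (fourier n (y : AddCircle L) : ℂ))
      (Complex.I * waveNumber L n * fourier n (x : AddCircle L)) x := by
  refine (hasDerivAt_fourier L n x).congr_deriv ?_
  simp only [waveNumber]
  push_cast
  ring

variable [Fact (0 < L)]

theorem summable_mul_inner_fourierBasis (v : L2per L) {s : ℤ → ℂ}
    (hs : ∀ n, ‖s n‖ ^ 2 ≤ 1 / (4 + waveNumber L n ^ 2)) :
    Summable fun n => s n * inner ℂ (fourierBasis (T := L) n) v := by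
  refine Summable.of_norm_bounded
    ((summable_one_div_four_add_waveNumber_sq (Fact.out : 0 < L).ne').add
      ((fourierBasis (T := L)).orthonormal.inner_products_summable v)) fun n => ?_
  rw [norm_mul]
  nlinarith [hs n, sq_nonneg (‖s n‖ - ‖inner ℂ (fourierBasis (T := L) n) v‖),
    sq_nonneg (‖s n‖ + ‖inner ℂ (fourierBasis (T := L) n) v‖)]

variable {e : ℤ → ℂ}

theorem summable_smul_fourier (he : Summable e) :
    Summable fun n => e n • (fourier n : C(AddCircle L, ℂ)) :=
  Summable.of_norm_bounded he.norm fun n => by rw [norm_smul, fourier_norm, mul_one]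

theorem tsum_smul_fourier_apply (he : Summable e) (x : AddCircle L) :
    (∑' n, e n • (fourier n : C(AddCircle L, ℂ))) x = ∑' n, e n * fourier n x := by
  simpa using (ContinuousMap.evalCLM ℂ x).map_tsum (summable_smul_fourier he)

theorem inner_fourierBasis_toLp_tsum (he : Summable e) (m : ℤ) :
    inner ℂ (fourierBasis (T := L) m) (ContinuousMap.toLp 2 haarAddCircle ℂ
      (∑' n, e n • (fourier n : C(AddCircle L, ℂ)))) = e m := by
  have ho := orthonormal_iff_ite.mp (fourierBasis (T := L)).orthonormal
  have hmode : ∀ n, ContinuousMap.toLp (E := ℂ) 2 (haarAddCircle (T := L)) ℂ (fourier n) =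
      fourierBasis (T := L) n := fun n => by rw [coe_fourierBasis]
  have hsum := ((innerSL ℂ (fourierBasis (T := L) m)).comp
    (ContinuousMap.toLp (E := ℂ) 2 haarAddCircle ℂ)).hasSum (summable_smul_fourier he).hasSum
  refine hsum.unique ((hasSum_ite_eq m (e m)).congr_fun fun n => ?_)
  rw [ContinuousLinearMap.comp_apply, map_smul, hmode, innerSL_apply_apply, inner_smul_right, ho]
  rcases eq_or_ne n m with rfl | hn
  · rw [if_pos rfl, if_pos rfl, mul_one]
  · rw [if_neg hn.symm, if_neg hn, mul_zero]

theorem hasDerivAt_tsum_smul_fourier (he : Summable e)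
    (he' : Summable fun n => Complex.I * waveNumber L n * e n) (x : ℝ) :
    HasDerivAt (fun y : ℝ => (∑' n, e n • (fourier n : C(AddCircle L, ℂ))) (y : AddCircle L))
      ((∑' n, (Complex.I * waveNumber L n * e n) • (fourier n : C(AddCircle L, ℂ)))
        (x : AddCircle L)) x := by
  have hnorm : ∀ n (y : AddCircle L), ‖(fourier n y : ℂ)‖ = 1 := fun n y => by
    rw [fourier_apply, Circle.norm_coe]
  simp_rw [tsum_smul_fourier_apply he, tsum_smul_fourier_apply he']
  refine hasDerivAt_tsum (y₀ := (0 : ℝ)) he'.norm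
    (g := fun n (y : ℝ) => e n * fourier n (y : AddCircle L))
    (g' := fun n (y : ℝ) => Complex.I * waveNumber L n * e n * fourier n (y : AddCircle L))
    (fun n y => ((hasDerivAt_fourier_waveNumber n y).const_mul (e n)).congr_deriv (by ring))
    (fun n y => by rw [norm_mul, hnorm, mul_one]) ?_ x
  exact Summable.of_norm_bounded he.norm fun n => by rw [norm_mul, hnorm, mul_one]

end FourierSeries

section Resolvent

variable {L : ℝ} [Fact (0 < L)]

theorem isSelfAdjoint_resolventFour : IsSelfAdjoint (resolventFour L) := by
  have hsum := (summable_resolventFour L).hasSum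
  rw [ContinuousLinearMap.isSelfAdjoint_iff']
  refine (hsum.map ContinuousLinearMap.adjoint ContinuousLinearMap.adjoint.continuous).unique
    (hsum.congr_fun fun n => ?_)
  simp only [Function.comp_apply, LinearIsometryEquiv.map_smulₛₗ,
    InnerProductSpace.adjoint_rankOne, Complex.conj_ofReal]

theorem isCompactOperator_resolventFour : IsCompactOperator (resolventFour L) := by
  refine isCompactOperator_of_tendsto (summable_resolventFour L).hasSum
    (Filter.Eventually.of_forall fun s => ?_)
  induction s using Finset.induction_on with
  | empty => exact isCompactOperator_zero
  | insert n s hn ih =>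
    rw [Finset.sum_insert hn]
    refine IsCompactOperator.add (IsCompactOperator.smul ?_ _) ih
    exact (isCompactOperator_of_locallyCompactSpace_dom
      (innerSL ℂ (fourierBasis (T := L) n))).clm_comp
        (ContinuousLinearMap.toSpanSingleton ℂ (fourierBasis (T := L) n))

theorem inner_fourierBasis_resolventFour (v : L2per L) (n : ℤ) :
    inner ℂ (fourierBasis (T := L) n) (resolventFour L v) =
      ((1 / (4 + waveNumber L n ^ 2) : ℝ) : ℂ) * inner ℂ (fourierBasis (T := L) n) v := by
  rw [← isSelfAdjoint_resolventFour.isSymmetric.apply_clm, resolventFour_fourierBasis,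
    inner_smul_left, Complex.conj_ofReal, waveNumber]

/-- The Sobolev space `H¹_per` as the graph of the weak derivative: the pairs `(η, ∂η)` in
`L²_per`, where `∂` is the Fourier multiplier with symbol `i (2 π n / L)`. -/
def weakDerivGraph (L : ℝ) [Fact (0 < L)] : Submodule ℂ (L2per L × L2per L) where
  carrier := {η | ∀ n : ℤ, inner ℂ (fourierBasis (T := L) n) η.2 =
    Complex.I * waveNumber L n * inner ℂ (fourierBasis (T := L) n) η.1}
  add_mem' {η ζ} hη hζ n := by
    rw [Prod.snd_add, Prod.fst_add, inner_add_right, inner_add_right, hη n, hζ n, mul_add]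
  zero_mem' n := by rw [Prod.snd_zero, Prod.fst_zero, inner_zero_right, mul_zero]
  smul_mem' r η hη n := by
    rw [Prod.smul_snd, Prod.smul_fst, inner_smul_right, inner_smul_right, hη n, mul_left_comm]

/-- The `n`-th Fourier mode with its derivative, as an element of `H¹_per`. -/
def fourierPair (L : ℝ) [Fact (0 < L)] (n : ℤ) : L2per L × L2per L :=
  (fourierBasis (T := L) n, (Complex.I * waveNumber L n : ℂ) • fourierBasis (T := L) n)

theorem eq_of_forall_inner_hilbertBasis {ι 𝕜 E : Type*} [RCLike 𝕜] [NormedAddCommGroup E]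
    [InnerProductSpace 𝕜 E] (b : HilbertBasis ι 𝕜 E) {x y : E}
    (h : ∀ i, inner 𝕜 (b i) x = inner 𝕜 (b i) y) : x = y := by
  refine b.repr.injective (lp.ext (funext fun i => ?_))
  rw [b.repr_apply_apply, b.repr_apply_apply, h i]

theorem four_add_sq_ne_zero (r : ℝ) : (4 + (r : ℂ) ^ 2) ≠ 0 := by
  have h : 4 + r ^ 2 ≠ 0 := by positivity
  exact_mod_cast h

theorem inner_eq_of_mem_weakDerivGraph {η u : L2per L × L2per L} {v : L2per L}
    (hη : η ∈ weakDerivGraph L) (hu : u ∈ weakDerivGraph L) (huv : u.1 = resolventFour L v) :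
    inner ℂ η.1 v = inner ℂ η.2 u.2 + 4 * inner ℂ η.1 u.1 := by
  have hparseval := (fourierBasis (T := L)).hasSum_inner_mul_inner (𝕜 := ℂ)
  refine (hparseval η.1 v).unique ?_
  convert (hparseval η.2 u.2).add ((hparseval η.1 u.1).mul_left 4) using 2 with n
  have hη' : inner ℂ η.2 (fourierBasis (T := L) n) =
      -(Complex.I * waveNumber L n) * inner ℂ η.1 (fourierBasis (T := L) n) := by
    rw [← inner_conj_symm, hη n, map_mul, inner_conj_symm, map_mul, Complex.conj_I,
      Complex.conj_ofReal, neg_mul]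
  rw [hη', hu n, huv, inner_fourierBasis_resolventFour]
  have hne := four_add_sq_ne_zero (waveNumber L n)
  push_cast
  field_simp
  linear_combination (inner ℂ η.1 (fourierBasis (T := L) n) *
    inner ℂ (fourierBasis (T := L) n) v * (waveNumber L n : ℂ) ^ 2) * Complex.I_sq

theorem resolventFour_eq_of_forall_fourierPair {u : L2per L × L2per L} {v : L2per L}
    (hu : u ∈ weakDerivGraph L) (h : ∀ n : ℤ, inner ℂ (fourierPair L n).1 v =
      inner ℂ (fourierPair L n).2 u.2 + 4 * inner ℂ (fourierPair L n).1 u.1) :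
    resolventFour L v = u.1 := by
  refine eq_of_forall_inner_hilbertBasis fourierBasis fun n => ?_
  have hn := h n
  simp only [fourierPair, inner_smul_left, hu n, map_mul, Complex.conj_I, Complex.conj_ofReal]
    at hn
  rw [inner_fourierBasis_resolventFour, hn]
  have hne := four_add_sq_ne_zero (waveNumber L n)
  push_cast
  field_simp
  linear_combination (-(waveNumber L n : ℂ) ^ 2) * inner ℂ (fourierBasis (T := L) n) u.1 *
    Complex.I_sq

theorem exists_hasDerivAt_resolventFour (v : L2per L) :
    ∃ U U' : C(AddCircle L, ℂ), ContinuousMap.toLp 2 haarAddCircle ℂ U = resolventFour L v ∧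
      (ContinuousMap.toLp 2 haarAddCircle ℂ U, ContinuousMap.toLp 2 haarAddCircle ℂ U') ∈
        weakDerivGraph L ∧
      (∀ x : ℝ, HasDerivAt (fun y : ℝ => U (y : AddCircle L)) (U' (x : AddCircle L)) x) := by
  set r : ℤ → ℝ := fun n => 1 / (4 + waveNumber L n ^ 2)
  have hr : ∀ n, 0 < r n ∧ r n ≤ 1 ∧ waveNumber L n ^ 2 * r n ≤ 1 := fun n => by
    refine ⟨by positivity, ?_, ?_⟩
    · rw [div_le_one (by positivity)]
      nlinarith [sq_nonneg (waveNumber L n)]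
    · rw [mul_one_div, div_le_one (by positivity)]
      linarith
  have he : Summable fun n => (r n : ℂ) * inner ℂ (fourierBasis (T := L) n) v :=
    summable_mul_inner_fourierBasis v fun n => by
      rw [Complex.norm_real, Real.norm_eq_abs, sq_abs]
      nlinarith [hr n]
  have he' : Summable fun n => Complex.I * waveNumber L n *
      ((r n : ℂ) * inner ℂ (fourierBasis (T := L) n) v) := by
    simp_rw [← mul_assoc]
    refine summable_mul_inner_fourierBasis v fun n => ?_
    rw [mul_assoc, norm_mul, Complex.norm_I, one_mul, ← Complex.ofReal_mul, Complex.norm_real,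
      Real.norm_eq_abs, sq_abs, mul_pow]
    nlinarith [hr n]
  refine ⟨_, _, ?_, fun n => ?_, hasDerivAt_tsum_smul_fourier he he'⟩
  · refine eq_of_forall_inner_hilbertBasis fourierBasis fun n => ?_
    rw [inner_fourierBasis_toLp_tsum he, inner_fourierBasis_resolventFour]
  · rw [inner_fourierBasis_toLp_tsum he, inner_fourierBasis_toLp_tsum he']

end Resolvent

section Represents

variable {L : ℝ} [Fact (0 < L)] {x₀ : ℝ} {v w : L2per L} {g h : ℝ → ℂ}

/-- The function `g` on `(x₀, x₀ + L]` represents the element `v` of `L²_per`. -/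
def Represents (x₀ : ℝ) (v : L2per L) (g : ℝ → ℂ) : Prop :=
  ∀ᵐ x : ℝ ∂(volume.restrict (Set.Ioc x₀ (x₀ + L))), v (x : AddCircle L) = g x

theorem ae_restrict_Ioc_of_ae_haarAddCircle {p : AddCircle L → Prop}
    (hp : ∀ᵐ t ∂haarAddCircle, p t) :
    ∀ᵐ x : ℝ ∂(volume.restrict (Set.Ioc x₀ (x₀ + L))), p (x : AddCircle L) := by
  refine (AddCircle.measurePreserving_mk L x₀).quasiMeasurePreserving.ae ?_
  rw [volume_eq_smul_haarAddCircle]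
  exact Measure.ae_smul_measure hp _

theorem exists_represents (hg : MemLp g 2 (volume.restrict (Set.Ioc x₀ (x₀ + L)))) :
    ∃ v : L2per L, Represents x₀ v g := by
  have hlift := hg.memLp_liftIoc.haarAddCircle
  refine ⟨hlift.toLp, ?_⟩
  filter_upwards [ae_restrict_Ioc_of_ae_haarAddCircle hlift.coeFn_toLp,
    ae_restrict_mem measurableSet_Ioc] with x hx hmem
  rw [hx, liftIoc_coe_apply hmem]

theorem represents_zero : Represents x₀ (0 : L2per L) 0 :=
  ae_restrict_Ioc_of_ae_haarAddCircle (Lp.coeFn_zero ℂ 2 haarAddCircle)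

theorem represents_toLp (U : C(AddCircle L, ℂ)) :
    Represents x₀ (ContinuousMap.toLp 2 haarAddCircle ℂ U) (fun x => U (x : AddCircle L)) :=
  ae_restrict_Ioc_of_ae_haarAddCircle (ContinuousMap.coeFn_toLp haarAddCircle U)

theorem represents_fourierBasis (n : ℤ) :
    Represents x₀ (fourierBasis (T := L) n) (fun x => fourier n (x : AddCircle L)) := by
  rw [coe_fourierBasis]
  exact represents_toLp (fourier n)

namespace Represents

theorem add (hv : Represents x₀ v g) (hw : Represents x₀ w h) :
    Represents x₀ (v + w) (g + h) := by
  filter_upwards [hv, hw, ae_restrict_Ioc_of_ae_haarAddCircle (Lp.coeFn_add v w)]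
    with x hvx hwx hadd
  rw [hadd, Pi.add_apply, Pi.add_apply, hvx, hwx]

theorem smul (hv : Represents x₀ v g) (r : ℂ) : Represents x₀ (r • v) (r • g) := by
  filter_upwards [hv, ae_restrict_Ioc_of_ae_haarAddCircle (Lp.coeFn_smul r v)] with x hvx hsmul
  rw [hsmul, Pi.smul_apply, Pi.smul_apply, hvx]

theorem mulOp (hv : Represents x₀ v g) (V : C(AddCircle L, ℂ)) :
    Represents x₀ (mulOp V v) (fun x => V (x : AddCircle L) * g x) := by
  filter_upwards [hv, ae_restrict_Ioc_of_ae_haarAddCircle (mulOp_coeFn V v)] with x hvx hmul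
  rw [hmul, hvx]

theorem congr (hv : Represents x₀ v g) (hgh : Set.EqOn g h (Set.Ioc x₀ (x₀ + L))) :
    Represents x₀ v h := by
  filter_upwards [hv, ae_restrict_mem measurableSet_Ioc] with x hvx hmem
  rw [hvx, hgh hmem]

theorem inner_eq (hv : Represents x₀ v g) (hw : Represents x₀ w h) :
    inner ℂ v w = (L : ℂ)⁻¹ * ∫ x in x₀..x₀ + L, (starRingEnd ℂ) (g x) * h x := by
  have hL : (0 : ℝ) < L := Fact.out
  rw [L2.inner_def, integral_haarAddCircle, ← AddCircle.intervalIntegral_preimage L x₀,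
    Complex.real_smul, Complex.ofReal_inv]
  congr 1
  refine intervalIntegral.integral_congr_ae_restrict ?_
  rw [Set.uIoc_of_le (by linarith)]
  filter_upwards [hv, hw] with x hvx hwx
  rw [RCLike.inner_apply, hvx, hwx, mul_comm]

theorem eqOn (hv : Represents x₀ v g) (hv' : Represents x₀ v h)
    (hg : ContinuousOn g (Set.Icc x₀ (x₀ + L))) (hh : ContinuousOn h (Set.Icc x₀ (x₀ + L))) :
    Set.EqOn g h (Set.Ioc x₀ (x₀ + L)) := by
  refine Measure.eqOn_Ioc_of_ae_eq volume ?_ (hg.mono Set.Ioc_subset_Icc_self)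
    (hh.mono Set.Ioc_subset_Icc_self)
  filter_upwards [hv, hv'] with x hvx hvx'
  rw [← hvx, hvx']

theorem unique (hv : Represents x₀ v g) (hw : Represents x₀ w g) : v = w := by
  have hsub : Represents x₀ (v - w) 0 := by
    rw [sub_eq_add_neg, ← neg_one_smul ℂ w]
    exact (hv.add (hw.smul (-1))).congr fun x _ => by simp
  have hinner : inner ℂ (v - w) (v - w) = (0 : ℂ) := by rw [hsub.inner_eq hsub]; simp
  exact sub_eq_zero.mp (inner_self_eq_zero.mp hinner)

end Represents

theorem mem_weakDerivGraph_of_represents {η : L2per L × L2per L} {g' : ℝ → ℂ}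
    (hη : Represents x₀ η.1 g) (hη' : Represents x₀ η.2 g')
    (hg : ContinuousOn g (Set.Icc x₀ (x₀ + L))) (hper : g (x₀ + L) = g x₀)
    (hd : ∀ x ∈ Set.Ioo x₀ (x₀ + L), HasDerivWithinAt g (g' x) (Set.Ioi x) x)
    (hi : IntervalIntegrable g' volume x₀ (x₀ + L)) : η ∈ weakDerivGraph L := by
  intro n
  have hL : (0 : ℝ) < L := Fact.out
  have hle : x₀ ≤ x₀ + L := by linarith
  have hcont : Continuous fun x : ℝ => (fourier (-n) (x : AddCircle L) : ℂ) :=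
    (map_continuous (fourier (-n))).comp (AddCircle.continuous_mk' _)
  have hparts := intervalIntegral.integral_mul_deriv_eq_deriv_mul_of_hasDeriv_right
    (u := fun x : ℝ => (fourier (-n) (x : AddCircle L) : ℂ)) (v := g)
    hcont.continuousOn (by rwa [Set.uIcc_of_le hle])
    (fun x _ => (hasDerivAt_fourier_waveNumber (-n) x).hasDerivWithinAt)
    (fun x hx => hd x (by simpa [hle] using hx))
    ((continuous_const.mul hcont).intervalIntegrable _ _) hi
  have hend : ((x₀ + L : ℝ) : AddCircle L) = (x₀ : AddCircle L) := by simp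
  rw [(represents_fourierBasis n).inner_eq hη', (represents_fourierBasis n).inner_eq hη]
  simp_rw [← fourier_neg]
  rw [hparts, hend, hper, sub_self, zero_sub]
  simp_rw [mul_assoc (Complex.I * (waveNumber L (-n) : ℂ))]
  rw [intervalIntegral.integral_const_mul]
  unfold waveNumber
  push_cast
  ring

end Represents

section Multiplication

variable {L : ℝ} [Fact (0 < L)]

/-- Multiplication operators as a `*`-representation of the continuous functions on the circle. -/
def mulOpHom (L : ℝ) [Fact (0 < L)] : C(AddCircle L, ℂ) →⋆ₐ[ℂ] (L2per L →L[ℂ] L2per L) where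
  toFun := mulOp
  map_one' := by
    ext v : 1
    refine Lp.ext ?_
    filter_upwards [mulOp_coeFn 1 v] with t ht
    rw [ht, ContinuousMap.one_apply, one_mul, one_apply_eq_self]
  map_mul' V W := by
    ext v : 1
    refine Lp.ext ?_
    rw [mul_apply_eq_comp]
    filter_upwards [mulOp_coeFn (V * W) v, mulOp_coeFn V (mulOp W v), mulOp_coeFn W v]
      with t hVW hV hW
    rw [hVW, hV, hW, ContinuousMap.mul_apply, mul_assoc]
  map_zero' := by
    ext v : 1
    refine Lp.ext ?_
    rw [zero_apply]
    filter_upwards [mulOp_coeFn 0 v, Lp.coeFn_zero ℂ 2 (haarAddCircle (T := L))] with t ht h0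
    rw [ht, h0, ContinuousMap.zero_apply, zero_mul, Pi.zero_apply]
  map_add' V W := by
    ext v : 1
    refine Lp.ext ?_
    rw [add_apply]
    filter_upwards [mulOp_coeFn (V + W) v, mulOp_coeFn V v, mulOp_coeFn W v,
      Lp.coeFn_add (mulOp V v) (mulOp W v)] with t hVW hV hW hadd
    rw [hVW, hadd, Pi.add_apply, hV, hW, ContinuousMap.add_apply, add_mul]
  commutes' z := by
    ext v : 1
    refine Lp.ext ?_
    rw [ContinuousLinearMap.algebraMap_apply]
    filter_upwards [mulOp_coeFn (algebraMap ℂ C(AddCircle L, ℂ) z) v, Lp.coeFn_smul z v]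
      with t hz hsmul
    rw [hz, hsmul, algebraMap_apply, Pi.smul_apply, smul_eq_mul, smul_eq_mul, mul_one]
  map_star' V := by
    refine (ContinuousLinearMap.eq_adjoint_iff _ _).mpr fun v w => ?_
    rw [L2.inner_def, L2.inner_def]
    refine integral_congr_ae ?_
    filter_upwards [mulOp_coeFn (star V) v, mulOp_coeFn V w] with t hV hW
    rw [hV, hW, RCLike.inner_apply, RCLike.inner_apply, ContinuousMap.star_apply, map_mul,
      RCLike.star_def, RCLike.conj_conj]
    ring

theorem isSelfAdjoint_mulOp {V : C(AddCircle L, ℂ)} (hV : IsSelfAdjoint V) :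
    IsSelfAdjoint (mulOp V) :=
  hV.map (mulOpHom L)

theorem mulOp_mul_mulOp_eq_one {V W : C(AddCircle L, ℂ)} (h : V * W = 1) :
    mulOp V * mulOp W = 1 :=
  ((mulOpHom L).map_mul V W).symm.trans (h ▸ map_one (mulOpHom L))

theorem spectrum_mulOp_subset_range (V : C(AddCircle L, ℂ)) :
    spectrum ℂ (mulOp V) ⊆ Set.range V :=
  (AlgHom.spectrum_apply_subset (mulOpHom L) V).trans
    (ContinuousMap.spectrum_eq_range (𝕜 := ℂ) V).subset

end Multiplication

section Energy

variable {L : ℝ} [Fact (0 < L)]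

/-- The Hermitian form of the Hill operator `-∂² + 4 - 3 c B` on pairs of a function and its weak
derivative. -/
def energyForm (c : ℝ) (B : L2per L →L[ℂ] L2per L) :
    (L2per L × L2per L) →ₗ⋆[ℂ] (L2per L × L2per L) →ₗ[ℂ] ℂ :=
  LinearMap.mk₂'ₛₗ (starRingEnd ℂ) (RingHom.id ℂ)
    (fun η ζ => inner ℂ η.2 ζ.2 + 4 * inner ℂ η.1 ζ.1 - 3 * c * inner ℂ η.1 (B ζ.1))
    (fun η η' ζ => by simp only [Prod.snd_add, Prod.fst_add, inner_add_left]; ring)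
    (fun r η ζ => by simp only [Prod.smul_snd, Prod.smul_fst, inner_smul_left, smul_eq_mul]; ring)
    (fun η ζ ζ' => by simp only [Prod.snd_add, Prod.fst_add, map_add, inner_add_right]; ring)
    (fun r η ζ => by
      simp only [Prod.smul_snd, Prod.smul_fst, map_smul, inner_smul_right, RingHom.id_apply,
        smul_eq_mul]
      ring)

variable {c : ℝ} {A B : L2per L →L[ℂ] L2per L} {η ζ u : L2per L × L2per L} {v : L2per L}

theorem energyForm_apply (c : ℝ) (B : L2per L →L[ℂ] L2per L) (η ζ : L2per L × L2per L) :
    energyForm c B η ζ =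
      inner ℂ η.2 ζ.2 + 4 * inner ℂ η.1 ζ.1 - 3 * c * inner ℂ η.1 (B ζ.1) := rfl

theorem conj_energyForm (hB : IsSelfAdjoint B) (η ζ : L2per L × L2per L) :
    (starRingEnd ℂ) (energyForm c B η ζ) = energyForm c B ζ η := by
  have hsymm : inner ℂ (B ζ.1) η.1 = inner ℂ ζ.1 (B η.1) := hB.isSymmetric ζ.1 η.1
  simp only [energyForm_apply, map_add, map_sub, map_mul, inner_conj_symm, hsymm, map_ofNat,
    Complex.conj_ofReal]

theorem energyForm_of_eq_resolventFour (hη : η ∈ weakDerivGraph L) (hu : u ∈ weakDerivGraph L)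
    (huv : u.1 = resolventFour L v) :
    energyForm c B η u = inner ℂ η.1 v - 3 * c * inner ℂ η.1 (B u.1) := by
  rw [energyForm_apply, inner_eq_of_mem_weakDerivGraph hη hu huv]

theorem inner_sub_resolventFour (hA : IsSelfAdjoint A) (hAB : A * B = 1)
    (hu : u ∈ weakDerivGraph L) (huv : u.1 = resolventFour L v) :
    inner ℂ v ((A - ((3 * c : ℝ) : ℂ) • resolventFour L) v) =
      inner ℂ (v - ((3 * c : ℝ) : ℂ) • B u.1) (A (v - ((3 * c : ℝ) : ℂ) • B u.1)) +
      3 * c * energyForm c B u u := by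
  have hABu : A (B u.1) = u.1 := DFunLike.congr_fun hAB u.1
  have hBAv : inner ℂ (B u.1) (A v) = inner ℂ u.1 v := by
    rw [← hA.isSymmetric.apply_clm, hABu]
  have hBu : inner ℂ (B u.1) u.1 = inner ℂ u.1 (B u.1) := by
    rw [← congrArg (inner ℂ (B u.1)) hABu, ← hA.isSymmetric.apply_clm, hABu]
  rw [energyForm_of_eq_resolventFour hu hu huv]
  simp only [sub_apply, smul_apply, ← huv, map_sub, map_smul, inner_sub_left, inner_sub_right,
    inner_smul_left, inner_smul_right, hABu, hBAv, hBu, Complex.conj_ofReal]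
  push_cast
  ring

theorem three_mul_energyForm_self (hAB : A * B = 1) (hη : η ∈ weakDerivGraph L)
    (hu : u ∈ weakDerivGraph L)
    (huv : u.1 = resolventFour L (((3 * c : ℝ) : ℂ) • B η.1)) :
    3 * c * energyForm c B η η =
      inner ℂ (((3 * c : ℝ) : ℂ) • B η.1)
        ((A - ((3 * c : ℝ) : ℂ) • resolventFour L) (((3 * c : ℝ) : ℂ) • B η.1)) +
      3 * c * (inner ℂ (η.2 - u.2) (η.2 - u.2) + 4 * inner ℂ (η.1 - u.1) (η.1 - u.1)) := by
  set v := ((3 * c : ℝ) : ℂ) • B η.1 with hv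
  have hconj : ∀ {ζ : L2per L × L2per L}, ζ ∈ weakDerivGraph L →
      inner ℂ v ζ.1 = inner ℂ u.2 ζ.2 + 4 * inner ℂ u.1 ζ.1 := fun {ζ} hζ => by
    rw [← inner_conj_symm, inner_eq_of_mem_weakDerivGraph hζ hu huv, map_add, map_mul,
      inner_conj_symm, inner_conj_symm, map_ofNat]
  have hAv : A v = ((3 * c : ℝ) : ℂ) • η.1 := by
    rw [hv, map_smul, ← mul_apply_eq_comp A, hAB, one_apply_eq_self]
  have hηv : inner ℂ η.1 v = 3 * c * inner ℂ η.1 (B η.1) := by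
    rw [hv, inner_smul_right]; push_cast; ring
  rw [energyForm_apply, sub_apply, smul_apply, hAv, ← huv]
  simp only [inner_sub_left, inner_sub_right, inner_smul_right]
  push_cast
  linear_combination (-3 * (c : ℂ)) * inner_eq_of_mem_weakDerivGraph hη hu huv
    - 3 * (c : ℂ) * hconj hη + 3 * (c : ℂ) * hconj hu + 3 * (c : ℂ) * hηv

theorem re_inner_le_energyForm (hAB : A * B = 1) (hc : 0 ≤ c) (hη : η ∈ weakDerivGraph L) :
    (inner ℂ (((3 * c : ℝ) : ℂ) • B η.1)
      ((A - ((3 * c : ℝ) : ℂ) • resolventFour L) (((3 * c : ℝ) : ℂ) • B η.1))).re ≤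
      3 * c * (energyForm c B η η).re := by
  obtain ⟨U, U', hU, hmem, -⟩ := exists_hasDerivAt_resolventFour (((3 * c : ℝ) : ℂ) • B η.1)
  have hre := congrArg Complex.re (three_mul_energyForm_self hAB hη hmem hU)
  have h3c : (3 * c : ℂ) = ((3 * c : ℝ) : ℂ) := by push_cast; ring
  rw [h3c, ← Complex.ofReal_ofNat 4, Complex.add_re, Complex.re_ofReal_mul, Complex.re_ofReal_mul,
    Complex.add_re, Complex.re_ofReal_mul] at hre
  rw [hre]
  refine le_add_of_nonneg_right (mul_nonneg (by linarith) (add_nonneg ?_ (mul_nonneg ?_ ?_)))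
  · exact inner_self_nonneg (𝕜 := ℂ)
  · norm_num
  · exact inner_self_nonneg (𝕜 := ℂ)

theorem eq_smul_of_apply_eq_zero (hBA : B * A = 1)
    (hv : (A - ((3 * c : ℝ) : ℂ) • resolventFour L) v = 0) :
    v = ((3 * c : ℝ) : ℂ) • B (resolventFour L v) := by
  rw [sub_apply, smul_apply, sub_eq_zero] at hv
  rw [← map_smul, ← hv, ← mul_apply_eq_comp B, hBA, one_apply_eq_self]

theorem energyForm_eq_zero_of_apply_eq_zero (hBA : B * A = 1) (hη : η ∈ weakDerivGraph L)
    (hu : u ∈ weakDerivGraph L) (huv : u.1 = resolventFour L v)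
    (hv : (A - ((3 * c : ℝ) : ℂ) • resolventFour L) v = 0) : energyForm c B η u = 0 := by
  have hvB := congrArg (inner ℂ η.1) (eq_smul_of_apply_eq_zero hBA hv)
  rw [← huv, inner_smul_right] at hvB
  rw [energyForm_of_eq_resolventFour hη hu huv, hvB]
  push_cast
  ring

theorem resolventFour_smul_of_energyForm_eq_zero (hu : u ∈ weakDerivGraph L)
    (h : ∀ n : ℤ, energyForm c B (fourierPair L n) u = 0) :
    resolventFour L (((3 * c : ℝ) : ℂ) • B u.1) = u.1 := by
  refine resolventFour_eq_of_forall_fourierPair hu fun n => ?_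
  have hn := h n
  rw [energyForm_apply] at hn
  rw [inner_smul_right]
  push_cast
  linear_combination -hn

theorem apply_eq_zero_of_resolventFour_smul (hAB : A * B = 1) {η : L2per L}
    (h : resolventFour L (((3 * c : ℝ) : ℂ) • B η) = η) :
    (A - ((3 * c : ℝ) : ℂ) • resolventFour L) (((3 * c : ℝ) : ℂ) • B η) = 0 := by
  rw [sub_apply, smul_apply, h, map_smul, ← mul_apply_eq_comp A, hAB, one_apply_eq_self, sub_self]

end Energy

section Lift

theorem memLp_two_of_continuousOn {a b : ℝ} {g : ℝ → ℂ} (hg : ContinuousOn g (Set.Icc a b)) :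
    MemLp g 2 (volume.restrict (Set.Ioc a b)) := by
  obtain ⟨C, hC⟩ := isCompact_Icc.exists_bound_of_continuousOn hg
  refine MemLp.of_bound ((hg.mono Set.Ioc_subset_Icc_self).aestronglyMeasurable measurableSet_Ioc)
    C ?_
  filter_upwards [ae_restrict_mem measurableSet_Ioc] with x hx
  exact hC x (Set.Ioc_subset_Icc_self hx)

variable {L : ℝ} [Fact (0 < L)] {x₀ : ℝ}

theorem le_add_period (x₀ : ℝ) : x₀ ≤ x₀ + L :=
  (lt_add_of_pos_right x₀ (Fact.out : 0 < L)).le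

/-- The pair `η` in `L²_per` is represented on `(x₀, x₀ + L]` by a continuous function `g` with
equal values at the ends and by its square integrable right derivative `g'`. -/
structure IsLift (x₀ : ℝ) (η : L2per L × L2per L) (g g' : ℝ → ℂ) : Prop where
  rep : Represents x₀ η.1 g
  rep' : Represents x₀ η.2 g'
  cont : ContinuousOn g (Set.Icc x₀ (x₀ + L))
  per : g (x₀ + L) = g x₀
  deriv : ∀ x ∈ Set.Ioo x₀ (x₀ + L), HasDerivWithinAt g (g' x) (Set.Ioi x) x
  memLp : MemLp g' 2 (volume.restrict (Set.Ioc x₀ (x₀ + L)))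

namespace IsLift

variable {η ζ : L2per L × L2per L} {g g' f f' : ℝ → ℂ}

theorem intervalIntegrable (h : IsLift x₀ η g g') :
    IntervalIntegrable g' volume x₀ (x₀ + L) := by
  rw [intervalIntegrable_iff_integrableOn_Ioc_of_le (le_add_period x₀)]
  exact h.memLp.integrable one_le_two

theorem mem_weakDerivGraph (h : IsLift x₀ η g g') : η ∈ weakDerivGraph L :=
  mem_weakDerivGraph_of_represents h.rep h.rep' h.cont h.per h.deriv h.intervalIntegrable

theorem add (h : IsLift x₀ η g g') (k : IsLift x₀ ζ f f') :
    IsLift x₀ (η + ζ) (g + f) (g' + f') where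
  rep := h.rep.add k.rep
  rep' := h.rep'.add k.rep'
  cont := h.cont.add k.cont
  per := congrArg₂ (· + ·) h.per k.per
  deriv x hx := (h.deriv x hx).add (k.deriv x hx)
  memLp := h.memLp.add k.memLp

theorem smul (h : IsLift x₀ η g g') (r : ℂ) : IsLift x₀ (r • η) (r • g) (r • g') where
  rep := h.rep.smul r
  rep' := h.rep'.smul r
  cont := h.cont.const_smul r
  per := congrArg (r • ·) h.per
  deriv x hx := (h.deriv x hx).const_smul r
  memLp := h.memLp.const_smul r

theorem of_hasDerivAt (h : Represents x₀ η.1 g) (h' : Represents x₀ η.2 g')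
    (hd : ∀ x, HasDerivAt g (g' x) x) (hc : Continuous g') (per : g (x₀ + L) = g x₀) :
    IsLift x₀ η g g' where
  rep := h
  rep' := h'
  cont x _ := (hd x).continuousAt.continuousWithinAt
  per := per
  deriv x _ := (hd x).hasDerivWithinAt
  memLp := memLp_two_of_continuousOn hc.continuousOn

end IsLift

theorem exists_isLift {g g' : ℝ → ℂ} (cont : ContinuousOn g (Set.Icc x₀ (x₀ + L)))
    (per : g (x₀ + L) = g x₀)
    (deriv : ∀ x ∈ Set.Ioo x₀ (x₀ + L), HasDerivWithinAt g (g' x) (Set.Ioi x) x)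
    (memLp : MemLp g' 2 (volume.restrict (Set.Ioc x₀ (x₀ + L)))) :
    ∃ η : L2per L × L2per L, IsLift x₀ η g g' := by
  obtain ⟨η, hη⟩ := exists_represents (memLp_two_of_continuousOn cont)
  obtain ⟨η', hη'⟩ := exists_represents memLp
  exact ⟨(η, η'), hη, hη', cont, per, deriv, memLp⟩

theorem exists_isLift_ofReal {g g' : ℝ → ℝ} (hd : ∀ x, HasDerivAt g (g' x) x)
    (hc : Continuous g') (per : g (x₀ + L) = g x₀) :
    ∃ η : L2per L × L2per L, IsLift x₀ η (fun x => (g x : ℂ)) (fun x => (g' x : ℂ)) :=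
  exists_isLift (fun x _ => (hd x).ofReal_comp.continuousAt.continuousWithinAt)
    (congrArg Complex.ofReal per) (fun x _ => (hd x).ofReal_comp.hasDerivWithinAt)
    (memLp_two_of_continuousOn (Complex.continuous_ofReal.comp hc).continuousOn)

theorem isLift_fourierPair (n : ℤ) : IsLift x₀ (fourierPair L n)
    (fun x => fourier n (x : AddCircle L))
    (fun x => (Complex.I * waveNumber L n) * fourier n (x : AddCircle L)) :=
  IsLift.of_hasDerivAt (represents_fourierBasis n) ((represents_fourierBasis n).smul _)
    (hasDerivAt_fourier_waveNumber n) (continuous_const.mul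
      ((map_continuous (fourier n)).comp (AddCircle.continuous_mk' _))) (by simp)

theorem exists_isLift_resolventFour (v : L2per L) :
    ∃ (u : L2per L × L2per L) (U U' : ℝ → ℂ), u.1 = resolventFour L v ∧ IsLift x₀ u U U' ∧
      (∀ x, HasDerivAt U (U' x) x) ∧ Continuous U' := by
  obtain ⟨U, U', hU, -, hd⟩ := exists_hasDerivAt_resolventFour v
  have hc : Continuous fun x : ℝ => U' (x : AddCircle L) :=
    U'.continuous.comp (AddCircle.continuous_mk' _)
  exact ⟨(_, _), _, _, hU,
    IsLift.of_hasDerivAt (represents_toLp U) (represents_toLp U') hd hc (by simp), hd, hc⟩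

theorem integral_conj_mul_solution {s t : ℝ} (hst : s ≤ t) {g g' : ℝ → ℂ}
    (hg : ContinuousOn g (Set.Icc s t))
    (hd : ∀ x ∈ Set.Ioo s t, HasDerivWithinAt g (g' x) (Set.Ioi x) x)
    (hi : IntervalIntegrable g' volume s t) {F Z q : ℝ → ℝ} (hF : Continuous F)
    (hq : Continuous q) (hZ : Continuous Z)
    (hZd : ∀ x ∈ Set.Ioo s t, HasDerivAt Z (q x * F x) x) :
    ∫ x in s..t, ((starRingEnd ℂ) (g' x) * (Z x : ℂ) +
      (q x : ℂ) * ((starRingEnd ℂ) (g x) * (F x : ℂ))) =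
      (starRingEnd ℂ) (g t) * (Z t : ℂ) - (starRingEnd ℂ) (g s) * (Z s : ℂ) := by
  have hgc : ContinuousOn (fun x => (starRingEnd ℂ) (g x)) (Set.Icc s t) :=
    Complex.continuous_conj.comp_continuousOn hg
  have hZc : Continuous fun x => (Z x : ℂ) := Complex.continuous_ofReal.comp hZ
  have hi' : IntervalIntegrable (fun x => (starRingEnd ℂ) (g' x)) volume s t :=
    ⟨Complex.conjCLE.toContinuousLinearMap.integrable_comp hi.1,
      Complex.conjCLE.toContinuousLinearMap.integrable_comp hi.2⟩
  refine intervalIntegral.integral_eq_sub_of_hasDeriv_right_of_le hst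
    (hgc.mul hZc.continuousOn) (fun x hx => ?_) ?_
  · have hconj : HasDerivWithinAt (fun x => (starRingEnd ℂ) (g x)) ((starRingEnd ℂ) (g' x))
        (Set.Ioi x) x :=
      Complex.conjCLE.toContinuousLinearMap.hasFDerivAt.comp_hasDerivWithinAt x (hd x hx)
    refine (hconj.mul (hZd x hx).ofReal_comp.hasDerivWithinAt).congr_deriv ?_
    push_cast
    ring
  · refine (hi'.mul_continuousOn hZc.continuousOn).add (ContinuousOn.intervalIntegrable ?_)
    rw [Set.uIcc_of_le hst]
    exact (Complex.continuous_ofReal.comp hq).continuousOn.mul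
      (hgc.mul (Complex.continuous_ofReal.comp hF).continuousOn)

namespace IsLift

variable {c : ℝ} {W : C(AddCircle L, ℂ)} {w q : ℝ → ℝ} {η ζ : L2per L × L2per L}

theorem intervalIntegrable_conj_mul {g g' f f' : ℝ → ℂ} (hη : IsLift x₀ η g g')
    (hζ : IsLift x₀ ζ f f') :
    IntervalIntegrable (fun x => (starRingEnd ℂ) (g' x) * f' x) volume x₀ (x₀ + L) := by
  rw [intervalIntegrable_iff_integrableOn_Ioc_of_le (le_add_period x₀)]
  exact hη.memLp.star.integrable_mul hζ.memLp

theorem energyForm_eq (hW : ∀ x : ℝ, W (x : AddCircle L) = ((w x)⁻¹ : ℝ))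
    (hq : ∀ x, q x = 4 - 3 * c / w x) {g g' f f' : ℝ → ℂ}
    (hη : IsLift x₀ η g g') (hζ : IsLift x₀ ζ f f') :
    energyForm c (mulOp W) η ζ = (L : ℂ)⁻¹ * ∫ x in x₀..x₀ + L,
      ((starRingEnd ℂ) (g' x) * f' x + (q x : ℂ) * ((starRingEnd ℂ) (g x) * f x)) := by
  have hle : x₀ ≤ x₀ + L := le_add_period x₀
  have hWc : Continuous fun x : ℝ => W (x : AddCircle L) :=
    W.continuous.comp (AddCircle.continuous_mk' _)
  have hgc : ContinuousOn (fun x => (starRingEnd ℂ) (g x)) (Set.uIcc x₀ (x₀ + L)) := by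
    rw [Set.uIcc_of_le hle]
    exact Complex.continuous_conj.comp_continuousOn hη.cont
  have hfc : ContinuousOn f (Set.uIcc x₀ (x₀ + L)) := Set.uIcc_of_le hle ▸ hζ.cont
  have hi' := hη.intervalIntegrable_conj_mul hζ
  have hi : IntervalIntegrable (fun x => 4 * ((starRingEnd ℂ) (g x) * f x)) volume x₀ (x₀ + L) :=
    (hgc.mul hfc).intervalIntegrable.const_mul 4
  have hiW : IntervalIntegrable (fun x => 3 * c * ((starRingEnd ℂ) (g x) *
      (W (x : AddCircle L) * f x))) volume x₀ (x₀ + L) :=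
    (hgc.mul (hWc.continuousOn.mul hfc)).intervalIntegrable.const_mul (3 * c : ℂ)
  rw [energyForm_apply, hη.rep'.inner_eq hζ.rep', hη.rep.inner_eq hζ.rep,
    hη.rep.inner_eq (hζ.rep.mulOp W), mul_left_comm (4 : ℂ), mul_left_comm (3 * c : ℂ), ← mul_add,
    ← mul_sub, ← intervalIntegral.integral_const_mul, ← intervalIntegral.integral_const_mul,
    ← intervalIntegral.integral_add hi' hi, ← intervalIntegral.integral_sub (hi'.add hi) hiW]
  refine congrArg _ (intervalIntegral.integral_congr fun x _ => ?_)
  simp only [hW x, hq x]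
  push_cast
  ring

theorem energyForm_solution (hW : ∀ x : ℝ, W (x : AddCircle L) = ((w x)⁻¹ : ℝ))
    (hq : ∀ x, q x = 4 - 3 * c / w x) (hqc : Continuous q) {g g' : ℝ → ℂ} {F Z : ℝ → ℝ}
    (hη : IsLift x₀ η g g') (hζ : IsLift x₀ ζ (fun x => (F x : ℂ)) (fun x => (Z x : ℂ)))
    (hF : Continuous F) (hZ : Continuous Z)
    (hZd : ∀ x ∈ Set.Ioo x₀ (x₀ + L), HasDerivAt Z (q x * F x) x) :
    energyForm c (mulOp W) η ζ =
      (L : ℂ)⁻¹ * ((starRingEnd ℂ) (g x₀) * ((Z (x₀ + L) : ℂ) - (Z x₀ : ℂ))) := by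
  rw [hη.energyForm_eq hW hq hζ, integral_conj_mul_solution (le_add_period x₀) hη.cont hη.deriv
    hη.intervalIntegrable hF hqc hZ hZd, hη.per]
  ring

end IsLift

end Lift

/-! ### The turning points and the period -/

section TurningPoints

/-- The polynomial for which the first-order invariant, in the variable `w = c - φ`, reads
`(w w')² = quartic c b w - a`. -/
def quartic (c b w : ℝ) : ℝ := w ^ 2 * ((c - w) ^ 2 + b)

/-- The force of the wave equation `(w w')' = force c b w`, which is the derivative of
`quartic c b` divided by `2 w`. -/
def force (c b w : ℝ) : ℝ := c ^ 2 + b - 3 * c * w + 2 * w ^ 2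

theorem hasDerivAt_quartic (c b w : ℝ) :
    HasDerivAt (quartic c b) (2 * w * force c b w) w := by
  have h1 : HasDerivAt (fun w : ℝ => w ^ 2) (2 * w) w := by simpa using hasDerivAt_pow 2 w
  have h2 : HasDerivAt (fun w : ℝ => (c - w) ^ 2 + b) (2 * (c - w) * (-1)) w := by
    simpa using (((hasDerivAt_id w).const_sub c).pow 2).add_const b
  refine (h1.mul h2).congr_deriv ?_
  unfold force
  ring

variable {c a b : ℝ}

theorem hasDerivAt_cubic (c p : ℝ) :
    HasDerivAt (fun p : ℝ => p * (c - p) ^ 3) ((c - p) ^ 2 * (c - 4 * p)) p := by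
  have h : HasDerivAt (fun w : ℝ => (c - w) ^ 3) (3 * (c - p) ^ 2 * (-1)) p := by
    simpa using ((hasDerivAt_id p).const_sub c).fun_pow 3
  refine ((hasDerivAt_id p).mul h).congr_deriv ?_
  simp only [id]
  ring

theorem strictMonoOn_cubic (c : ℝ) :
    StrictMonoOn (fun p : ℝ => p * (c - p) ^ 3) (Set.Icc 0 (c / 4)) := by
  refine strictMonoOn_of_deriv_pos (convex_Icc _ _) (by fun_prop) fun p hp => ?_
  rw [interior_Icc] at hp
  rw [(hasDerivAt_cubic c p).deriv]
  have : 0 < c - p := by linarith [hp.1, hp.2]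
  exact mul_pos (by positivity) (by linarith [hp.2])

theorem strictAntiOn_cubic (c : ℝ) :
    StrictAntiOn (fun p : ℝ => p * (c - p) ^ 3) (Set.Icc (c / 4) c) := by
  refine strictAntiOn_of_deriv_neg (convex_Icc _ _) (by fun_prop) fun p hp => ?_
  rw [interior_Icc] at hp
  rw [(hasDerivAt_cubic c p).deriv]
  have : 0 < c - p := by linarith [hp.2]
  exact mul_neg_of_pos_of_neg (by positivity) (by linarith [hp.1])

theorem sInf_eq_of_injOn {α : Type*} {f : ℝ → α} {s t : Set ℝ} (hf : s.InjOn f) (hts : t ⊆ s)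
    {p : ℝ} {y : α} (hp : p ∈ t) (hy : f p = y) : sInf {q | q ∈ t ∧ f q = y} = p := by
  have : {q | q ∈ t ∧ f q = y} = {p} := Set.eq_singleton_iff_unique_mem.mpr
    ⟨⟨hp, hy⟩, fun q hq => hf (hts hq.1) (hts hp) (hq.2.trans hy.symm)⟩
  rw [this, csInf_singleton]

theorem saddle_spec (hc : 0 < c) (ha : 0 < a) (ha' : a < 27 / 256 * c ^ 4) :
    saddle c a ∈ Set.Ioo 0 (c / 4) ∧ saddle c a * (c - saddle c a) ^ 3 = a := by
  have hcont : ContinuousOn (fun p : ℝ => p * (c - p) ^ 3) (Set.Icc 0 (c / 4)) := by fun_prop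
  have hmax : c / 4 * (c - c / 4) ^ 3 = 27 / 256 * c ^ 4 := by ring
  obtain ⟨p, hp, hpa⟩ := intermediate_value_Ioo (by linarith) hcont
    (show a ∈ _ from ⟨by simpa using ha, hmax ▸ ha'⟩)
  rw [saddle, sInf_eq_of_injOn (strictMonoOn_cubic c).injOn Set.Ioo_subset_Icc_self hp hpa]
  exact ⟨hp, hpa⟩

theorem center_spec (hc : 0 < c) (ha : 0 < a) (ha' : a < 27 / 256 * c ^ 4) :
    center c a ∈ Set.Ioo (c / 4) c ∧ center c a * (c - center c a) ^ 3 = a := by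
  have hcont : ContinuousOn (fun p : ℝ => p * (c - p) ^ 3) (Set.Icc (c / 4) c) := by fun_prop
  have hmax : c / 4 * (c - c / 4) ^ 3 = 27 / 256 * c ^ 4 := by ring
  obtain ⟨p, hp, hpa⟩ := intermediate_value_Ioo' (by linarith) hcont
    (show a ∈ _ from ⟨by simpa using ha, hmax ▸ ha'⟩)
  rw [center, sInf_eq_of_injOn (strictAntiOn_cubic c).injOn Set.Ioo_subset_Icc_self hp hpa]
  exact ⟨hp, hpa⟩

theorem lt_cubic_iff (hc : 0 < c) (ha : 0 < a) (ha' : a < 27 / 256 * c ^ 4) {p : ℝ}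
    (hp : p ∈ Set.Ioo 0 c) :
    a < p * (c - p) ^ 3 ↔ p ∈ Set.Ioo (saddle c a) (center c a) := by
  obtain ⟨hs, hsa⟩ := saddle_spec hc ha ha'
  obtain ⟨hr, hra⟩ := center_spec hc ha ha'
  rcases le_total p (c / 4) with h | h
  · have := (strictMonoOn_cubic c).lt_iff_lt ⟨hs.1.le, hs.2.le⟩ ⟨hp.1.le, h⟩
    simp only [hsa] at this
    rw [this]
    exact ⟨fun h' => ⟨h', h.trans_lt hr.1⟩, And.left⟩
  · have := (strictAntiOn_cubic c).lt_iff_gt ⟨hr.1.le, hr.2.le⟩ ⟨h, hp.2.le⟩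
    simp only [hra] at this
    rw [this]
    exact ⟨fun h' => ⟨hs.2.trans_le h, h'⟩, And.right⟩

theorem cubic_lt_iff (hc : 0 < c) (ha : 0 < a) (ha' : a < 27 / 256 * c ^ 4) {p : ℝ}
    (hp : p ∈ Set.Ioo (c / 4) c) : p * (c - p) ^ 3 < a ↔ center c a < p := by
  obtain ⟨hr, hra⟩ := center_spec hc ha ha'
  have := (strictAntiOn_cubic c).lt_iff_gt ⟨hp.1.le, hp.2.le⟩ ⟨hr.1.le, hr.2.le⟩
  simpa only [hra] using this

theorem hasDerivAt_potential {p : ℝ} (hp : p < c) :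
    HasDerivAt (potential c a) (2 * (a - p * (c - p) ^ 3) / (c - p) ^ 3) p := by
  have hne : c - p ≠ 0 := (sub_pos.mpr hp).ne'
  have h1 : HasDerivAt (fun w : ℝ => -w ^ 2) (-(2 * p)) p := by
    simpa using (hasDerivAt_pow 2 p).fun_neg
  have h2 : HasDerivAt (fun w : ℝ => (c - w) ^ 2) (2 * (c - p) * (-1)) p := by
    simpa using ((hasDerivAt_id p).const_sub c).fun_pow 2
  refine (h1.add ((hasDerivAt_const p a).div h2 (pow_ne_zero 2 hne))).congr_deriv ?_
  field_simp
  ring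

theorem continuousOn_potential : ContinuousOn (potential c a) (Set.Iio c) := fun _ hp =>
  (hasDerivAt_potential hp).continuousAt.continuousWithinAt

theorem strictAntiOn_potential (hc : 0 < c) (ha : 0 < a) (ha' : a < 27 / 256 * c ^ 4) :
    StrictAntiOn (potential c a) (Set.Icc (saddle c a) (center c a)) := by
  obtain ⟨hs, -⟩ := saddle_spec hc ha ha'
  obtain ⟨hr, -⟩ := center_spec hc ha ha'
  refine strictAntiOn_of_deriv_neg (convex_Icc _ _)
    (continuousOn_potential.mono fun p hp => hp.2.trans_lt hr.2) fun p hp => ?_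
  rw [interior_Icc] at hp
  have hp' : p ∈ Set.Ioo 0 c := ⟨hs.1.trans hp.1, hp.2.trans hr.2⟩
  rw [(hasDerivAt_potential hp'.2).deriv]
  exact div_neg_of_neg_of_pos (by linarith [(lt_cubic_iff hc ha ha' hp').mpr hp])
    (pow_pos (sub_pos.mpr hp'.2) 3)

theorem strictMonoOn_potential (hc : 0 < c) (ha : 0 < a) (ha' : a < 27 / 256 * c ^ 4) :
    StrictMonoOn (potential c a) (Set.Ico (center c a) c) := by
  obtain ⟨hr, -⟩ := center_spec hc ha ha'
  refine strictMonoOn_of_deriv_pos (convex_Ico _ _)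
    (continuousOn_potential.mono fun p hp => hp.2) fun p hp => ?_
  rw [interior_Ico] at hp
  rw [(hasDerivAt_potential hp.2).deriv]
  exact div_pos (by linarith [(cubic_lt_iff hc ha ha' ⟨hr.1.trans hp.1, hp.2⟩).mpr hp.1])
    (pow_pos (sub_pos.mpr hp.2) 3)

theorem sub_potential_eq_div {w : ℝ} (hw : w ≠ 0) :
    b - potential c a (c - w) = (quartic c b w - a) / w ^ 2 := by
  unfold potential quartic
  rw [sub_sub_cancel]
  field_simp
  ring

theorem potential_eq_iff {w : ℝ} (hw : w ≠ 0) :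
    potential c a (c - w) = b ↔ quartic c b w = a := by
  rw [eq_comm, ← sub_eq_zero, sub_potential_eq_div hw, div_eq_zero_iff, sub_eq_zero,
    or_iff_left (pow_ne_zero 2 hw)]

theorem sq_mul_force {w : ℝ} (h : quartic c b w = a) :
    w ^ 2 * force c b w = a - (c - w) * (c - (c - w)) ^ 3 := by
  rw [← h]
  unfold force quartic
  ring

theorem force_neg_iff (hc : 0 < c) (ha : 0 < a) (ha' : a < 27 / 256 * c ^ 4) {w : ℝ}
    (hw : w ∈ Set.Ioo 0 c) (hq : quartic c b w = a) :
    force c b w < 0 ↔ c - w ∈ Set.Ioo (saddle c a) (center c a) := by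
  rw [← lt_cubic_iff hc ha ha' ⟨by linarith [hw.2], by linarith [hw.1]⟩, ← sub_neg (b := _ * _),
    ← sq_mul_force hq, ← smul_eq_mul, smul_neg_iff_of_pos_left (pow_pos hw.1 2)]

theorem force_pos_iff (hc : 0 < c) (ha : 0 < a) (ha' : a < 27 / 256 * c ^ 4) {w : ℝ}
    (hw : w ∈ Set.Ioo 0 (3 * c / 4)) (hq : quartic c b w = a) :
    0 < force c b w ↔ center c a < c - w := by
  rw [← cubic_lt_iff hc ha ha' ⟨by linarith [hw.2], by linarith [hw.1]⟩, ← sub_pos (b := _ * _),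
    ← sq_mul_force hq, mul_pos_iff_of_pos_left (pow_pos hw.1 2)]

theorem turnLower_eq (hc : 0 < c) (ha : 0 < a) (ha' : a < 27 / 256 * c ^ 4) {w : ℝ}
    (hw : w ∈ Set.Ioo 0 c) (hq : quartic c b w = a) (hf : force c b w < 0) :
    turnLower c a b = c - w :=
  sInf_eq_of_injOn (strictAntiOn_potential hc ha ha').injOn Set.Ioo_subset_Icc_self
    ((force_neg_iff hc ha ha' hw hq).mp hf) ((potential_eq_iff hw.1.ne').mpr hq)

theorem turnUpper_eq (hc : 0 < c) (ha : 0 < a) (ha' : a < 27 / 256 * c ^ 4) {w : ℝ}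
    (hw : w ∈ Set.Ioo 0 (3 * c / 4)) (hq : quartic c b w = a) (hf : 0 < force c b w) :
    turnUpper c a b = c - w :=
  sInf_eq_of_injOn (strictMonoOn_potential hc ha ha').injOn Set.Ioo_subset_Ico_self
    ⟨(force_pos_iff hc ha ha' hw hq).mp hf, by linarith [hw.1]⟩
    ((potential_eq_iff hw.1.ne').mpr hq)

open Filter Topology in
theorem tendsto_potential_atTop (ha : 0 < a) : Tendsto (potential c a) (𝓝[<] c) atTop := by
  have hpos : ∀ᶠ p in 𝓝[<] c, 0 < (c - p) ^ 2 := by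
    filter_upwards [self_mem_nhdsWithin] with p hp using pow_pos (sub_pos.mpr hp) 2
  have hzero : Tendsto (fun p : ℝ => (c - p) ^ 2) (𝓝[<] c) (𝓝 0) :=
    ((show Continuous fun p : ℝ => (c - p) ^ 2 by fun_prop).tendsto' c 0 (by simp)).mono_left
      nhdsWithin_le_nhds
  have hdiv : Tendsto (fun p => a / (c - p) ^ 2) (𝓝[<] c) atTop :=
    (tendsto_nhdsWithin_iff.mpr ⟨hzero, hpos⟩).inv_tendsto_nhdsGT_zero.const_mul_atTop ha
  exact Tendsto.add_atTop
    ((show Continuous fun p : ℝ => -p ^ 2 by fun_prop).continuousWithinAt.tendsto) hdiv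

/-- The values `wm = c - φ₊ < wp = c - φ₋` of `w = c - φ` at the two turning points, with the
signs of the force there. -/
structure IsTurningPair (c a b wm wp : ℝ) : Prop where
  pos : 0 < wm
  lt : wm < wp
  level_pos : 0 < a
  quartic_left : quartic c b wm = a
  quartic_right : quartic c b wp = a
  force_left : 0 < force c b wm
  force_right : force c b wp < 0

open Filter Topology in
theorem exists_isTurningPair (hc : 0 < c) (hab : (a, b) ∈ existenceRegion c) :
    ∃ wm wp : ℝ, IsTurningPair c a b wm wp ∧ wm < 3 * c / 4 ∧ wp < c := by
  obtain ⟨ha : 0 < a, ha' : a < _, hb1 : _ < b, hb2 : b < _⟩ := hab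
  obtain ⟨hs, -⟩ := saddle_spec hc ha ha'
  obtain ⟨hr, -⟩ := center_spec hc ha ha'
  have hcont := continuousOn_potential (c := c) (a := a)
  obtain ⟨p, hp, hpb⟩ : b ∈ potential c a '' Set.Ioo (saddle c a) (center c a) :=
    intermediate_value_Ioo' (by linarith [hs.2, hr.1])
      (hcont.mono fun p hp => hp.2.trans_lt hr.2) ⟨hb1, hb2⟩
  obtain ⟨r, hbr, hr1, hr2⟩ : ∃ r, b < potential c a r ∧ center c a < r ∧ r < c :=
    (((tendsto_potential_atTop ha).eventually_gt_atTop b).and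
      (Ioo_mem_nhdsLT hr.2)).exists
  obtain ⟨q, hq, hqb⟩ : b ∈ potential c a '' Set.Ioo (center c a) r :=
    intermediate_value_Ioo hr1.le (hcont.mono fun p hp => hp.2.trans_lt hr2) ⟨hb1, hbr⟩
  have hm : c - q ∈ Set.Ioo 0 (3 * c / 4) := ⟨by linarith [hq.2], by linarith [hq.1, hr.1]⟩
  have hp' : c - p ∈ Set.Ioo 0 c := ⟨by linarith [hp.2, hr.2], by linarith [hp.1, hs.1]⟩
  have hqm : quartic c b (c - q) = a := by
    rw [← potential_eq_iff hm.1.ne', sub_sub_cancel, hqb]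
  have hqp : quartic c b (c - p) = a := by
    rw [← potential_eq_iff hp'.1.ne', sub_sub_cancel, hpb]
  refine ⟨c - q, c - p, ⟨hm.1, by linarith [hp.2, hq.1], ha, hqm, hqp,
    (force_pos_iff hc ha ha' hm hqm).mpr ?_, (force_neg_iff hc ha ha' hp' hqp).mpr ?_⟩,
    hm.2, hp'.2⟩
  · rw [sub_sub_cancel]
    exact hq.1
  · rwa [sub_sub_cancel]

/-- The quadratic factor of `quartic c b w - a = (w - wm) (wp - w) cofactor c wm wp w`. -/
def cofactor (c wm wp w : ℝ) : ℝ :=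
  -w ^ 2 + (2 * c - (wm + wp)) * (w + wm * wp / (wm + wp))

theorem hasDerivAt_cofactor (c wm wp w : ℝ) :
    HasDerivAt (cofactor c wm wp) (-(2 * w) + (2 * c - (wm + wp))) w := by
  have h1 : HasDerivAt (fun w : ℝ => -w ^ 2) (-(2 * w)) w := by
    simpa using (hasDerivAt_pow 2 w).fun_neg
  have h2 := ((hasDerivAt_id w).add_const (wm * wp / (wm + wp))).const_mul (2 * c - (wm + wp))
  exact (h1.add h2).congr_deriv (by ring)

theorem mul_cofactor_eq (c wm wp w w₁ : ℝ) :
    w₁ * cofactor c wm wp w =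
      (w₁ - w) * cofactor c wm wp 0 + w * cofactor c wm wp w₁ + w₁ * (w * (w₁ - w)) := by
  unfold cofactor
  ring

variable {wm wp : ℝ}

namespace IsTurningPair

theorem right_pos (h : IsTurningPair c a b wm wp) : 0 < wp := h.pos.trans h.lt

theorem quartic_sub_eq (h : IsTurningPair c a b wm wp) (w : ℝ) :
    quartic c b w - a = (w - wm) * (wp - w) * cofactor c wm wp w := by
  have hs : wm + wp ≠ 0 := (add_pos h.pos h.right_pos).ne'
  have hb : b = (2 * c * ((wm + wp) ^ 2 - wm * wp) -
      (wm + wp) * ((wm + wp) ^ 2 - 2 * (wm * wp))) / (wm + wp) - c ^ 2 := by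
    have hroots : quartic c b wp - quartic c b wm = 0 := by
      rw [h.quartic_left, h.quartic_right, sub_self]
    rw [eq_sub_iff_add_eq, eq_div_iff hs, ← sub_eq_zero,
      ← mul_right_inj' (sub_pos.mpr h.lt).ne', mul_zero, ← hroots]
    unfold quartic
    ring
  rw [← h.quartic_left, hb]
  unfold quartic cofactor
  field_simp
  ring

theorem two_mul_force_eq (h : IsTurningPair c a b wm wp) (w : ℝ) :
    2 * w * force c b w = (wm + wp - 2 * w) * cofactor c wm wp w +
      (w - wm) * (wp - w) * (-(2 * w) + (2 * c - (wm + wp))) := by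
  have h1 : HasDerivAt (fun w : ℝ => (w - wm) * (wp - w)) (wm + wp - 2 * w) w :=
    (((hasDerivAt_id w).sub_const wm).mul ((hasDerivAt_id w).const_sub wp)).congr_deriv
      (by simp only [id]; ring)
  have h2 := h1.mul (hasDerivAt_cofactor c wm wp w)
  refine ((hasDerivAt_quartic c b w).sub_const a).unique (h2.congr_of_eventuallyEq ?_)
  exact Filter.Eventually.of_forall h.quartic_sub_eq

theorem cofactor_zero_pos (h : IsTurningPair c a b wm wp) : 0 < cofactor c wm wp 0 := by
  have h0 := h.quartic_sub_eq 0
  have hq : quartic c b 0 = 0 := by simp [quartic]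
  rw [hq] at h0
  refine pos_of_mul_pos_right (a := wm * wp) ?_ (mul_pos h.pos h.right_pos).le
  linarith [h.level_pos]

theorem cofactor_right_pos (h : IsTurningPair c a b wm wp) : 0 < cofactor c wm wp wp := by
  have h1 := h.two_mul_force_eq wp
  have h2 := mul_neg_of_pos_of_neg (mul_pos two_pos h.right_pos) h.force_right
  refine pos_of_mul_pos_right (a := wp - wm) ?_ (sub_pos.mpr h.lt).le
  linarith

theorem cofactor_pos_of_lt (h : IsTurningPair c a b wm wp) {w w₁ : ℝ} (hw : 0 ≤ w)
    (hlt : w < w₁) (h₁ : 0 ≤ cofactor c wm wp w₁) : 0 < cofactor c wm wp w := by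
  have hw₁ : 0 ≤ w₁ := hw.trans hlt.le
  refine pos_of_mul_pos_right (a := w₁) ?_ hw₁
  rw [mul_cofactor_eq]
  have h0 := mul_pos (sub_pos.mpr hlt) h.cofactor_zero_pos
  have h1 := mul_nonneg hw h₁
  have h2 := mul_nonneg hw₁ (mul_nonneg hw (sub_nonneg.mpr hlt.le))
  linarith

theorem cofactor_pos (h : IsTurningPair c a b wm wp) {w : ℝ} (hw : w ∈ Set.Icc 0 wp) :
    0 < cofactor c wm wp w := by
  rcases hw.2.eq_or_lt with rfl | hlt
  · exact h.cofactor_right_pos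
  · exact h.cofactor_pos_of_lt hw.1 hlt h.cofactor_right_pos.le

end IsTurningPair

end TurningPoints

section DerivIntegral

open Filter Topology

variable {E : Type*} [NormedAddCommGroup E] [NormedSpace ℝ E] {F : ℝ × ℝ → E} {a : ℝ}

theorem hasDerivAt_prodMk_of_contDiffAt {θ : ℝ} (h : ContDiffAt ℝ 1 F (a, θ)) :
    HasDerivAt (fun x => F (x, θ)) (fderiv ℝ F (a, θ) (1, 0)) a :=
  (h.differentiableAt one_ne_zero).hasFDerivAt.comp_hasDerivAt a
    ((hasDerivAt_id a).prodMk (hasDerivAt_const a θ))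

theorem continuous_fderiv_prodMk (hF : ∀ θ, ContDiffAt ℝ 1 F (a, θ)) :
    Continuous fun θ => fderiv ℝ F (a, θ) :=
  continuous_iff_continuousAt.mpr fun θ => ContinuousAt.comp (f := fun θ : ℝ => (a, θ))
    ((hF θ).fderiv_right (m := 0) (by norm_num)).continuousAt (by fun_prop)

theorem exists_eventually_norm_fderiv_lt (hF : ∀ θ, ContDiffAt ℝ 1 F (a, θ)) {s : Set ℝ}
    (hs : IsCompact s) : ∃ M, ∀ᶠ a' in 𝓝 a, ∀ θ ∈ s,
      ContDiffAt ℝ 1 F (a', θ) ∧ ‖fderiv ℝ F (a', θ)‖ < M := by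
  obtain ⟨M, hM⟩ := hs.exists_bound_of_continuousOn (continuous_fderiv_prodMk hF).continuousOn
  refine ⟨M + 1, hs.eventually_forall_of_forall_eventually fun θ hθ => ?_⟩
  exact ((hF θ).eventually (by simp)).and
    (((hF θ).fderiv_right (m := 0) (by norm_num)).continuousAt.norm.eventually_lt_const
      ((hM θ hθ).trans_lt (lt_add_one M)))

theorem hasDerivAt_integral_of_contDiffAt {t₀ t₁ : ℝ} (hF : ∀ θ, ContDiffAt ℝ 1 F (a, θ)) :
    HasDerivAt (fun a' => ∫ θ in t₀..t₁, F (a', θ))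
      (∫ θ in t₀..t₁, fderiv ℝ F (a, θ) (1, 0)) a := by
  obtain ⟨M, hM⟩ := exists_eventually_norm_fderiv_lt hF (s := Set.uIcc t₀ t₁) isCompact_uIcc
  have hcont : ∀ a', (∀ θ ∈ Set.uIcc t₀ t₁, ContDiffAt ℝ 1 F (a', θ)) →
      ContinuousOn (fun θ => F (a', θ)) (Set.uIcc t₀ t₁) := fun a' h θ hθ =>
    (ContinuousAt.comp (f := fun θ : ℝ => (a', θ)) (h θ hθ).continuousAt
      (by fun_prop)).continuousWithinAt
  refine (intervalIntegral.hasDerivAt_integral_of_dominated_loc_of_deriv_le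
    (F := fun a' θ => F (a', θ)) (F' := fun a' θ => fderiv ℝ F (a', θ) (1, 0))
    (bound := fun _ => M) hM ?_ ?_ ?_ ?_ intervalIntegrable_const ?_).2
  · filter_upwards [hM] with a' ha'
    exact ((hcont a' fun θ hθ => (ha' θ hθ).1).mono
      Set.uIoc_subset_uIcc).aestronglyMeasurable measurableSet_uIoc
  · exact (hcont a fun θ _ => hF θ).intervalIntegrable
  · exact ((continuous_fderiv_prodMk hF).clm_apply continuous_const).aestronglyMeasurable
  · refine Eventually.of_forall fun θ hθ a' ha' => ?_
    calc ‖fderiv ℝ F (a', θ) (1, 0)‖ ≤ ‖fderiv ℝ F (a', θ)‖ * ‖((1 : ℝ), (0 : ℝ))‖ :=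
          ContinuousLinearMap.le_opNorm _ _
      _ ≤ M := by simpa [Prod.norm_mk] using (ha' θ (Set.uIoc_subset_uIcc hθ)).2.le
  · exact Eventually.of_forall fun θ hθ a' ha' =>
      hasDerivAt_prodMk_of_contDiffAt (ha' θ (Set.uIoc_subset_uIcc hθ)).1

end DerivIntegral

section Period

open Filter Topology

theorem exists_quartic_rightInverse {c a b w₀ : ℝ} (hw₀ : w₀ ≠ 0) (hq : quartic c b w₀ = a)
    (hf : force c b w₀ ≠ 0) :
    ∃ r : ℝ → ℝ, r a = w₀ ∧ ContDiffAt ℝ 1 r a ∧ ∀ᶠ a' in 𝓝 a, quartic c b (r a') = a' := by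
  have hcd : ContDiffAt ℝ 1 (quartic c b) w₀ := by
    unfold quartic
    fun_prop
  have hne : 2 * w₀ * force c b w₀ ≠ 0 := mul_ne_zero (mul_ne_zero two_ne_zero hw₀) hf
  have hd : HasFDerivAt (quartic c b)
      ((ContinuousLinearEquiv.unitsEquivAut ℝ (Units.mk0 _ hne) : ℝ ≃L[ℝ] ℝ) : ℝ →L[ℝ] ℝ) w₀ := by
    refine (hasDerivAt_quartic c b w₀).hasFDerivAt.congr_fderiv ?_
    ext
    simp
  subst hq
  exact ⟨hcd.localInverse hd one_ne_zero, hcd.localInverse_apply_image hd one_ne_zero,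
    hcd.to_localInverse hd one_ne_zero,
    (hcd.hasStrictFDerivAt' hd one_ne_zero).eventually_right_inverse⟩

/-- The uniformization of the interval `[wm, wp]` by an angle; the turning points are at the
angles `-π / 2` and `π / 2` modulo `2 π`. -/
def angleW (wm wp θ : ℝ) : ℝ := (wm + wp) / 2 + (wp - wm) / 2 * Real.sin θ

/-- The density `dx / dθ` of the time `x` along a wave with respect to the angle `θ`. -/
def timeDensity (c wm wp θ : ℝ) : ℝ :=
  angleW wm wp θ / √(cofactor c wm wp (angleW wm wp θ))

theorem angleW_mem_Icc {wm wp : ℝ} (h : wm < wp) (θ : ℝ) : angleW wm wp θ ∈ Set.Icc wm wp := by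
  have h1 := Real.neg_one_le_sin θ
  have h2 := Real.sin_le_one θ
  unfold angleW
  constructor <;> nlinarith

theorem angleW_sub_mul_sub_angleW (wm wp θ : ℝ) :
    (angleW wm wp θ - wm) * (wp - angleW wm wp θ) = ((wp - wm) / 2 * Real.cos θ) ^ 2 := by
  unfold angleW
  linear_combination (-((wp - wm) / 2) ^ 2) * Real.sin_sq_add_cos_sq θ

theorem hasDerivAt_angleW (wm wp θ : ℝ) :
    HasDerivAt (angleW wm wp) ((wp - wm) / 2 * Real.cos θ) θ :=
  ((Real.hasDerivAt_sin θ).const_mul _).const_add _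

theorem timeDensity_pi_sub (c wm wp θ : ℝ) :
    timeDensity c wm wp (Real.pi - θ) = timeDensity c wm wp θ := by
  simp only [timeDensity, angleW, Real.sin_pi_sub]

theorem image_sin_Ioo :
    Real.sin '' Set.Ioo (-(Real.pi / 2)) (Real.pi / 2) = Set.Ioo (-1) 1 := by
  refine Set.Subset.antisymm ?_ fun y hy => ⟨Real.arcsin y,
    ⟨Real.neg_pi_div_two_lt_arcsin.mpr hy.1, Real.arcsin_lt_pi_div_two.mpr hy.2⟩,
    Real.sin_arcsin hy.1.le hy.2.le⟩
  rintro _ ⟨θ, hθ, rfl⟩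
  have hcos := pow_pos (Real.cos_pos_of_mem_Ioo hθ) 2
  exact abs_lt.mp ((sq_lt_one_iff_abs_lt_one _).mp (by linarith [Real.sin_sq_add_cos_sq θ]))

theorem image_angleW_Ioo {wm wp : ℝ} (h : wm < wp) :
    angleW wm wp '' Set.Ioo (-(Real.pi / 2)) (Real.pi / 2) = Set.Ioo wm wp := by
  have hcomp : angleW wm wp = (fun s => (wp - wm) / 2 * s + (wm + wp) / 2) ∘ Real.sin := by
    funext θ
    exact add_comm _ _
  rw [hcomp, Set.image_comp, image_sin_Ioo, Set.image_affine_Ioo (by linarith)]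
  congr 1 <;> ring

theorem injOn_angleW {wm wp : ℝ} (h : wm < wp) :
    Set.InjOn (angleW wm wp) (Set.Ioo (-(Real.pi / 2)) (Real.pi / 2)) := fun x hx y hy hxy =>
  Real.injOn_sin (Set.Ioo_subset_Icc_self hx) (Set.Ioo_subset_Icc_self hy)
    (mul_left_cancel₀ (by linarith : (wp - wm) / 2 ≠ 0) (add_left_cancel hxy))

variable {c a b wm wp : ℝ}

namespace IsTurningPair

theorem cofactor_angleW_pos (h : IsTurningPair c a b wm wp) (θ : ℝ) :
    0 < cofactor c wm wp (angleW wm wp θ) :=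
  h.cofactor_pos ⟨h.pos.le.trans (angleW_mem_Icc h.lt θ).1, (angleW_mem_Icc h.lt θ).2⟩

theorem angleW_pos (h : IsTurningPair c a b wm wp) (θ : ℝ) : 0 < angleW wm wp θ :=
  h.pos.trans_le (angleW_mem_Icc h.lt θ).1

theorem timeDensity_pos (h : IsTurningPair c a b wm wp) (θ : ℝ) : 0 < timeDensity c wm wp θ :=
  div_pos (h.angleW_pos θ) (Real.sqrt_pos.mpr (h.cofactor_angleW_pos θ))

theorem quartic_angleW (h : IsTurningPair c a b wm wp) (θ : ℝ) :
    quartic c b (angleW wm wp θ) - a =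
      ((wp - wm) / 2 * Real.cos θ) ^ 2 * cofactor c wm wp (angleW wm wp θ) := by
  rw [h.quartic_sub_eq, angleW_sub_mul_sub_angleW]

theorem sq_eq_timeDensity_sq_mul (h : IsTurningPair c a b wm wp) (θ : ℝ) :
    (angleW wm wp θ * ((wp - wm) / 2 * Real.cos θ)) ^ 2 =
      timeDensity c wm wp θ ^ 2 * (quartic c b (angleW wm wp θ) - a) := by
  rw [h.quartic_angleW, timeDensity, div_pow, Real.sq_sqrt (h.cofactor_angleW_pos θ).le]
  have := (h.cofactor_angleW_pos θ).ne'
  field_simp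

theorem contDiffAt_timeDensity {ωm ωp : ℝ → ℝ} (h : IsTurningPair c a b (ωm a) (ωp a))
    (hm : ContDiffAt ℝ 1 ωm a) (hp : ContDiffAt ℝ 1 ωp a) (θ : ℝ) :
    ContDiffAt ℝ 1 (fun q : ℝ × ℝ => timeDensity c (ωm q.1) (ωp q.1) q.2) (a, θ) := by
  have h1 : ContDiffAt ℝ 1 (fun q : ℝ × ℝ => ωm q.1) (a, θ) :=
    ContDiffAt.comp (a, θ) (f := Prod.fst) hm contDiffAt_fst
  have h2 : ContDiffAt ℝ 1 (fun q : ℝ × ℝ => ωp q.1) (a, θ) :=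
    ContDiffAt.comp (a, θ) (f := Prod.fst) hp contDiffAt_fst
  have h3 : ContDiffAt ℝ 1 (fun q : ℝ × ℝ => angleW (ωm q.1) (ωp q.1) q.2) (a, θ) :=
    ((h1.add h2).div_const 2).add
      (((h2.sub h1).div_const 2).mul (Real.contDiff_sin.comp contDiff_snd).contDiffAt)
  have h4 : ContDiffAt ℝ 1 (fun q : ℝ × ℝ =>
      cofactor c (ωm q.1) (ωp q.1) (angleW (ωm q.1) (ωp q.1) q.2)) (a, θ) :=
    (h3.pow 2).neg.add ((contDiffAt_const.sub (h1.add h2)).mul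
      (h3.add ((h1.mul h2).div (h1.add h2) (add_pos h.pos h.right_pos).ne')))
  exact h3.div (h4.sqrt (h.cofactor_angleW_pos θ).ne')
    (Real.sqrt_pos.mpr (h.cofactor_angleW_pos θ)).ne'

theorem continuous_timeDensity (h : IsTurningPair c a b wm wp) :
    Continuous (timeDensity c wm wp) :=
  continuous_iff_continuousAt.mpr fun θ =>
    ContinuousAt.comp (f := fun θ : ℝ => (a, θ)) (h.contDiffAt_timeDensity
      (ωm := fun _ => wm) (ωp := fun _ => wp) contDiffAt_const contDiffAt_const θ).continuousAt
      (by fun_prop)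

theorem abs_mul_one_div_sqrt_sub_potential (h : IsTurningPair c a b wm wp) {θ : ℝ}
    (hθ : 0 < Real.cos θ) :
    |(wp - wm) / 2 * Real.cos θ| * (1 / √(b - potential c a (c - angleW wm wp θ))) =
      timeDensity c wm wp θ := by
  have hd : 0 < (wp - wm) / 2 * Real.cos θ := mul_pos (half_pos (sub_pos.mpr h.lt)) hθ
  have hw := h.angleW_pos θ
  rw [abs_of_pos hd, sub_potential_eq_div hw.ne', h.quartic_angleW, Real.sqrt_div' _ (sq_nonneg _),
    Real.sqrt_mul (sq_nonneg _), Real.sqrt_sq hd.le, Real.sqrt_sq hw.le, timeDensity]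
  have hsqrt := (Real.sqrt_pos.mpr (h.cofactor_angleW_pos θ)).ne'
  generalize (wp - wm) / 2 * Real.cos θ = d at hd
  field_simp

theorem integral_one_div_sqrt_sub_potential (h : IsTurningPair c a b wm wp) :
    ∫ p in (c - wp)..(c - wm), 1 / √(b - potential c a p) =
      ∫ θ in (-(Real.pi / 2))..(Real.pi / 2), timeDensity c wm wp θ := by
  rw [← intervalIntegral.integral_comp_sub_left (fun p => 1 / √(b - potential c a p)) c,
    intervalIntegral.integral_of_le h.lt.le, integral_Ioc_eq_integral_Ioo,
    intervalIntegral.integral_of_le (by linarith [Real.pi_pos]), integral_Ioc_eq_integral_Ioo,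
    ← image_angleW_Ioo h.lt, integral_image_eq_integral_abs_deriv_smul measurableSet_Ioo
      (fun θ _ => (hasDerivAt_angleW wm wp θ).hasDerivWithinAt) (injOn_angleW h.lt)]
  exact setIntegral_congr_fun measurableSet_Ioo fun θ hθ =>
    h.abs_mul_one_div_sqrt_sub_potential (Real.cos_pos_of_mem_Ioo hθ)

theorem integral_timeDensity_full_turn (h : IsTurningPair c a b wm wp) :
    ∫ θ in (-(Real.pi / 2))..(3 * Real.pi / 2), timeDensity c wm wp θ =
      2 * ∫ θ in (-(Real.pi / 2))..(Real.pi / 2), timeDensity c wm wp θ := by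
  have hreflect := intervalIntegral.integral_comp_sub_left (a := -(Real.pi / 2))
    (b := Real.pi / 2) (timeDensity c wm wp) Real.pi
  simp only [timeDensity_pi_sub] at hreflect
  have hint := fun x y => h.continuous_timeDensity.intervalIntegrable (μ := volume) x y
  rw [← intervalIntegral.integral_add_adjacent_intervals (hint _ (Real.pi / 2)) (hint _ _),
    two_mul]
  refine congrArg₂ _ rfl (Eq.trans ?_ hreflect.symm)
  congr 1 <;> ring

theorem periodFn_eq (h : IsTurningPair c a b wm wp) (hl : turnLower c a b = c - wp)
    (hu : turnUpper c a b = c - wm) :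
    periodFn c a b = ∫ θ in (-(Real.pi / 2))..(3 * Real.pi / 2), timeDensity c wm wp θ := by
  rw [periodFn, hl, hu, h.integral_one_div_sqrt_sub_potential, h.integral_timeDensity_full_turn]

end IsTurningPair

theorem exists_isTurningPair_branch (hc : 0 < c) (hab : (a, b) ∈ existenceRegion c) :
    ∃ ωm ωp : ℝ → ℝ, ContDiffAt ℝ 1 ωm a ∧ ContDiffAt ℝ 1 ωp a ∧
      ∀ᶠ a' in 𝓝 a, IsTurningPair c a' b (ωm a') (ωp a') ∧ periodFn c a' b =
        ∫ θ in (-(Real.pi / 2))..(3 * Real.pi / 2), timeDensity c (ωm a') (ωp a') θ := by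
  obtain ⟨wm, wp, h, hm3, hpc⟩ := exists_isTurningPair hc hab
  obtain ⟨ωm, rfl, hcm, hem⟩ :=
    exists_quartic_rightInverse h.pos.ne' h.quartic_left h.force_left.ne'
  obtain ⟨ωp, rfl, hcp, hep⟩ :=
    exists_quartic_rightInverse h.right_pos.ne' h.quartic_right h.force_right.ne
  have hm := hcm.continuousAt
  have hp := hcp.continuousAt
  have hforce : Continuous (force c b) :=
    (show Continuous fun w => c ^ 2 + b - 3 * c * w + 2 * w ^ 2 by fun_prop)
  refine ⟨ωm, ωp, hcm, hcp, ?_⟩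
  filter_upwards [hem, hep, hm.eventually_const_lt h.pos, hm.eventually_lt_const hm3,
    hm.eventually_lt hp h.lt, hp.eventually_lt_const hpc,
    (hforce.continuousAt.comp hm).eventually_const_lt h.force_left,
    (hforce.continuousAt.comp hp).eventually_lt_const h.force_right,
    eventually_gt_nhds hab.1, eventually_lt_nhds hab.2.1]
    with a' hqm hqp hpos hm3' hlt hpc' hfm hfp ha ha'
  have h' : IsTurningPair c a' b (ωm a') (ωp a') := ⟨hpos, hlt, ha, hqm, hqp, hfm, hfp⟩
  exact ⟨h', h'.periodFn_eq (turnLower_eq hc ha ha' ⟨h'.right_pos, hpc'⟩ hqp hfp)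
    (turnUpper_eq hc ha ha' ⟨hpos, hm3'⟩ hqm hfm)⟩

/-- The variations `α + β sin θ` of `angleW` and `ρ'` of `timeDensity` when the level `a` moves
with `b` fixed; `variation_eq` is the derivative of `IsTurningPair.sq_eq_timeDensity_sq_mul` with
respect to `a`. -/
structure IsAngleVariation (c a b wm wp α β : ℝ) (ρ' : ℝ → ℝ) : Prop where
  continuous : Continuous ρ'
  variation_eq : ∀ θ, 2 * (angleW wm wp θ * ((wp - wm) / 2 * Real.cos θ)) *
      ((α + β * Real.sin θ) * ((wp - wm) / 2 * Real.cos θ) + angleW wm wp θ * (β * Real.cos θ)) =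
    2 * timeDensity c wm wp θ * ρ' θ * (quartic c b (angleW wm wp θ) - a) +
      timeDensity c wm wp θ ^ 2 *
        (2 * angleW wm wp θ * force c b (angleW wm wp θ) * (α + β * Real.sin θ) - 1)

theorem angle_variation_eq {ωm ωp : ℝ → ℝ} {m' p' ρ' θ : ℝ}
    (h : ∀ᶠ a' in 𝓝 a, IsTurningPair c a' b (ωm a') (ωp a')) (hm : HasDerivAt ωm m' a)
    (hp : HasDerivAt ωp p' a)
    (hρ : HasDerivAt (fun a' => timeDensity c (ωm a') (ωp a') θ) ρ' a) :
    2 * (angleW (ωm a) (ωp a) θ * ((ωp a - ωm a) / 2 * Real.cos θ)) *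
        (((m' + p') / 2 + (p' - m') / 2 * Real.sin θ) * ((ωp a - ωm a) / 2 * Real.cos θ) +
          angleW (ωm a) (ωp a) θ * ((p' - m') / 2 * Real.cos θ)) =
      2 * timeDensity c (ωm a) (ωp a) θ * ρ' * (quartic c b (angleW (ωm a) (ωp a) θ) - a) +
        timeDensity c (ωm a) (ωp a) θ ^ 2 *
          (2 * angleW (ωm a) (ωp a) θ * force c b (angleW (ωm a) (ωp a) θ) *
            ((m' + p') / 2 + (p' - m') / 2 * Real.sin θ) - 1) := by
  have hw : HasDerivAt (fun a' => angleW (ωm a') (ωp a') θ)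
      ((m' + p') / 2 + (p' - m') / 2 * Real.sin θ) a :=
    ((hm.add hp).div_const 2).add (((hp.sub hm).div_const 2).mul_const _)
  have hd : HasDerivAt (fun a' => (ωp a' - ωm a') / 2 * Real.cos θ)
      ((p' - m') / 2 * Real.cos θ) a := ((hp.sub hm).div_const 2).mul_const _
  have hq : HasDerivAt (fun a' => quartic c b (angleW (ωm a') (ωp a') θ) - a') _ a :=
    (HasDerivAt.comp (h₂ := quartic c b) a (hasDerivAt_quartic c b _) hw).fun_sub
      (hasDerivAt_id a)
  have hsq : (fun a' => (angleW (ωm a') (ωp a') θ * ((ωp a' - ωm a') / 2 * Real.cos θ)) ^ 2)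
      =ᶠ[𝓝 a] fun a' => timeDensity c (ωm a') (ωp a') θ ^ 2 *
        (quartic c b (angleW (ωm a') (ωp a') θ) - a') := by
    filter_upwards [h] with a' ha' using ha'.sq_eq_timeDensity_sq_mul θ
  have huniq := ((hw.mul hd).fun_pow 2).unique
    (((hρ.fun_pow 2).mul hq).congr_of_eventuallyEq hsq)
  simp only [Pi.mul_apply] at huniq
  linear_combination huniq

theorem exists_isAngleVariation (hc : 0 < c) (hab : (a, b) ∈ existenceRegion c) :
    ∃ wm wp α β : ℝ, ∃ ρ' : ℝ → ℝ, IsTurningPair c a b wm wp ∧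
      IsAngleVariation c a b wm wp α β ρ' ∧ HasDerivAt (fun a' => periodFn c a' b)
        (∫ θ in (-(Real.pi / 2))..(3 * Real.pi / 2), ρ' θ) a := by
  obtain ⟨ωm, ωp, hcm, hcp, hev⟩ := exists_isTurningPair_branch hc hab
  have h : IsTurningPair c a b (ωm a) (ωp a) := hev.self_of_nhds.1
  have hF := h.contDiffAt_timeDensity hcm hcp
  have hm := (hcm.differentiableAt one_ne_zero).hasDerivAt
  have hp := (hcp.differentiableAt one_ne_zero).hasDerivAt
  refine ⟨ωm a, ωp a, (deriv ωm a + deriv ωp a) / 2, (deriv ωp a - deriv ωm a) / 2, _, h,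
    ⟨(continuous_fderiv_prodMk hF).clm_apply continuous_const, fun θ => angle_variation_eq
      (hev.mono fun _ => And.left) hm hp (hasDerivAt_prodMk_of_contDiffAt (hF θ))⟩, ?_⟩
  exact (hasDerivAt_integral_of_contDiffAt hF).congr_of_eventuallyEq (hev.mono fun _ => And.right)

end Period

/-! ### The wave and its Jacobi field -/

section Wave

open Filter Topology

theorem exists_forall_le_of_periodic {α : Type*} [LinearOrder α] [TopologicalSpace α]
    [ClosedIicTopology α] {f : ℝ → α} {L : ℝ} (hf : Continuous f) (hL : 0 < L)
    (hp : Function.Periodic f L) : ∃ x₀, ∀ x, f x₀ ≤ f x := by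
  obtain ⟨x₀, -, hx₀⟩ := isCompact_Icc.exists_isMinOn (Set.nonempty_Icc.mpr hL.le) hf.continuousOn
  refine ⟨x₀, fun x => ?_⟩
  obtain ⟨y, hy, hxy⟩ := hp.exists_mem_Ico₀ hL x
  rw [hxy]
  exact hx₀ (Set.Ico_subset_Icc_self hy)

theorem hasDerivAt_of_mul_deriv_sub_eq_zero {ψ N : ℝ → ℝ} (hψ : ContDiff ℝ 1 ψ)
    (hN : Continuous N) (hmul : ∀ x, ψ x * (deriv ψ x - N x) = 0)
    (hNz : ∀ x, ψ x = 0 → N x ≠ 0) (hψz : ∃ x, ψ x ≠ 0) (x : ℝ) : HasDerivAt ψ (N x) x := by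
  have hψd : Differentiable ℝ ψ := hψ.differentiable one_ne_zero
  have hmem : ∀ y, ψ y ≠ 0 → deriv ψ y = N y := fun y hy =>
    sub_eq_zero.mp ((mul_eq_zero.mp (hmul y)).resolve_left hy)
  have hopen : IsOpen {x | deriv ψ x = N x} := by
    refine isOpen_iff_mem_nhds.mpr fun x hx => ?_
    by_cases hψx : ψ x = 0
    · have hd : HasDerivAt ψ (N x) x := hx ▸ (hψd x).hasDerivAt
      have hev := eventually_nhdsWithin_iff.mp (hd.eventually_ne (c := 0) (hNz x hψx))
      filter_upwards [hev] with y hy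
      rcases eq_or_ne y x with rfl | hyx
      exacts [hx, hmem y (hy hyx)]
    · filter_upwards [hψd.continuous.continuousAt.eventually_ne hψx] with y hy using hmem y hy
  have huniv := IsClopen.eq_univ ⟨isClosed_eq (hψ.continuous_deriv le_rfl) hN, hopen⟩
    (hψz.imp hmem)
  exact (Set.eq_univ_iff_forall.mp huniv x : deriv ψ x = N x) ▸ (hψd x).hasDerivAt

theorem eq_sin_of_hasDerivAt {S C κ Θ : ℝ → ℝ} (hS : ∀ x, HasDerivAt S (C x * κ x) x)
    (hC : ∀ x, HasDerivAt C (-(S x * κ x)) x) (hΘ : ∀ x, HasDerivAt Θ (κ x) x) {x₀ : ℝ}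
    (hS₀ : S x₀ = Real.sin (Θ x₀)) (hC₀ : C x₀ = Real.cos (Θ x₀)) (x : ℝ) :
    S x = Real.sin (Θ x) := by
  have hd : ∀ x, HasDerivAt
      (fun x => (S x - Real.sin (Θ x)) ^ 2 + (C x - Real.cos (Θ x)) ^ 2) 0 x := fun x =>
    ((((hS x).fun_sub (hΘ x).sin).fun_pow 2).fun_add
      (((hC x).fun_sub (hΘ x).cos).fun_pow 2)).congr_deriv (by ring)
  have hconst := is_const_of_deriv_eq_zero (fun x => (hd x).differentiableAt)
    (fun x => (hd x).deriv) x x₀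
  simp only [hS₀, hC₀, sub_self, ne_eq, OfNat.ofNat_ne_zero, not_false_eq_true, zero_pow,
    add_zero] at hconst
  have hsq := (add_eq_zero_iff_of_nonneg (sq_nonneg _) (sq_nonneg _)).mp hconst
  exact sub_eq_zero.mp (pow_eq_zero_iff two_ne_zero |>.mp hsq.1)

variable {c a b L wm wp : ℝ} {φ : ℝ → ℝ}

/-- The derivative of `(c - φ) ^ 2 / 2` along a wave `φ`. -/
def momentum (c : ℝ) (φ : ℝ → ℝ) (x : ℝ) : ℝ := (c - φ x) * (-deriv φ x)

theorem IsTurningPair.quartic_lt (h : IsTurningPair c a b wm wp) {w w₁ : ℝ} (hw : wp < w)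
    (hlt : w < w₁) (h₁ : quartic c b w₁ = a) : quartic c b w < a := by
  have hfac := h.quartic_sub_eq w₁
  rw [h₁, sub_self, eq_comm] at hfac
  have hcof : cofactor c wm wp w₁ = 0 := (mul_eq_zero.mp hfac).resolve_left
    (mul_ne_zero (by linarith [h.lt]) (by linarith))
  have hpos := h.cofactor_pos_of_lt (h.right_pos.trans hw).le hlt hcof.ge
  have hneg := mul_neg_of_neg_of_pos (mul_neg_of_pos_of_neg (sub_pos.mpr (h.lt.trans hw))
    (sub_neg.mpr hw)) hpos
  rw [← h.quartic_sub_eq] at hneg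
  exact sub_neg.mp hneg

theorem IsTurningPair.eq_or_eq_of_quartic_eq (h : IsTurningPair c a b wm wp) {w : ℝ}
    (hw : w ∈ Set.Icc 0 wp) (hq : quartic c b w = a) : w = wm ∨ w = wp := by
  have hfac := h.quartic_sub_eq w
  rw [hq, sub_self, eq_comm] at hfac
  exact (mul_eq_zero.mp ((mul_eq_zero.mp hfac).resolve_right (h.cofactor_pos hw).ne')).imp
    sub_eq_zero.mp fun h => (sub_eq_zero.mp h).symm

namespace IsSmoothPeriodicWave

theorem not_const (h : IsSmoothPeriodicWave c a b L φ) : ¬ ∀ x y, φ x = φ y := fun hconst =>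
  (half_lt_self h.period.1.1).not_ge
    (h.period.2 ⟨half_pos h.period.1.1, fun _ => hconst _ _⟩)

theorem hasDerivAt_speed (h : IsSmoothPeriodicWave c a b L φ) (x : ℝ) :
    HasDerivAt (fun x => c - φ x) (-deriv φ x) x :=
  (h.smooth.differentiable (by simp) x).hasDerivAt.const_sub c

theorem momentum_sq (h : IsSmoothPeriodicWave c a b L φ) (x : ℝ) :
    momentum c φ x ^ 2 = quartic c b (c - φ x) - a := by
  unfold quartic momentum
  linear_combination h.invariant x

theorem quartic_eq_of_deriv_eq_zero (h : IsSmoothPeriodicWave c a b L φ) {x : ℝ}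
    (hx : deriv φ x = 0) : quartic c b (c - φ x) = a := by
  have := h.momentum_sq x
  rw [momentum, hx, neg_zero, mul_zero, zero_pow two_ne_zero] at this
  exact (sub_eq_zero.mp this.symm)

theorem exists_speed_extrema (h : IsSmoothPeriodicWave c a b L φ) :
    ∃ x₀ x₁, (∀ x, c - φ x ∈ Set.Icc (c - φ x₀) (c - φ x₁)) ∧ c - φ x₀ < c - φ x₁ ∧
      quartic c b (c - φ x₀) = a ∧ quartic c b (c - φ x₁) = a := by
  have hcont := h.smooth.continuous
  obtain ⟨x₀, hx₀⟩ := exists_forall_le_of_periodic hcont.neg h.period.1.1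
    fun x => congrArg Neg.neg (h.periodic x)
  obtain ⟨x₁, hx₁⟩ := exists_forall_le_of_periodic hcont h.period.1.1 h.periodic
  have hx₀' : ∀ x, φ x ≤ φ x₀ := fun x => neg_le_neg_iff.mp (hx₀ x)
  refine ⟨x₀, x₁, fun x => ⟨sub_le_sub_left (hx₀' x) c, sub_le_sub_left (hx₁ x) c⟩,
    sub_lt_sub_left ((hx₁ x₀).lt_of_ne fun heq => h.not_const fun x y => ?_) c,
    h.quartic_eq_of_deriv_eq_zero (IsLocalMax.deriv_eq_zero (Eventually.of_forall hx₀')),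
    h.quartic_eq_of_deriv_eq_zero (IsLocalMin.deriv_eq_zero (Eventually.of_forall hx₁))⟩
  exact (((hx₀' x).trans heq.ge).antisymm (hx₁ x)).trans
    (((hx₀' y).trans heq.ge).antisymm (hx₁ y)).symm

theorem speed_mem_Icc (h : IsSmoothPeriodicWave c a b L φ) (hT : IsTurningPair c a b wm wp) :
    (∀ x, c - φ x ∈ Set.Icc wm wp) ∧ ∃ x₀, c - φ x₀ = wm := by
  obtain ⟨x₀, x₁, hx, hlt, hq₀, hq₁⟩ := h.exists_speed_extrema
  have hle : c - φ x₁ ≤ wp := by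
    by_contra! hgt
    obtain ⟨t, ht, ht₁⟩ := exists_between (max_lt hgt hlt)
    obtain ⟨z, rfl : c - φ z = t⟩ := mem_range_of_exists_le_of_exists_ge
      (continuous_const.sub h.smooth.continuous)
      ⟨x₀, ((le_max_right _ _).trans_lt ht).le⟩ ⟨x₁, ht₁.le⟩
    have := hT.quartic_lt ((le_max_left _ _).trans_lt ht) ht₁ hq₁
    linarith [sq_nonneg (momentum c φ z), h.momentum_sq z]
  have hwm : c - φ x₀ = wm :=
    (hT.eq_or_eq_of_quartic_eq ⟨(h.lt_speed x₀).le, hlt.le.trans hle⟩ hq₀).resolve_right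
      (hlt.trans_le hle).ne
  exact ⟨fun x => ⟨hwm ▸ (hx x).1, (hx x).2.trans hle⟩, x₀, hwm⟩

theorem cofactor_pos (h : IsSmoothPeriodicWave c a b L φ) (hT : IsTurningPair c a b wm wp)
    (x : ℝ) : 0 < cofactor c wm wp (c - φ x) :=
  hT.cofactor_pos ⟨(h.lt_speed x).le, ((h.speed_mem_Icc hT).1 x).2⟩

theorem momentum_mul_deriv_sub (h : IsSmoothPeriodicWave c a b L φ) {x : ℝ}
    (hd : DifferentiableAt ℝ (momentum c φ) x) :
    momentum c φ x * (deriv (momentum c φ) x - force c b (c - φ x)) = 0 := by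
  have hq : HasDerivAt (fun x => quartic c b (c - φ x) - a) _ x :=
    (HasDerivAt.comp (h₂ := quartic c b) x (hasDerivAt_quartic c b _)
      (h.hasDerivAt_speed x)).sub_const a
  have huniq := (hd.hasDerivAt.fun_pow 2).unique
    (hq.congr_of_eventuallyEq (Eventually.of_forall h.momentum_sq))
  simp only [momentum] at huniq ⊢
  linear_combination huniq / 2

theorem force_ne_zero (h : IsSmoothPeriodicWave c a b L φ) (hT : IsTurningPair c a b wm wp)
    {x : ℝ} (hx : momentum c φ x = 0) : force c b (c - φ x) ≠ 0 := by
  have hq := h.momentum_sq x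
  rw [hx, zero_pow two_ne_zero, eq_comm, sub_eq_zero] at hq
  rcases hT.eq_or_eq_of_quartic_eq
    ⟨(h.lt_speed x).le, ((h.speed_mem_Icc hT).1 x).2⟩ hq with hw | hw
  · exact hw ▸ hT.force_left.ne'
  · exact hw ▸ hT.force_right.ne

theorem hasDerivAt_momentum (h : IsSmoothPeriodicWave c a b L φ)
    (hT : IsTurningPair c a b wm wp) (x : ℝ) :
    HasDerivAt (momentum c φ) (force c b (c - φ x)) x := by
  have hφ' : ContDiff ℝ 1 (deriv φ) := (contDiff_infty_iff_deriv.mp h.smooth).2.of_le (by simp)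
  have hψ : ContDiff ℝ 1 (momentum c φ) :=
    (contDiff_const.sub (h.smooth.of_le (by simp))).mul hφ'.neg
  have hN : Continuous fun x => force c b (c - φ x) := by
    have := h.smooth.continuous
    unfold force
    fun_prop
  refine hasDerivAt_of_mul_deriv_sub_eq_zero hψ hN
    (fun x => h.momentum_mul_deriv_sub (hψ.differentiable one_ne_zero x))
    (fun x => h.force_ne_zero hT) ?_ x
  by_contra! hzero
  exact h.not_const (is_const_of_deriv_eq_zero (h.smooth.differentiable (by simp)) fun x =>
    neg_eq_zero.mp ((mul_eq_zero.mp (hzero x)).resolve_left (h.lt_speed x).ne'))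

end IsSmoothPeriodicWave

/-- `Θ` lifts the motion of `c - φ` between its turning points `wm` and `wp` to the angle of
`angleW`, starting from `wm` at the point `x₀`. -/
structure IsAngle (c wm wp x₀ : ℝ) (φ Θ : ℝ → ℝ) : Prop where
  apply_left : Θ x₀ = -(Real.pi / 2)
  hasDerivAt : ∀ x, HasDerivAt Θ (1 / timeDensity c wm wp (Θ x)) x
  speed_eq : ∀ x, c - φ x = angleW wm wp (Θ x)

theorem IsSmoothPeriodicWave.hasDerivAt_momentum_div_sqrt (h : IsSmoothPeriodicWave c a b L φ)
    (hT : IsTurningPair c a b wm wp) (x : ℝ) :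
    HasDerivAt (fun x => momentum c φ x / ((wp - wm) / 2 * √(cofactor c wm wp (c - φ x))))
      (-((c - φ x - (wm + wp) / 2) / ((wp - wm) / 2) *
        (√(cofactor c wm wp (c - φ x)) / (c - φ x)))) x := by
  have hd : 0 < (wp - wm) / 2 := half_pos (sub_pos.mpr hT.lt)
  have hR := h.cofactor_pos hT x
  have hcof : HasDerivAt (fun x => cofactor c wm wp (c - φ x)) _ x :=
    HasDerivAt.comp (h₂ := cofactor c wm wp) x (hasDerivAt_cofactor c wm wp _)
      (h.hasDerivAt_speed x)
  have hsqrt := Real.sqrt_pos.mpr hR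
  refine ((h.hasDerivAt_momentum hT x).fun_div ((hcof.sqrt hR.ne').const_mul _)
    (mul_pos hd hsqrt).ne').congr_deriv ?_
  have hsq := h.momentum_sq x
  have hf := hT.two_mul_force_eq (c - φ x)
  have hw := h.lt_speed x
  rw [hT.quartic_sub_eq, momentum] at hsq
  rw [← Real.sq_sqrt hR.le] at hsq hf
  rw [momentum]
  generalize √(cofactor c wm wp (c - φ x)) = s at *
  generalize c - φ x = w at *
  generalize (wp - wm) / 2 = d at hd
  rw [div_eq_iff (by positivity)]
  field_simp
  linear_combination s ^ 2 * hf - (-(2 * w) + (2 * c - (wm + wp))) * hsq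

theorem IsSmoothPeriodicWave.exists_isAngle (h : IsSmoothPeriodicWave c a b L φ)
    (hT : IsTurningPair c a b wm wp) : ∃ x₀ Θ, IsAngle c wm wp x₀ φ Θ := by
  obtain ⟨x₀, hx₀⟩ := (h.speed_mem_Icc hT).2
  have hd : (wp - wm) / 2 ≠ 0 := (half_pos (sub_pos.mpr hT.lt)).ne'
  let κ : ℝ → ℝ := fun x => √(cofactor c wm wp (c - φ x)) / (c - φ x)
  let Θ : ℝ → ℝ := fun x => -(Real.pi / 2) + ∫ y in x₀..x, κ y
  let S : ℝ → ℝ := fun x => (c - φ x - (wm + wp) / 2) / ((wp - wm) / 2)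
  have hκ : Continuous κ := by
    have hφ := h.smooth.continuous
    have hcof : Continuous fun x => cofactor c wm wp (c - φ x) := by
      unfold cofactor
      fun_prop
    exact hcof.sqrt.div (by fun_prop) fun x => (h.lt_speed x).ne'
  have hΘ : ∀ x, HasDerivAt Θ (κ x) x := fun x =>
    (hκ.integral_hasStrictDerivAt x₀ x).hasDerivAt.const_add _
  have hΘ₀ : Θ x₀ = -(Real.pi / 2) := by simp [Θ]
  have hS : ∀ x, HasDerivAt S
      (momentum c φ x / ((wp - wm) / 2 * √(cofactor c wm wp (c - φ x))) * κ x) x := fun x => by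
    refine (((h.hasDerivAt_speed x).sub_const _).div_const _).congr_deriv ?_
    have hw := (h.lt_speed x).ne'
    have hs := (Real.sqrt_pos.mpr (h.cofactor_pos hT x)).ne'
    simp only [κ, momentum]
    generalize (wp - wm) / 2 = d at hd
    field_simp
  have hψ₀ : momentum c φ x₀ = 0 := pow_eq_zero_iff two_ne_zero |>.mp <| by
    rw [h.momentum_sq, hx₀, hT.quartic_left, sub_self]
  have hsin := eq_sin_of_hasDerivAt hS (h.hasDerivAt_momentum_div_sqrt hT) hΘ (x₀ := x₀)
    (by
      rw [hΘ₀, Real.sin_neg, Real.sin_pi_div_two, div_eq_iff hd, hx₀]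
      ring)
    (by rw [hψ₀, zero_div, hΘ₀, Real.cos_neg, Real.cos_pi_div_two])
  have hspeed : ∀ x, c - φ x = angleW wm wp (Θ x) := fun x => by
    rw [angleW, ← hsin x, mul_div_cancel₀ _ hd, add_sub_cancel]
  exact ⟨x₀, Θ, hΘ₀, fun x => (hΘ x).congr_deriv (by rw [timeDensity, ← hspeed, one_div_div]),
    hspeed⟩

/-- The time taken by the wave to move from the angle `-π / 2` to the angle `θ`. -/
def angleTime (c wm wp θ : ℝ) : ℝ := ∫ t in (-(Real.pi / 2))..θ, timeDensity c wm wp t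

theorem angleTime_left (c wm wp : ℝ) : angleTime c wm wp (-(Real.pi / 2)) = 0 :=
  intervalIntegral.integral_same

theorem angleW_add_two_pi (wm wp θ : ℝ) : angleW wm wp (θ + 2 * Real.pi) = angleW wm wp θ := by
  rw [angleW, Real.sin_add_two_pi, angleW]

namespace IsTurningPair

theorem hasDerivAt_angleTime (h : IsTurningPair c a b wm wp) (θ : ℝ) :
    HasDerivAt (angleTime c wm wp) (timeDensity c wm wp θ) θ :=
  (h.continuous_timeDensity.integral_hasStrictDerivAt _ θ).hasDerivAt

theorem strictMono_angleTime (h : IsTurningPair c a b wm wp) : StrictMono (angleTime c wm wp) :=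
  strictMono_of_deriv_pos fun θ => by
    rw [(h.hasDerivAt_angleTime θ).deriv]
    exact h.timeDensity_pos θ

theorem angleTime_add_two_pi (h : IsTurningPair c a b wm wp) (θ : ℝ) :
    angleTime c wm wp (θ + 2 * Real.pi) =
      angleTime c wm wp θ + angleTime c wm wp (3 * Real.pi / 2) := by
  have hper : Function.Periodic (timeDensity c wm wp) (2 * Real.pi) := fun θ => by
    simp only [timeDensity, angleW_add_two_pi]
  have hint := fun x y => h.continuous_timeDensity.intervalIntegrable (μ := volume) x y
  have hturn := hper.intervalIntegral_add_eq (-(Real.pi / 2)) θ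
  rw [show -(Real.pi / 2) + 2 * Real.pi = 3 * Real.pi / 2 by ring] at hturn
  rw [angleTime, angleTime, angleTime, hturn,
    intervalIntegral.integral_add_adjacent_intervals (hint _ _) (hint _ _)]

end IsTurningPair

namespace IsAngle

variable {x₀ : ℝ} {Θ : ℝ → ℝ}

theorem angleTime_apply (h : IsAngle c wm wp x₀ φ Θ) (hT : IsTurningPair c a b wm wp) (x : ℝ) :
    angleTime c wm wp (Θ x) = x - x₀ := by
  have hd : ∀ x, HasDerivAt (fun x => angleTime c wm wp (Θ x) - x) 0 x := fun x =>
    (((hT.hasDerivAt_angleTime (Θ x)).comp x (h.hasDerivAt x)).sub (hasDerivAt_id x)).congr_deriv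
      (by rw [mul_one_div_cancel (hT.timeDensity_pos _).ne', sub_self])
  have hconst := is_const_of_deriv_eq_zero (fun x => (hd x).differentiableAt)
    (fun x => (hd x).deriv) x x₀
  rw [h.apply_left, angleTime_left] at hconst
  linarith

theorem apply_add_angleTime (h : IsAngle c wm wp x₀ φ Θ) (hT : IsTurningPair c a b wm wp)
    (θ : ℝ) : Θ (x₀ + angleTime c wm wp θ) = θ :=
  hT.strictMono_angleTime.injective (by rw [h.angleTime_apply hT, add_sub_cancel_left])

theorem lt_apply_iff (h : IsAngle c wm wp x₀ φ Θ) (hT : IsTurningPair c a b wm wp) {θ x : ℝ} :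
    θ < Θ x ↔ x₀ + angleTime c wm wp θ < x := by
  rw [← hT.strictMono_angleTime.lt_iff_lt, h.angleTime_apply hT, lt_sub_iff_add_lt']

theorem periodic_angleTime (h : IsAngle c wm wp x₀ φ Θ) (hT : IsTurningPair c a b wm wp) :
    Function.Periodic φ (angleTime c wm wp (3 * Real.pi / 2)) := fun x => by
  have hturn : Θ (x + angleTime c wm wp (3 * Real.pi / 2)) = Θ x + 2 * Real.pi :=
    hT.strictMono_angleTime.injective (by
      rw [h.angleTime_apply hT, hT.angleTime_add_two_pi, h.angleTime_apply hT]
      ring)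
  have hspeed := h.speed_eq (x + angleTime c wm wp (3 * Real.pi / 2))
  rw [hturn, angleW_add_two_pi, ← h.speed_eq] at hspeed
  exact sub_right_injective hspeed

theorem apply_add_period (h : IsAngle c wm wp x₀ φ Θ) (hT : IsTurningPair c a b wm wp)
    (hφ : IsSmoothPeriodicWave c a b L φ) : Θ (x₀ + L) = 3 * Real.pi / 2 := by
  have hpi := Real.pi_pos
  have hpos : 0 < angleTime c wm wp (3 * Real.pi / 2) := by
    rw [← angleTime_left c wm wp]
    exact hT.strictMono_angleTime (by linarith)
  have hle : L ≤ angleTime c wm wp (3 * Real.pi / 2) :=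
    hφ.period.2 ⟨hpos, h.periodic_angleTime hT⟩
  have hlower : -(Real.pi / 2) < Θ (x₀ + L) := by
    rw [h.lt_apply_iff hT, angleTime_left, add_zero]
    exact lt_add_of_pos_right _ hφ.period.1.1
  have hupper : Θ (x₀ + L) ≤ 3 * Real.pi / 2 := by
    rw [← not_lt, h.lt_apply_iff hT, not_lt]
    exact add_le_add_right hle x₀
  have hsin : Real.sin (Θ (x₀ + L)) = -1 := by
    have hspeed := h.speed_eq (x₀ + L)
    rw [hφ.periodic x₀, h.speed_eq x₀, h.apply_left, angleW, angleW, add_right_inj,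
      mul_right_inj' (half_pos (sub_pos.mpr hT.lt)).ne'] at hspeed
    rw [← hspeed, Real.sin_neg, Real.sin_pi_div_two]
  obtain ⟨n, hn⟩ := Real.sin_eq_neg_one_iff.mp hsin
  have hn₀ : (0 : ℝ) < n := by nlinarith
  have hn₁ : (n : ℝ) ≤ 1 := by nlinarith
  obtain rfl : n = 1 := le_antisymm (mod_cast hn₁) (mod_cast hn₀)
  rw [← hn]
  push_cast
  ring

theorem exists_apply_eq_pi_div_two (h : IsAngle c wm wp x₀ φ Θ)
    (hT : IsTurningPair c a b wm wp) (hφ : IsSmoothPeriodicWave c a b L φ) :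
    ∃ x₁ ∈ Set.Ioo x₀ (x₀ + L), Θ x₁ = Real.pi / 2 := by
  have hpi := Real.pi_pos
  refine ⟨_, ⟨?_, ?_⟩, h.apply_add_angleTime hT _⟩
  · rw [lt_add_iff_pos_right, ← angleTime_left c wm wp]
    exact hT.strictMono_angleTime (by linarith)
  · rw [← h.lt_apply_iff hT, h.apply_add_period hT hφ]
    linarith

end IsAngle

end Wave

section JacobiField

open Filter Topology

theorem hasDerivAt_of_eventually_hasDerivAt {E : Type*} [NormedAddCommGroup E] [NormedSpace ℝ E]
    {f g : ℝ → E} {x : ℝ} (hfg : ∀ᶠ y in 𝓝[≠] x, HasDerivAt f (g y) y) (hf : ContinuousAt f x)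
    (hg : ContinuousAt g x) : HasDerivAt f (g x) x := by
  obtain ⟨U, hU, hUo, hxU⟩ := mem_nhds_iff.mp (eventually_nhdsWithin_iff.mp hfg)
  have hright : HasDerivWithinAt f (g x) (Set.Ici x) x := by
    have hU' : U ∩ Set.Ioi x ∈ 𝓝[>] x :=
      inter_mem (mem_nhdsWithin_of_mem_nhds (hUo.mem_nhds hxU)) self_mem_nhdsWithin
    have hd : ∀ y ∈ U ∩ Set.Ioi x, HasDerivAt f (g y) y := fun y hy => hU hy.1 hy.2.ne'
    refine hasDerivWithinAt_Ici_of_tendsto_deriv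
      (fun y hy => (hd y hy).differentiableAt.differentiableWithinAt) hf.continuousWithinAt hU'
      ((hg.tendsto.mono_left nhdsWithin_le_nhds).congr' ?_)
    filter_upwards [hU'] with y hy using (hd y hy).deriv.symm
  have hleft : HasDerivWithinAt f (g x) (Set.Iic x) x := by
    have hU' : U ∩ Set.Iio x ∈ 𝓝[<] x :=
      inter_mem (mem_nhdsWithin_of_mem_nhds (hUo.mem_nhds hxU)) self_mem_nhdsWithin
    have hd : ∀ y ∈ U ∩ Set.Iio x, HasDerivAt f (g y) y := fun y hy => hU hy.1 hy.2.ne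
    refine hasDerivWithinAt_Iic_of_tendsto_deriv
      (fun y hy => (hd y hy).differentiableAt.differentiableWithinAt) hf.continuousWithinAt hU'
      ((hg.tendsto.mono_left nhdsWithin_le_nhds).congr' ?_)
    filter_upwards [hU'] with y hy using (hd y hy).deriv.symm
  simpa using hleft.union hright

variable {c a b L wm wp x₀ α β : ℝ} {φ Θ ρ' : ℝ → ℝ}

theorem IsSmoothPeriodicWave.hasDerivAt_force_speed (h : IsSmoothPeriodicWave c a b L φ) (x : ℝ) :
    HasDerivAt (fun x => force c b (c - φ x)) ((4 - 3 * c / (c - φ x)) * momentum c φ x) x := by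
  have hw := h.hasDerivAt_speed x
  have hd : HasDerivAt (fun x => force c b (c - φ x)) _ x :=
    ((hw.const_mul (3 * c)).const_sub (c ^ 2 + b)).fun_add ((hw.fun_pow 2).const_mul 2)
  refine hd.congr_deriv ?_
  have := (h.lt_speed x).ne'
  rw [momentum]
  field_simp
  ring

namespace IsAngle

theorem continuous (h : IsAngle c wm wp x₀ φ Θ) : Continuous Θ :=
  continuous_iff_continuousAt.mpr fun x => (h.hasDerivAt x).continuousAt

theorem strictMono (h : IsAngle c wm wp x₀ φ Θ) (hT : IsTurningPair c a b wm wp) :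
    StrictMono Θ := strictMono_of_deriv_pos fun x => by
  rw [(h.hasDerivAt x).deriv]
  exact one_div_pos.mpr (hT.timeDensity_pos _)

theorem neg_deriv_mul_timeDensity (h : IsAngle c wm wp x₀ φ Θ) (hT : IsTurningPair c a b wm wp)
    (hφ : IsSmoothPeriodicWave c a b L φ) (x : ℝ) :
    -deriv φ x * timeDensity c wm wp (Θ x) = (wp - wm) / 2 * Real.cos (Θ x) := by
  have hw := (hasDerivAt_angleW wm wp (Θ x)).comp x (h.hasDerivAt x)
  rw [(hφ.hasDerivAt_speed x).unique (hw.congr_of_eventuallyEq (Eventually.of_forall h.speed_eq)),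
    mul_assoc, one_div_mul_cancel (hT.timeDensity_pos _).ne', mul_one]

theorem deriv_eq_zero_iff (h : IsAngle c wm wp x₀ φ Θ) (hT : IsTurningPair c a b wm wp)
    (hφ : IsSmoothPeriodicWave c a b L φ) {x : ℝ} : deriv φ x = 0 ↔ Real.cos (Θ x) = 0 := by
  rw [← neg_eq_zero, ← mul_eq_zero_iff_right (hT.timeDensity_pos (Θ x)).ne',
    h.neg_deriv_mul_timeDensity hT hφ, mul_eq_zero_iff_left (half_pos (sub_pos.mpr hT.lt)).ne']

end IsAngle

theorem IsSmoothPeriodicWave.momentum_eq_zero_iff (h : IsSmoothPeriodicWave c a b L φ) {x : ℝ} :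
    momentum c φ x = 0 ↔ deriv φ x = 0 := by
  rw [momentum, mul_eq_zero_iff_left (h.lt_speed x).ne', neg_eq_zero]

/-- The derivative with respect to `a`, at a fixed point `x`, of `(c - φ) ^ 2 / 2` along the family
of waves of fixed `b` that are at their lower turning angle at `x₀`. The integral of the variation
`ρ'` of `timeDensity` is the variation of `angleTime` at the angle `Θ x`. -/
def jacobiField (c α β : ℝ) (φ Θ ρ' : ℝ → ℝ) (x : ℝ) : ℝ :=
  (c - φ x) * (α + β * Real.sin (Θ x)) -
    momentum c φ x * ∫ t in (-(Real.pi / 2))..Θ x, ρ' t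

/-- The derivative of `jacobiField` in `x`, with `Θ'` for the derivative of `Θ`. -/
def jacobiFieldDeriv (c b α β : ℝ) (φ Θ Θ' ρ' : ℝ → ℝ) (x : ℝ) : ℝ :=
  -deriv φ x * (α + β * Real.sin (Θ x)) + (c - φ x) * (β * (Real.cos (Θ x) * Θ' x)) -
    (force c b (c - φ x) * (∫ t in (-(Real.pi / 2))..Θ x, ρ' t) +
      momentum c φ x * (ρ' (Θ x) * Θ' x))

theorem hasDerivAt_jacobiField {Θ' : ℝ → ℝ} (hφ : IsSmoothPeriodicWave c a b L φ)
    (hT : IsTurningPair c a b wm wp) (hΘ : ∀ x, HasDerivAt Θ (Θ' x) x) (hρ' : Continuous ρ')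
    (x : ℝ) :
    HasDerivAt (jacobiField c α β φ Θ ρ') (jacobiFieldDeriv c b α β φ Θ Θ' ρ' x) x :=
  ((hφ.hasDerivAt_speed x).mul (((hΘ x).sin.const_mul β).const_add α)).sub
    ((hφ.hasDerivAt_momentum hT x).mul
      (((hρ'.integral_hasStrictDerivAt _ (Θ x)).hasDerivAt).comp x (hΘ x)))

theorem continuous_jacobiFieldDeriv {Θ' : ℝ → ℝ} (hφ : IsSmoothPeriodicWave c a b L φ)
    (hΘ : Continuous Θ) (hΘ' : Continuous Θ') (hρ' : Continuous ρ') :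
    Continuous (jacobiFieldDeriv c b α β φ Θ Θ' ρ') := by
  have hφc := hφ.smooth.continuous
  have hφ'c : Continuous (deriv φ) := hφ.smooth.continuous_deriv (by simp)
  have : Continuous fun x => ρ' (Θ x) := hρ'.comp hΘ
  have : Continuous fun x => ∫ t in (-(Real.pi / 2))..Θ x, ρ' t :=
    (intervalIntegral.continuous_primitive (fun _ _ => hρ'.intervalIntegrable _ _) _).comp hΘ
  unfold jacobiFieldDeriv momentum force
  fun_prop

theorem momentum_mul_jacobiFieldDeriv {Θ' : ℝ → ℝ} (hφ : IsSmoothPeriodicWave c a b L φ)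
    (hT : IsTurningPair c a b wm wp) (hΘ : IsAngle c wm wp x₀ φ Θ)
    (hρ' : IsAngleVariation c a b wm wp α β ρ')
    (x : ℝ) (hΘ' : Θ' x * timeDensity c wm wp (Θ x) = 1) :
    momentum c φ x * jacobiFieldDeriv c b α β φ Θ Θ' ρ' x =
      force c b (c - φ x) * jacobiField c α β φ Θ ρ' x - 1 / 2 := by
  have hvar := hρ'.variation_eq (Θ x)
  rw [← hΘ.speed_eq, ← hΘ.neg_deriv_mul_timeDensity hT hφ, ← hφ.momentum_sq] at hvar
  have hρ := (hT.timeDensity_pos (Θ x)).ne'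
  rw [← mul_right_inj' (mul_ne_zero two_ne_zero (pow_ne_zero 2 hρ))]
  simp only [jacobiField, jacobiFieldDeriv, momentum] at hvar ⊢
  linear_combination hvar +
    2 * (c - φ x) ^ 2 * -deriv φ x * timeDensity c wm wp (Θ x) * β * Real.cos (Θ x) * hΘ' -
    2 * ((c - φ x) * -deriv φ x) ^ 2 * timeDensity c wm wp (Θ x) * ρ' (Θ x) * hΘ'

theorem hasDerivAt_of_wronskian_eq_of_ne {ψ N y Z : ℝ → ℝ} {q k x : ℝ} (hψ : HasDerivAt ψ (N x) x)
    (hN : HasDerivAt N (q * ψ x) x) (hy : HasDerivAt y (Z x) x)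
    (hW : ∀ x, ψ x * Z x = N x * y x - k) (hx : ψ x ≠ 0) : HasDerivAt Z (q * y x) x := by
  have hquot : Z =ᶠ[𝓝 x] fun x => (N x * y x - k) / ψ x := by
    filter_upwards [hψ.continuousAt.eventually_ne hx] with t ht
    rw [eq_div_iff ht, ← hW t, mul_comm]
  refine ((((hN.fun_mul hy).sub_const k).fun_div hψ hx).congr_of_eventuallyEq
    hquot).congr_deriv ?_
  rw [div_eq_iff (pow_ne_zero 2 hx)]
  linear_combination N x * hW x

theorem hasDerivAt_of_wronskian_eq {ψ N y Z q : ℝ → ℝ} {k : ℝ} (hψ : ∀ x, HasDerivAt ψ (N x) x)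
    (hN : ∀ x, HasDerivAt N (q x * ψ x) x) (hy : ∀ x, HasDerivAt y (Z x) x)
    (hW : ∀ x, ψ x * Z x = N x * y x - k) (hne : ∀ x, ψ x = 0 → N x ≠ 0) (hq : Continuous q)
    (hZ : Continuous Z) (x : ℝ) : HasDerivAt Z (q x * y x) x := by
  have hd : ∀ x, ψ x ≠ 0 → HasDerivAt Z (q x * y x) x := fun x =>
    hasDerivAt_of_wronskian_eq_of_ne (hψ x) (hN x) (hy x) hW
  rcases eq_or_ne (ψ x) 0 with hx | hx
  · exact hasDerivAt_of_eventually_hasDerivAt (g := fun x => q x * y x)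
      (((hψ x).eventually_ne (hne x hx)).mono hd) hZ.continuousAt
      (hq.continuousAt.mul (hy x).continuousAt)
  · exact hd x hx

theorem IsSmoothPeriodicWave.continuous_hillPotential (hφ : IsSmoothPeriodicWave c a b L φ) :
    Continuous fun x => 4 - 3 * c / (c - φ x) :=
  continuous_const.sub (continuous_const.div (continuous_const.sub hφ.smooth.continuous)
    fun x => (hφ.lt_speed x).ne')

theorem hasDerivAt_jacobiFieldDeriv (hφ : IsSmoothPeriodicWave c a b L φ)
    (hT : IsTurningPair c a b wm wp) (hΘ : IsAngle c wm wp x₀ φ Θ)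
    (hρ' : IsAngleVariation c a b wm wp α β ρ') (x : ℝ) :
    HasDerivAt (jacobiFieldDeriv c b α β φ Θ (fun x => 1 / timeDensity c wm wp (Θ x)) ρ')
      ((4 - 3 * c / (c - φ x)) * jacobiField c α β φ Θ ρ' x) x := by
  have hpos := fun x => (hT.timeDensity_pos (Θ x)).ne'
  have hΘ' : Continuous fun x => 1 / timeDensity c wm wp (Θ x) :=
    continuous_const.div (hT.continuous_timeDensity.comp hΘ.continuous) hpos
  exact hasDerivAt_of_wronskian_eq (hφ.hasDerivAt_momentum hT) hφ.hasDerivAt_force_speed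
    (hasDerivAt_jacobiField hφ hT hΘ.hasDerivAt hρ'.continuous)
    (fun x => momentum_mul_jacobiFieldDeriv hφ hT hΘ hρ' x (one_div_mul_cancel (hpos x)))
    (fun _ => hφ.force_ne_zero hT) hφ.continuous_hillPotential
    (continuous_jacobiFieldDeriv hφ hΘ.continuous hΘ' hρ'.continuous) x

theorem jacobiFieldDeriv_of_cos_eq_zero {Θ' : ℝ → ℝ} {x : ℝ}
    (hφ : IsSmoothPeriodicWave c a b L φ) (hT : IsTurningPair c a b wm wp)
    (hΘ : IsAngle c wm wp x₀ φ Θ) (hx : Real.cos (Θ x) = 0) :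
    jacobiFieldDeriv c b α β φ Θ Θ' ρ' x =
      -(force c b (c - φ x) * ∫ t in (-(Real.pi / 2))..Θ x, ρ' t) := by
  have hφ' := (hΘ.deriv_eq_zero_iff hT hφ).mpr hx
  simp only [jacobiFieldDeriv, hφ', hφ.momentum_eq_zero_iff.mpr hφ', hx]
  ring

/-- The data of the periodic Hill equation `u'' = q u` on the period cell `[x₀, x₀ + L]`: a periodic
solution `ψ`, with derivative `N`, that has the one further zero `x₁` in the cell, and a second
solution `y`, with derivative `Z`, whose derivative jumps by `-(N x₀ * τ)` over the period. The
factor `1 / 2` of the Wronskian is that of the Jacobi field of the waves. -/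
structure Profile (L x₀ x₁ τ : ℝ) (q ψ N y Z : ℝ → ℝ) : Prop where
  lt_left : x₀ < x₁
  lt_right : x₁ < x₀ + L
  cont_q : Continuous q
  deriv_ψ : ∀ x, HasDerivAt ψ (N x) x
  deriv_N : ∀ x, HasDerivAt N (q x * ψ x) x
  ψ_left : ψ x₀ = 0
  ψ_mid : ψ x₁ = 0
  ψ_right : ψ (x₀ + L) = 0
  ψ_ne_left : ∀ x ∈ Set.Ioo x₀ x₁, ψ x ≠ 0
  ψ_ne_right : ∀ x ∈ Set.Ioo x₁ (x₀ + L), ψ x ≠ 0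
  N_left : 0 < N x₀
  N_mid : N x₁ < 0
  N_right : N (x₀ + L) = N x₀
  deriv_y : ∀ x, HasDerivAt y (Z x) x
  deriv_Z : ∀ x, HasDerivAt Z (q x * y x) x
  wronskian : ∀ x, ψ x * Z x = N x * y x - 1 / 2
  Z_left : Z x₀ = 0
  Z_right : Z (x₀ + L) = -(N x₀ * τ)

theorem profile_jacobiField (hφ : IsSmoothPeriodicWave c a b L φ)
    (hT : IsTurningPair c a b wm wp) (hΘ : IsAngle c wm wp x₀ φ Θ)
    (hρ' : IsAngleVariation c a b wm wp α β ρ') {x₁ : ℝ} (hx₁ : x₁ ∈ Set.Ioo x₀ (x₀ + L))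
    (hΘ₁ : Θ x₁ = Real.pi / 2) :
    Profile L x₀ x₁ (∫ θ in (-(Real.pi / 2))..(3 * Real.pi / 2), ρ' θ)
      (fun x => 4 - 3 * c / (c - φ x)) (momentum c φ) (fun x => force c b (c - φ x))
      (jacobiField c α β φ Θ ρ')
      (jacobiFieldDeriv c b α β φ Θ (fun x => 1 / timeDensity c wm wp (Θ x)) ρ') := by
  have hΘL := hΘ.apply_add_period hT hφ
  have hcos₀ : Real.cos (Θ x₀) = 0 := by rw [hΘ.apply_left, Real.cos_neg, Real.cos_pi_div_two]
  have hcosL : Real.cos (Θ (x₀ + L)) = 0 := hΘL ▸ Real.cos_eq_zero_iff.mpr ⟨1, by norm_num⟩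
  have hψ : ∀ {x}, momentum c φ x = 0 ↔ Real.cos (Θ x) = 0 :=
    hφ.momentum_eq_zero_iff.trans (hΘ.deriv_eq_zero_iff hT hφ)
  have hw₀ : c - φ x₀ = wm := by
    rw [hΘ.speed_eq, hΘ.apply_left, angleW, Real.sin_neg, Real.sin_pi_div_two]
    ring
  have hw₁ : c - φ x₁ = wp := by
    rw [hΘ.speed_eq, hΘ₁, angleW, Real.sin_pi_div_two]
    ring
  exact
    { lt_left := hx₁.1
      lt_right := hx₁.2
      cont_q := hφ.continuous_hillPotential
      deriv_ψ := hφ.hasDerivAt_momentum hT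
      deriv_N := hφ.hasDerivAt_force_speed
      ψ_left := hψ.mpr hcos₀
      ψ_mid := hψ.mpr (by rw [hΘ₁, Real.cos_pi_div_two])
      ψ_right := hψ.mpr hcosL
      ψ_ne_left := fun x hx => hψ.not.mpr (Real.cos_pos_of_mem_Ioo
        ⟨hΘ.apply_left ▸ hΘ.strictMono hT hx.1, hΘ₁ ▸ hΘ.strictMono hT hx.2⟩).ne'
      ψ_ne_right := fun x hx => hψ.not.mpr (Real.cos_neg_of_pi_div_two_lt_of_lt
        (hΘ₁ ▸ hΘ.strictMono hT hx.1)
        ((hΘ.strictMono hT hx.2).trans_eq (hΘL.trans (by ring)))).ne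
      N_left := by rw [hw₀]; exact hT.force_left
      N_mid := by rw [hw₁]; exact hT.force_right
      N_right := by rw [hφ.periodic]
      deriv_y := hasDerivAt_jacobiField hφ hT hΘ.hasDerivAt hρ'.continuous
      deriv_Z := hasDerivAt_jacobiFieldDeriv hφ hT hΘ hρ'
      wronskian := fun x => momentum_mul_jacobiFieldDeriv hφ hT hΘ hρ' x
        (one_div_mul_cancel (hT.timeDensity_pos _).ne')
      Z_left := by
        rw [jacobiFieldDeriv_of_cos_eq_zero hφ hT hΘ hcos₀, hΘ.apply_left,
          intervalIntegral.integral_same, mul_zero, neg_zero]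
      Z_right := by
        rw [jacobiFieldDeriv_of_cos_eq_zero hφ hT hΘ hcosL, hΘL, hφ.periodic x₀] }

theorem IsSmoothPeriodicWave.exists_profile (hc : 0 < c) (hab : (a, b) ∈ existenceRegion c)
    (hφ : IsSmoothPeriodicWave c a b L φ) :
    ∃ τ x₀ x₁ ψ N y Z, HasDerivAt (fun a' => periodFn c a' b) τ a ∧
      Profile L x₀ x₁ τ (fun x => 4 - 3 * c / (c - φ x)) ψ N y Z := by
  obtain ⟨wm, wp, α, β, ρ', hT, hρ', hτ⟩ := exists_isAngleVariation hc hab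
  obtain ⟨x₀, Θ, hΘ⟩ := hφ.exists_isAngle hT
  obtain ⟨x₁, hx₁, hΘ₁⟩ := hΘ.exists_apply_eq_pi_div_two hT hφ
  exact ⟨_, x₀, x₁, _, _, _, _, hτ, profile_jacobiField hφ hT hΘ hρ' hx₁ hΘ₁⟩

end JacobiField

/-! ### The Hill form -/

section HillForm

open Filter Topology

theorem tendsto_sq_div_of_hasDerivAt {z ψ : ℝ → ℝ} {s z' n : ℝ} (hz : HasDerivAt z z' s)
    (hψ : HasDerivAt ψ n s) (hzs : z s = 0) (hψs : ψ s = 0) (hn : n ≠ 0) :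
    Tendsto (fun x => z x ^ 2 / ψ x) (𝓝[≠] s) (𝓝 0) := by
  have hz₀ : Tendsto z (𝓝[≠] s) (𝓝 0) := hzs ▸ hz.continuousAt.tendsto.mono_left nhdsWithin_le_nhds
  have hslope := ((hasDerivAt_iff_tendsto_slope.mp hz).mul hz₀).div
    (hasDerivAt_iff_tendsto_slope.mp hψ) hn
  rw [mul_zero, zero_div] at hslope
  refine hslope.congr' ?_
  filter_upwards [self_mem_nhdsWithin] with x hx
  have hxs : x - s ≠ 0 := sub_ne_zero.mpr hx
  simp only [slope_def_field, hzs, hψs, sub_zero, Pi.div_apply]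
  rw [div_mul_eq_mul_div, div_div_div_cancel_right₀ hxs, sq]

theorem mem_Icc_of_monotoneOn_Ioo {G : ℝ → ℝ} {s t A B : ℝ} (hG : MonotoneOn G (Set.Ioo s t))
    (hs : Tendsto G (𝓝[>] s) (𝓝 A)) (ht : Tendsto G (𝓝[<] t) (𝓝 B)) {x : ℝ}
    (hx : x ∈ Set.Ioo s t) : G x ∈ Set.Icc A B := by
  constructor
  · refine le_of_tendsto hs ?_
    filter_upwards [Ioo_mem_nhdsGT hx.1] with r hr
    exact hG ⟨hr.1, hr.2.trans hx.2⟩ hx hr.2.le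
  · refine ge_of_tendsto ht ?_
    filter_upwards [Ioo_mem_nhdsLT hx.2] with r hr
    exact hG hx ⟨hx.1.trans hr.1, hr.2⟩ hr.1.le

/-- The quadratic form of the Hill operator `-∂² + q` on `[s, t]`, at a function `z` with
derivative `z'`. -/
def hillForm (q z z' : ℝ → ℝ) (s t : ℝ) : ℝ := ∫ x in s..t, (z' x ^ 2 + q x * z x ^ 2)

theorem hillForm_add_hillForm {q z z' : ℝ → ℝ} (hq : Continuous q) (hz : Continuous z)
    (hz' : Continuous z') (r s t : ℝ) :
    hillForm q z z' r s + hillForm q z z' s t = hillForm q z z' r t :=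
  intervalIntegral.integral_add_adjacent_intervals
    (Continuous.intervalIntegrable (by fun_prop) _ _)
    (Continuous.intervalIntegrable (by fun_prop) _ _)

/-- What remains of the Hill form on `[s, x]` after subtracting the null Lagrangian
`(N / ψ * z ^ 2)'` of a solution `ψ`, where `N = ψ'`. Its derivative is a square. -/
def jacobiRemainder (q ψ N z z' : ℝ → ℝ) (s x : ℝ) : ℝ :=
  hillForm q z z' s x - N x * (z x ^ 2 / ψ x)

variable {q ψ N z z' : ℝ → ℝ} {s t : ℝ}

section Jacobi

variable (hq : Continuous q) (hψ : ∀ x, HasDerivAt ψ (N x) x)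
  (hN : ∀ x, HasDerivAt N (q x * ψ x) x) (hz : ∀ x, HasDerivAt z (z' x) x) (hz' : Continuous z')
include hq hz hz'

theorem hasDerivAt_hillForm (s x : ℝ) :
    HasDerivAt (hillForm q z z' s) (z' x ^ 2 + q x * z x ^ 2) x := by
  have hzc : Continuous z := continuous_iff_continuousAt.mpr fun x => (hz x).continuousAt
  exact (Continuous.integral_hasStrictDerivAt (by fun_prop) s x).hasDerivAt

include hψ hN

theorem hasDerivAt_jacobiRemainder (s : ℝ) {x : ℝ} (hx : ψ x ≠ 0) :
    HasDerivAt (jacobiRemainder q ψ N z z' s) ((z' x - N x / ψ x * z x) ^ 2) x := by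
  refine ((hasDerivAt_hillForm hq hz hz' s x).sub
    ((hN x).mul (((hz x).fun_pow 2).fun_div (hψ x) hx))).congr_deriv ?_
  field_simp
  push_cast
  ring

theorem tendsto_jacobiRemainder (s : ℝ) {x : ℝ} (hzx : z x = 0) (hψx : ψ x = 0) (hNx : N x ≠ 0) :
    Tendsto (jacobiRemainder q ψ N z z' s) (𝓝[≠] x) (𝓝 (hillForm q z z' s x)) := by
  have hlim := ((hasDerivAt_hillForm hq hz hz' s x).continuousAt.tendsto.mono_left
    nhdsWithin_le_nhds).sub (((hN x).continuousAt.tendsto.mono_left nhdsWithin_le_nhds).mul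
      (tendsto_sq_div_of_hasDerivAt (hz x) (hψ x) hzx hψx hNx))
  rwa [mul_zero, sub_zero] at hlim

variable (hψs : ψ s = 0) (hψt : ψ t = 0) (hne : ∀ x ∈ Set.Ioo s t, ψ x ≠ 0) (hNs : N s ≠ 0)
  (hNt : N t ≠ 0) (hzs : z s = 0) (hzt : z t = 0)
include hψs hψt hne hNs hNt hzs hzt

theorem jacobiRemainder_mem_Icc {x : ℝ} (hx : x ∈ Set.Ioo s t) :
    jacobiRemainder q ψ N z z' s x ∈ Set.Icc 0 (hillForm q z z' s t) := by
  have hd := fun x hx => hasDerivAt_jacobiRemainder hq hψ hN hz hz' s (hne x hx)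
  have hmono : MonotoneOn (jacobiRemainder q ψ N z z' s) (Set.Ioo s t) := by
    refine monotoneOn_of_deriv_nonneg (convex_Ioo s t)
      (fun x hx => (hd x hx).continuousAt.continuousWithinAt) ?_ ?_ <;>
    · rw [interior_Ioo]
      intro x hx
      first
        | exact (hd x hx).differentiableAt.differentiableWithinAt
        | exact (hd x hx).deriv ▸ sq_nonneg _
  have hlim := fun x => tendsto_jacobiRemainder hq hψ hN hz hz' s (x := x)
  have hs := hlim s hzs hψs hNs
  rw [hillForm, intervalIntegral.integral_same] at hs
  exact mem_Icc_of_monotoneOn_Ioo hmono (hs.mono_left (nhdsGT_le_nhdsNE s))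
    ((hlim t hzt hψt hNt).mono_left (nhdsLT_le_nhdsNE t)) hx

theorem hillForm_nonneg_of_zeros (hst : s < t) : 0 ≤ hillForm q z z' s t := by
  obtain ⟨x, hx⟩ := exists_between hst
  have h := jacobiRemainder_mem_Icc hq hψ hN hz hz' hψs hψt hne hNs hNt hzs hzt hx
  exact h.1.trans h.2

theorem exists_eq_mul_of_hillForm_eq_zero (hst : s < t) (hzero : hillForm q z z' s t = 0) :
    ∃ k, ∀ x ∈ Set.Icc s t, z x = k * ψ x := by
  have hG : ∀ x ∈ Set.Ioo s t, jacobiRemainder q ψ N z z' s x = 0 := fun x hx => by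
    have h := jacobiRemainder_mem_Icc hq hψ hN hz hz' hψs hψt hne hNs hNt hzs hzt hx
    rw [hzero, Set.Icc_self] at h
    exact h
  have hode : ∀ x ∈ Set.Ioo s t, z' x = N x / ψ x * z x := fun x hx => by
    have hconst : HasDerivAt (jacobiRemainder q ψ N z z' s) 0 x :=
      (hasDerivAt_const x (0 : ℝ)).congr_of_eventuallyEq
        (mem_of_superset (Ioo_mem_nhds hx.1 hx.2) hG)
    exact sub_eq_zero.mp (pow_eq_zero_iff two_ne_zero |>.mp
      ((hasDerivAt_jacobiRemainder hq hψ hN hz hz' s (hne x hx)).unique hconst))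
  have hquot : ∀ x ∈ Set.Ioo s t, HasDerivAt (fun x => z x / ψ x) 0 x := fun x hx => by
    have hψx := hne x hx
    refine ((hz x).div (hψ x) hψx).congr_deriv ?_
    rw [hode x hx]
    field_simp
    ring
  obtain ⟨m, hm⟩ := exists_between hst
  refine ⟨z m / ψ m, fun x hx => ?_⟩
  rcases hx.1.eq_or_lt with rfl | hsx
  · rw [hzs, hψs, mul_zero]
  rcases hx.2.eq_or_lt with rfl | hxt
  · rw [hzt, hψt, mul_zero]
  rw [← isOpen_Ioo.is_const_of_deriv_eq_zero isPreconnected_Ioo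
    (fun r hr => (hquot r hr).differentiableAt.differentiableWithinAt)
    (fun r hr => (hquot r hr).deriv) ⟨hsx, hxt⟩ hm, div_mul_cancel₀ _ (hne x ⟨hsx, hxt⟩)]

end Jacobi

namespace Profile

variable {L x₀ x₁ τ : ℝ} {y Z : ℝ → ℝ}

theorem N_mul_y (P : Profile L x₀ x₁ τ q ψ N y Z) {x : ℝ} (hx : ψ x = 0) : N x * y x = 1 / 2 := by
  have h := P.wronskian x
  rw [hx, zero_mul] at h
  linarith

theorem y_right (P : Profile L x₀ x₁ τ q ψ N y Z) : y (x₀ + L) = y x₀ :=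
  mul_left_cancel₀ P.N_left.ne' <| by
    rw [P.N_mul_y P.ψ_left, ← P.N_right, P.N_mul_y P.ψ_right]

theorem cont_y (P : Profile L x₀ x₁ τ q ψ N y Z) : Continuous y :=
  continuous_iff_continuousAt.mpr fun x => (P.deriv_y x).continuousAt

theorem cont_Z (P : Profile L x₀ x₁ τ q ψ N y Z) : Continuous Z :=
  continuous_iff_continuousAt.mpr fun x => (P.deriv_Z x).continuousAt

theorem cont_ψ (P : Profile L x₀ x₁ τ q ψ N y Z) : Continuous ψ :=
  continuous_iff_continuousAt.mpr fun x => (P.deriv_ψ x).continuousAt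

theorem cont_N (P : Profile L x₀ x₁ τ q ψ N y Z) : Continuous N :=
  continuous_iff_continuousAt.mpr fun x => (P.deriv_N x).continuousAt

/-- The cross terms integrate to boundary terms because `y` solves the Hill equation. -/
theorem hillForm_add_smul (P : Profile L x₀ x₁ τ q ψ N y Z) (hz : ∀ x, HasDerivAt z (z' x) x)
    (hz' : Continuous z') (hzL : z (x₀ + L) = 0) (r : ℝ) :
    hillForm q (fun x => z x + r * y x) (fun x => z' x + r * Z x) x₀ (x₀ + L) =
      hillForm q z z' x₀ (x₀ + L) - τ / 2 * r ^ 2 := by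
  have hcy := P.cont_y
  have hcZ := P.cont_Z
  have hcq := P.cont_q
  have hcz : Continuous z := continuous_iff_continuousAt.mpr fun x => (hz x).continuousAt
  have hcross : ∫ x in x₀..x₀ + L, (2 * r * (q x * y x * z x + Z x * z' x) +
      r ^ 2 * (q x * y x * y x + Z x * Z x)) = -(τ / 2 * r ^ 2) := by
    have hd := fun x => (((P.deriv_Z x).fun_mul (hz x)).const_mul (2 * r)).fun_add
      (((P.deriv_Z x).fun_mul (P.deriv_y x)).const_mul (r ^ 2))
    rw [intervalIntegral.integral_eq_sub_of_hasDerivAt (fun x _ => hd x)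
      (Continuous.intervalIntegrable (by fun_prop) _ _), P.Z_left, hzL, P.Z_right, P.y_right]
    linear_combination (-r ^ 2 * τ) * P.N_mul_y P.ψ_left
  rw [sub_eq_add_neg, ← hcross, hillForm, hillForm, ← intervalIntegral.integral_add
    (Continuous.intervalIntegrable (by fun_prop) _ _)
    (Continuous.intervalIntegrable (by fun_prop) _ _)]
  exact intervalIntegral.integral_congr fun x _ => by ring

theorem hillForm_nonneg (P : Profile L x₀ x₁ τ q ψ N y Z) (hz : ∀ x, HasDerivAt z (z' x) x)
    (hz' : Continuous z') (hz₀ : z x₀ = 0) (hz₁ : z x₁ = 0) (hzL : z (x₀ + L) = 0) :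
    0 ≤ hillForm q z z' x₀ (x₀ + L) ∧
      (hillForm q z z' x₀ (x₀ + L) = 0 → ∃ k, ∀ x ∈ Set.Icc x₀ (x₀ + L), z x = k * ψ x) := by
  have hNL : N (x₀ + L) ≠ 0 := P.N_right ▸ P.N_left.ne'
  have hleft := hillForm_nonneg_of_zeros P.cont_q P.deriv_ψ P.deriv_N hz hz' P.ψ_left P.ψ_mid
    P.ψ_ne_left P.N_left.ne' P.N_mid.ne hz₀ hz₁ P.lt_left
  have hright := hillForm_nonneg_of_zeros P.cont_q P.deriv_ψ P.deriv_N hz hz' P.ψ_mid P.ψ_right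
    P.ψ_ne_right P.N_mid.ne hNL hz₁ hzL P.lt_right
  rw [← hillForm_add_hillForm P.cont_q
    (continuous_iff_continuousAt.mpr fun x => (hz x).continuousAt) hz' x₀ x₁ (x₀ + L)]
  refine ⟨add_nonneg hleft hright, fun hzero => ?_⟩
  obtain ⟨k, hk⟩ := exists_eq_mul_of_hillForm_eq_zero P.cont_q P.deriv_ψ P.deriv_N hz hz' P.ψ_left
    P.ψ_mid P.ψ_ne_left P.N_left.ne' P.N_mid.ne hz₀ hz₁ P.lt_left (by linarith)
  obtain ⟨k', hk'⟩ := exists_eq_mul_of_hillForm_eq_zero P.cont_q P.deriv_ψ P.deriv_N hz hz' P.ψ_mid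
    P.ψ_right P.ψ_ne_right P.N_mid.ne hNL hz₁ hzL P.lt_right (by linarith)
  have hslope : ∀ {r A B}, A < B → x₁ ∈ Set.Icc A B → (∀ x ∈ Set.Icc A B, z x = r * ψ x) →
      z' x₁ = r * N x₁ := fun hAB hmem h =>
    (uniqueDiffOn_Icc hAB x₁ hmem).eq_deriv _ (hz x₁).hasDerivWithinAt
      (((P.deriv_ψ x₁).const_mul _).hasDerivWithinAt.congr h (h x₁ hmem))
  have hkk' : k = k' := mul_right_cancel₀ P.N_mid.ne <|
    (hslope P.lt_left ⟨P.lt_left.le, le_rfl⟩ hk).symm.trans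
      (hslope P.lt_right ⟨le_rfl, P.lt_right.le⟩ hk')
  refine ⟨k, fun x hx => ?_⟩
  rcases le_total x x₁ with hx₁ | hx₁
  · exact hk x ⟨hx.1, hx₁⟩
  · exact hkk' ▸ hk' x ⟨hx₁, hx.2⟩

/-- Under the condition at `x₁`, subtracting a multiple of `y` produces a function vanishing at
all the zeros of `ψ`. -/
theorem le_hillForm (P : Profile L x₀ x₁ τ q ψ N y Z) {u u' : ℝ → ℝ}
    (hu : ∀ x, HasDerivAt u (u' x) x) (hu' : Continuous u') (hper : u (x₀ + L) = u x₀)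
    (hcond : N x₁ * u x₁ = N x₀ * u x₀) :
    -(τ / 2 * (2 * N x₀ * u x₀) ^ 2) ≤ hillForm q u u' x₀ (x₀ + L) ∧
      (hillForm q u u' x₀ (x₀ + L) = -(τ / 2 * (2 * N x₀ * u x₀) ^ 2) →
        ∃ k, ∀ x ∈ Set.Icc x₀ (x₀ + L), u x = 2 * N x₀ * u x₀ * y x + k * ψ x) := by
  set r := 2 * N x₀ * u x₀
  have hcZ := P.cont_Z
  have hz : ∀ x, HasDerivAt (fun x => u x - r * y x) (u' x - r * Z x) x := fun x =>
    (hu x).sub ((P.deriv_y x).const_mul r)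
  have hz' : Continuous fun x => u' x - r * Z x := by fun_prop
  have hz₀ : u x₀ - r * y x₀ = 0 := by
    linear_combination (-2 * u x₀) * P.N_mul_y P.ψ_left
  have hz₁ : u x₁ - r * y x₁ = 0 := mul_left_cancel₀ P.N_mid.ne <| by
    linear_combination hcond - 2 * N x₀ * u x₀ * P.N_mul_y P.ψ_mid
  have hzL : u (x₀ + L) - r * y (x₀ + L) = 0 := by rw [hper, P.y_right, hz₀]
  have hform := P.hillForm_add_smul hz hz' hzL r
  simp only [sub_add_cancel] at hform
  obtain ⟨hnonneg, hzero⟩ := P.hillForm_nonneg hz hz' hz₀ hz₁ hzL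
  refine ⟨by linarith, fun heq => ?_⟩
  obtain ⟨k, hk⟩ := hzero (by linarith)
  exact ⟨k, fun x hx => by linear_combination hk x hx⟩

end Profile

end HillForm

section ProfileForm

variable {L : ℝ} [hL : Fact (0 < L)] {x₀ x₁ τ c : ℝ} {W : C(AddCircle L, ℂ)}
  {w q ψ N y Z : ℝ → ℝ}

namespace Profile

theorem exists_isLift_indicator (P : Profile L x₀ x₁ τ q ψ N y Z) :
    ∃ χ : L2per L × L2per L, IsLift x₀ χ ((Set.Iio x₁).indicator fun x => (ψ x : ℂ))
      ((Set.Iio x₁).indicator fun x => (N x : ℂ)) := by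
  have hright : ∀ {x}, x₁ ≤ x → (Set.Iio x₁).indicator (fun x => (ψ x : ℂ)) x = 0 := fun hx =>
    Set.indicator_of_notMem (Set.notMem_Iio.mpr hx) _
  refine exists_isLift ?_ ?_ (fun x _ => ?_) ?_
  · refine (continuous_indicator (fun x hx => ?_) ?_).continuousOn
    · rw [frontier_Iio, Set.mem_singleton_iff] at hx
      rw [hx, P.ψ_mid, Complex.ofReal_zero]
    · exact (Complex.continuous_ofReal.comp P.cont_ψ).continuousOn
  · rw [hright P.lt_right.le, Set.indicator_of_mem (Set.mem_Iio.mpr P.lt_left), P.ψ_left,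
      Complex.ofReal_zero]
  · rcases lt_or_ge x x₁ with hx | hx
    · rw [Set.indicator_of_mem (Set.mem_Iio.mpr hx)]
      refine ((P.deriv_ψ x).ofReal_comp.congr_of_eventuallyEq ?_).hasDerivWithinAt
      filter_upwards [Iio_mem_nhds hx] with t ht using Set.indicator_of_mem ht _
    · rw [Set.indicator_of_notMem (Set.notMem_Iio.mpr hx)]
      exact (hasDerivWithinAt_const x _ 0).congr (fun t ht => hright (hx.trans ht.le)) (hright hx)
  · exact (memLp_two_of_continuousOn
      (Complex.continuous_ofReal.comp P.cont_N).continuousOn).indicator measurableSet_Iio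

variable (P : Profile L x₀ x₁ τ q ψ N y Z)
  (hW : ∀ x : ℝ, W (x : AddCircle L) = ((w x)⁻¹ : ℝ)) (hq : ∀ x, q x = 4 - 3 * c / w x)

include P hW hq

theorem energyForm_indicator {η χ : L2per L × L2per L} {g g' : ℝ → ℂ}
    (hχ : IsLift x₀ χ ((Set.Iio x₁).indicator fun x => (ψ x : ℂ))
      ((Set.Iio x₁).indicator fun x => (N x : ℂ))) (hη : IsLift x₀ η g g') :
    energyForm c (mulOp W) η χ =
      (L : ℂ)⁻¹ * ((starRingEnd ℂ) (g x₁) * (N x₁ : ℂ) - (starRingEnd ℂ) (g x₀) * (N x₀ : ℂ)) := by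
  have hsub : Set.Icc x₀ x₁ ⊆ Set.Icc x₀ (x₀ + L) := Set.Icc_subset_Icc_right P.lt_right.le
  have hg' : IntervalIntegrable g' volume x₀ x₁ := hη.intervalIntegrable.mono_set <| by
    rwa [Set.uIcc_of_le P.lt_left.le, Set.uIcc_of_le (P.lt_left.trans P.lt_right).le]
  have hind : (fun x => (starRingEnd ℂ) (g' x) * (Set.Iio x₁).indicator (fun x => (N x : ℂ)) x +
        q x * ((starRingEnd ℂ) (g x) * (Set.Iio x₁).indicator (fun x => (ψ x : ℂ)) x)) =
      (Set.Iio x₁).indicator fun x =>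
        (starRingEnd ℂ) (g' x) * N x + q x * ((starRingEnd ℂ) (g x) * ψ x) := by
    funext x
    by_cases hx : x ∈ Set.Iio x₁ <;> simp [hx]
  rw [hη.energyForm_eq hW hq hχ, hind, ← integral_conj_mul_solution P.lt_left.le (hη.cont.mono hsub)
    (fun x hx => hη.deriv x ⟨hx.1, hx.2.trans P.lt_right⟩) hg' P.cont_ψ P.cont_q P.cont_N
    (fun x _ => P.deriv_N x)]
  rw [intervalIntegral.integral_of_le (P.lt_left.trans P.lt_right).le,
    intervalIntegral.integral_of_le P.lt_left.le, setIntegral_indicator measurableSet_Iio,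
    integral_Ioc_eq_integral_Ioo]
  congr 3
  ext x
  exact ⟨fun hx => ⟨hx.1.1, hx.2⟩, fun hx => ⟨⟨hx.1, (hx.2.trans P.lt_right).le⟩, hx.2⟩⟩

theorem energyForm_jacobi {η ζ : L2per L × L2per L} {g g' : ℝ → ℂ}
    (hζ : IsLift x₀ ζ (fun x => (y x : ℂ)) (fun x => (Z x : ℂ))) (hη : IsLift x₀ η g g') :
    energyForm c (mulOp W) η ζ =
      -((L : ℂ)⁻¹ * (N x₀ : ℂ) * (τ : ℂ)) * (starRingEnd ℂ) (g x₀) := by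
  rw [hη.energyForm_solution hW hq P.cont_q hζ P.cont_y P.cont_Z fun x _ => P.deriv_Z x,
    P.Z_left, P.Z_right]
  push_cast
  ring

theorem energyForm_periodic {η ζ : L2per L × L2per L} {g g' : ℝ → ℂ}
    (hζ : IsLift x₀ ζ (fun x => (ψ x : ℂ)) (fun x => (N x : ℂ))) (hη : IsLift x₀ η g g') :
    energyForm c (mulOp W) η ζ = 0 := by
  rw [hη.energyForm_solution hW hq P.cont_q hζ P.cont_ψ P.cont_N fun x _ => P.deriv_N x,
    P.N_right, sub_self, mul_zero, mul_zero]

end Profile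

theorem IsLift.re_energyForm_self (hW : ∀ x : ℝ, W (x : AddCircle L) = ((w x)⁻¹ : ℝ))
    (hq : ∀ x, q x = 4 - 3 * c / w x) (hqc : Continuous q) {u : L2per L × L2per L}
    {U U' : ℝ → ℂ} (hu : IsLift x₀ u U U') (hU : Continuous U) (hU' : Continuous U') :
    L * (energyForm c (mulOp W) u u).re =
      hillForm q (fun x => (U x).re) (fun x => (U' x).re) x₀ (x₀ + L) +
        hillForm q (fun x => (U x).im) (fun x => (U' x).im) x₀ (x₀ + L) := by
  have hnormSq : ∀ x, (starRingEnd ℂ) (U' x) * U' x + (q x : ℂ) * ((starRingEnd ℂ) (U x) * U x) =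
      (((U' x).re ^ 2 + q x * (U x).re ^ 2 + ((U' x).im ^ 2 + q x * (U x).im ^ 2) : ℝ) : ℂ) := by
    intro x
    rw [← Complex.normSq_eq_conj_mul_self, ← Complex.normSq_eq_conj_mul_self,
      Complex.normSq_apply, Complex.normSq_apply]
    push_cast
    ring
  rw [hu.energyForm_eq hW hq hu, intervalIntegral.integral_congr fun x _ => hnormSq x,
    intervalIntegral.integral_ofReal, ← Complex.ofReal_inv, ← Complex.ofReal_mul,
    Complex.ofReal_re, mul_inv_cancel_left₀ hL.out.ne', hillForm, hillForm,
    ← intervalIntegral.integral_add (Continuous.intervalIntegrable (by fun_prop) _ _)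
      (Continuous.intervalIntegrable (by fun_prop) _ _)]

theorem Profile.le_energyForm (P : Profile L x₀ x₁ τ q ψ N y Z)
    (hW : ∀ x : ℝ, W (x : AddCircle L) = ((w x)⁻¹ : ℝ)) (hq : ∀ x, q x = 4 - 3 * c / w x)
    {u : L2per L × L2per L} {U U' : ℝ → ℂ} (hu : IsLift x₀ u U U')
    (hU : ∀ x, HasDerivAt U (U' x) x) (hU' : Continuous U')
    (hcond : (N x₁ : ℂ) * U x₁ = (N x₀ : ℂ) * U x₀) :
    -(τ / 2 * (2 * N x₀ * ‖U x₀‖) ^ 2) ≤ L * (energyForm c (mulOp W) u u).re ∧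
      (L * (energyForm c (mulOp W) u u).re = -(τ / 2 * (2 * N x₀ * ‖U x₀‖) ^ 2) →
        ∃ k : ℂ, ∀ x ∈ Set.Icc x₀ (x₀ + L),
          U x = 2 * (N x₀ : ℂ) * U x₀ * (y x : ℂ) + k * (ψ x : ℂ)) := by
  have hre : ∀ x, HasDerivAt (fun x => (U x).re) (U' x).re x := fun x =>
    Complex.reCLM.hasFDerivAt.comp_hasDerivAt x (hU x)
  have him : ∀ x, HasDerivAt (fun x => (U x).im) (U' x).im x := fun x =>
    Complex.imCLM.hasFDerivAt.comp_hasDerivAt x (hU x)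
  have hre_cond := congrArg Complex.re hcond
  have him_cond := congrArg Complex.im hcond
  rw [Complex.re_ofReal_mul, Complex.re_ofReal_mul] at hre_cond
  rw [Complex.im_ofReal_mul, Complex.im_ofReal_mul] at him_cond
  obtain ⟨hre_le, hre_eq⟩ := P.le_hillForm hre (Complex.continuous_re.comp hU')
    (congrArg Complex.re hu.per) hre_cond
  obtain ⟨him_le, him_eq⟩ := P.le_hillForm him (Complex.continuous_im.comp hU')
    (congrArg Complex.im hu.per) him_cond
  rw [hu.re_energyForm_self hW hq P.cont_q
    (continuous_iff_continuousAt.mpr fun x => (hU x).continuousAt) hU', mul_pow,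
    ← Complex.normSq_eq_norm_sq, Complex.normSq_apply]
  refine ⟨by linarith, fun heq => ?_⟩
  obtain ⟨k, hk⟩ := hre_eq (by linarith)
  obtain ⟨k', hk'⟩ := him_eq (by linarith)
  refine ⟨⟨k, k'⟩, fun x hx => Complex.ext ?_ ?_⟩
  · simpa using hk x hx
  · simpa using hk' x hx

end ProfileForm

/-! ### The index of the operator -/

section SesquilinearForm

variable {M : Type*} [AddCommGroup M] [Module ℂ M] (E : M →ₗ⋆[ℂ] M →ₗ[ℂ] ℂ)

theorem re_apply_sum_smul_neg {ι : Type*} [Fintype ι] {η : ι → M}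
    (horth : Pairwise fun i j => E (η i) (η j) = 0) (hneg : ∀ i, (E (η i) (η i)).re < 0)
    {x : ι → ℂ} (hx : x ≠ 0) : (E (∑ i, x i • η i) (∑ i, x i • η i)).re < 0 := by
  classical
  have hdiag : E (∑ i, x i • η i) (∑ i, x i • η i) =
      ∑ i, ((‖x i‖ ^ 2 : ℝ) : ℂ) * E (η i) (η i) := by
    simp only [map_sum, LinearMap.sum_apply, map_smulₛₗ, LinearMap.smul_apply, smul_eq_mul,
      RingHom.id_apply]
    refine Finset.sum_congr rfl fun i _ => ?_
    rw [Finset.sum_eq_single i (fun j _ hj => by simp [horth hj])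
      fun h => absurd (Finset.mem_univ i) h, ← mul_assoc, Complex.mul_conj,
      Complex.normSq_eq_norm_sq]
  obtain ⟨i, hi⟩ := Function.ne_iff.mp hx
  simp only [hdiag, Complex.re_sum, Complex.re_ofReal_mul]
  exact Finset.sum_neg' (fun j _ => mul_nonpos_of_nonneg_of_nonpos (sq_nonneg _) (hneg j).le)
    ⟨i, Finset.mem_univ i, mul_neg_of_pos_of_neg (pow_pos (norm_pos_iff.mpr hi) 2) (hneg i)⟩

theorem exists_re_apply_add_smul_neg {χ p : M} {e : ℝ} (he : e < 0) (hχχ : E χ χ = 0)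
    (hχp : E χ p = e) (hpχ : E p χ = e) :
    ∃ ε : ℝ, (E (χ + (ε : ℂ) • p) (χ + (ε : ℂ) • p)).re < 0 := by
  set m := (E p p).re
  have hvalue : ∀ ε : ℝ, (E (χ + (ε : ℂ) • p) (χ + (ε : ℂ) • p)).re = ε * (2 * e + ε * m) := by
    intro ε
    simp only [map_add, map_smulₛₗ, LinearMap.add_apply, LinearMap.smul_apply, smul_eq_mul,
      RingHom.id_apply, Complex.conj_ofReal, hχχ, hχp, hpχ, Complex.add_re, Complex.re_ofReal_mul,
      Complex.ofReal_re, Complex.zero_re]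
    ring
  have hm : 0 < |m| + 1 := by positivity
  refine ⟨-e / (|m| + 1), ?_⟩
  have hε : 0 < -e / (|m| + 1) := div_pos (neg_pos.mpr he) hm
  have hcancel : -e / (|m| + 1) * (|m| + 1) = -e := div_mul_cancel₀ _ hm.ne'
  rw [hvalue]
  refine mul_neg_of_pos_of_neg hε ?_
  nlinarith [mul_le_mul_of_nonneg_left (le_abs_self m) hε.le]

end SesquilinearForm

section OperatorIndex

variable {L : ℝ} [Fact (0 < L)] {c : ℝ} {A B : L2per L →L[ℂ] L2per L}

/-- The functional `v ↦ ⟨η, v - 3 c B (4 - ∂²)⁻¹ v⟩`, which is the energy form of a pair over `η`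
with the pair over the resolvent of `v`. -/
def energyFunctional (c : ℝ) (B : L2per L →L[ℂ] L2per L) (η : L2per L) : L2per L →ₗ[ℂ] ℂ :=
  ((innerSL ℂ η).comp (1 - ((3 * c : ℝ) : ℂ) • (B * resolventFour L))).toLinearMap

theorem energyFunctional_apply {η u : L2per L × L2per L} {v : L2per L}
    (hη : η ∈ weakDerivGraph L) (hu : u ∈ weakDerivGraph L) (huv : u.1 = resolventFour L v) :
    energyFunctional c B η.1 v = energyForm c B η u := by
  rw [energyForm_of_eq_resolventFour hη hu huv, huv]
  change inner ℂ η.1 (v - ((3 * c : ℝ) : ℂ) • B (resolventFour L v)) = _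
  rw [inner_sub_right, inner_smul_right]
  push_cast
  ring

/-- `A` is a nonnegative self-adjoint operator with bounded inverse `B`. -/
structure IsPositiveInverse (A B : L2per L →L[ℂ] L2per L) : Prop where
  selfAdjoint : IsSelfAdjoint A
  notMem_spectrum : ∀ r : ℝ, r < 0 → (r : ℂ) ∉ spectrum ℂ A
  mul_inv : A * B = 1
  inv_mul : B * A = 1

theorem isCompactOperator_smul_resolventFour (r : ℝ) :
    IsCompactOperator ((r : ℂ) • resolventFour L) :=
  (isCompactOperator_resolventFour (L := L)).smul (r : ℂ)

theorem isSelfAdjoint_sub_smul_resolventFour (hA : IsSelfAdjoint A) (r : ℝ) :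
    IsSelfAdjoint (A - (r : ℂ) • resolventFour L) :=
  hA.sub (IsSelfAdjoint.smul (Complex.conj_ofReal r) isSelfAdjoint_resolventFour)

namespace IsPositiveInverse

theorem re_inner_nonneg (S : IsPositiveInverse A B) (hc : 0 ≤ c) {u : L2per L × L2per L}
    {v : L2per L} (hu : u ∈ weakDerivGraph L) (huv : u.1 = resolventFour L v)
    (h : 0 ≤ (energyForm c B u u).re) :
    0 ≤ (inner ℂ v ((A - ((3 * c : ℝ) : ℂ) • resolventFour L) v)).re := by
  have h3c : (3 * c : ℂ) = ((3 * c : ℝ) : ℂ) := by push_cast; rfl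
  have hpos := isPositive_of_forall_neg_notMem_spectrum S.selfAdjoint S.notMem_spectrum
  rw [inner_sub_resolventFour S.selfAdjoint S.mul_inv hu huv, Complex.add_re, h3c,
    Complex.re_ofReal_mul]
  exact add_nonneg (hpos.re_inner_nonneg_right _) (mul_nonneg (by linarith) h)

theorem negEigCount_le (S : IsPositiveInverse A B) (hc : 0 ≤ c) {x₀ : ℝ} {n : ℕ}
    {η : Fin n → L2per L × L2per L} (hη : ∀ i, η i ∈ weakDerivGraph L)
    (h : ∀ {u : L2per L × L2per L} {U U' : ℝ → ℂ}, IsLift x₀ u U U' →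
      (∀ x, HasDerivAt U (U' x) x) → Continuous U' → (∀ i, energyForm c B (η i) u = 0) →
        0 ≤ (energyForm c B u u).re) :
    negEigCount (A - ((3 * c : ℝ) : ℂ) • resolventFour L) ≤ n := by
  refine negEigCount_le_natCast (isSelfAdjoint_sub_smul_resolventFour S.selfAdjoint _)
    (LinearMap.pi fun i => energyFunctional c B (η i).1) fun v hv => ?_
  obtain ⟨u, U, U', huv, hu, hU, hU'⟩ := exists_isLift_resolventFour (x₀ := x₀) v
  refine S.re_inner_nonneg hc hu.mem_weakDerivGraph huv (h hu hU hU' fun i => ?_)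
  rw [← energyFunctional_apply (hη i) hu.mem_weakDerivGraph huv]
  exact congrFun hv i

theorem le_negEigCount (S : IsPositiveInverse A B) (hc : 0 < c) {n : ℕ}
    {η : Fin n → L2per L × L2per L} (hη : ∀ i, η i ∈ weakDerivGraph L)
    (horth : Pairwise fun i j => energyForm c B (η i) (η j) = 0)
    (hneg : ∀ i, (energyForm c B (η i) (η i)).re < 0) :
    n ≤ negEigCount (A - ((3 * c : ℝ) : ℂ) • resolventFour L) := by
  refine natCast_le_negEigCount (isSelfAdjoint_sub_smul_resolventFour S.selfAdjoint _)
    (isCompactOperator_smul_resolventFour _) S.notMem_spectrum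
    ((((3 * c : ℝ) : ℂ) • B).toLinearMap ∘ₗ LinearMap.fst ℂ _ _ ∘ₗ Fintype.linearCombination ℂ η)
    fun x hx => (re_inner_le_energyForm S.mul_inv hc.le
      (Submodule.sum_smul_mem _ x fun i _ => hη i)).trans_lt ?_
  exact mul_neg_of_pos_of_neg (by linarith) (re_apply_sum_smul_neg _ horth hneg hx)

end IsPositiveInverse

end OperatorIndex

theorem isSelfAdjoint_of_forall_coe_eq_ofReal {L : ℝ} {V : C(AddCircle L, ℂ)} {f : ℝ → ℝ}
    (hV : ∀ x : ℝ, V (x : AddCircle L) = (f x : ℂ)) : IsSelfAdjoint V := by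
  refine ContinuousMap.ext fun t => ?_
  induction t using QuotientAddGroup.induction_on with
  | H x => exact (congrArg star (hV x)).trans ((Complex.conj_ofReal _).trans (hV x).symm)

section HillIndex

variable {L : ℝ} [hL : Fact (0 < L)] {x₀ x₁ τ c : ℝ} {W : C(AddCircle L, ℂ)} {w q ψ N y Z : ℝ → ℝ}
  {u ζ ξ : L2per L × L2per L} {U U' : ℝ → ℂ}

namespace Profile

variable (P : Profile L x₀ x₁ τ q ψ N y Z)
  (hW : ∀ x : ℝ, W (x : AddCircle L) = ((w x)⁻¹ : ℝ)) (hq : ∀ x, q x = 4 - 3 * c / w x)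

include P hW hq

theorem exists_condition :
    ∃ χ ∈ weakDerivGraph L, ∀ {u : L2per L × L2per L} {U U' : ℝ → ℂ}, IsLift x₀ u U U' →
      energyForm c (mulOp W) χ u = 0 → (N x₁ : ℂ) * U x₁ = (N x₀ : ℂ) * U x₀ := by
  obtain ⟨χ, hχ⟩ := P.exists_isLift_indicator
  refine ⟨χ, hχ.mem_weakDerivGraph, fun {u U U'} hu h => ?_⟩
  have hL : (L : ℂ)⁻¹ ≠ 0 := inv_ne_zero (Complex.ofReal_ne_zero.mpr hL.out.ne')
  have hform := P.energyForm_indicator hW hq hχ hu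
  rw [← conj_energyForm (isSelfAdjoint_mulOp (isSelfAdjoint_of_forall_coe_eq_ofReal hW)), h,
    map_zero, eq_comm, mul_eq_zero, or_iff_right hL, sub_eq_zero] at hform
  have hconj := congrArg (starRingEnd ℂ) hform
  simp only [map_mul, Complex.conj_conj, Complex.conj_ofReal] at hconj
  rw [mul_comm, hconj, mul_comm]

theorem eq_zero_or_eq_zero_of_energyForm_jacobi
    (hζ : IsLift x₀ ζ (fun x => (y x : ℂ)) (fun x => (Z x : ℂ))) (hu : IsLift x₀ u U U')
    (h : energyForm c (mulOp W) ζ u = 0) : τ = 0 ∨ U x₀ = 0 := by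
  have hform := P.energyForm_jacobi hW hq hζ hu
  rw [← conj_energyForm (isSelfAdjoint_mulOp (isSelfAdjoint_of_forall_coe_eq_ofReal hW)), h,
    map_zero, eq_comm] at hform
  simpa [hL.out.ne', P.N_left.ne'] using hform

theorem re_energyForm_nonneg
    (hu : IsLift x₀ u U U') (hU : ∀ x, HasDerivAt U (U' x) x) (hU' : Continuous U')
    (hcond : (N x₁ : ℂ) * U x₁ = (N x₀ : ℂ) * U x₀) (hτ : τ ≤ 0 ∨ U x₀ = 0) :
    0 ≤ (energyForm c (mulOp W) u u).re := by
  refine nonneg_of_mul_nonneg_right (le_trans ?_ (P.le_energyForm hW hq hu hU hU' hcond).1) hL.out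
  rcases hτ with hτ | hU₀
  · nlinarith [sq_nonneg (2 * N x₀ * ‖U x₀‖)]
  · simp [hU₀]

theorem re_energyForm_jacobi_neg
    (hζ : IsLift x₀ ζ (fun x => (y x : ℂ)) (fun x => (Z x : ℂ))) (hτ : 0 < τ) :
    (energyForm c (mulOp W) ζ ζ).re < 0 := by
  have hvalue : energyForm c (mulOp W) ζ ζ = ((-(L⁻¹ * τ / 2) : ℝ) : ℂ) := by
    rw [P.energyForm_jacobi hW hq hζ hζ, Complex.conj_ofReal,
      show -(L⁻¹ * τ / 2) = -(L⁻¹ * N x₀ * τ) * y x₀ by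
        linear_combination L⁻¹ * τ * P.N_mul_y P.ψ_left]
    push_cast
    ring
  rw [hvalue, Complex.ofReal_re, neg_lt_zero]
  exact half_pos (mul_pos (inv_pos.mpr hL.out) hτ)

/-- The half-period arch `ψ 1_{x < x₁}` has zero energy, so a small multiple of `1 - 2 N(x₀) y`,
which pairs negatively with it, makes the energy negative. -/
theorem exists_neg_direction (hζ : IsLift x₀ ζ (fun x => (y x : ℂ)) (fun x => (Z x : ℂ))) :
    ∃ η ∈ weakDerivGraph L, (energyForm c (mulOp W) η η).re < 0 ∧
      energyForm c (mulOp W) η ζ = 0 := by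
  have hB := isSelfAdjoint_mulOp (isSelfAdjoint_of_forall_coe_eq_ofReal hW)
  have hleft : (Set.Iio x₁).indicator (fun x => (ψ x : ℂ)) x₀ = 0 := by simp [P.ψ_left]
  have hmid : (Set.Iio x₁).indicator (fun x => (ψ x : ℂ)) x₁ = 0 := by simp
  obtain ⟨χ, hχ⟩ := P.exists_isLift_indicator
  obtain ⟨p, hp⟩ := exists_isLift_ofReal (L := L) (x₀ := x₀)
    (fun x => ((P.deriv_y x).const_mul (2 * N x₀)).const_sub 1)
    (P.cont_Z.const_mul (2 * N x₀)).neg (by simp only [P.y_right])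
  have hp_left : 1 - 2 * N x₀ * y x₀ = 0 := by linear_combination (-2) * P.N_mul_y P.ψ_left
  have hp_mid : (1 - 2 * N x₀ * y x₁) * N x₁ = N x₁ - N x₀ := by
    linear_combination (-2 * N x₀) * P.N_mul_y P.ψ_mid
  have hneg : L⁻¹ * (N x₁ - N x₀) < 0 :=
    mul_neg_of_pos_of_neg (inv_pos.mpr hL.out) (by linarith [P.N_left, P.N_mid])
  have hχχ : energyForm c (mulOp W) χ χ = 0 := by
    rw [P.energyForm_indicator hW hq hχ hχ, hleft, hmid]
    simp
  have hpχ : energyForm c (mulOp W) p χ = ((L⁻¹ * (N x₁ - N x₀) : ℝ) : ℂ) := by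
    rw [P.energyForm_indicator hW hq hχ hp, hp_left, ← hp_mid, Complex.conj_ofReal,
      Complex.conj_ofReal]
    push_cast
    ring
  have hχp : energyForm c (mulOp W) χ p = ((L⁻¹ * (N x₁ - N x₀) : ℝ) : ℂ) := by
    rw [← conj_energyForm hB, hpχ, Complex.conj_ofReal]
  obtain ⟨ε, hε⟩ := exists_re_apply_add_smul_neg _ hneg hχχ hχp hpχ
  have hη := hχ.add (hp.smul (ε : ℂ))
  refine ⟨_, hη.mem_weakDerivGraph, hε, ?_⟩
  rw [P.energyForm_jacobi hW hq hζ hη, Pi.add_apply, Pi.smul_apply, hleft, hp_left]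
  simp

section NegativeCount

variable {A : L2per L →L[ℂ] L2per L}

theorem negEigCount_le_one (S : IsPositiveInverse A (mulOp W)) (hc : 0 ≤ c) (hτ : τ ≤ 0) :
    negEigCount (A - ((3 * c : ℝ) : ℂ) • resolventFour L) ≤ 1 := by
  obtain ⟨χ, hχ, hcond⟩ := P.exists_condition hW hq
  exact_mod_cast S.negEigCount_le hc (η := ![χ]) (Fin.forall_fin_one.mpr hχ) fun hu hU hU' h =>
    P.re_energyForm_nonneg hW hq hu hU hU' (hcond hu (h 0)) (Or.inl hτ)

theorem negEigCount_le_two (S : IsPositiveInverse A (mulOp W)) (hc : 0 ≤ c)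
    (hζ : IsLift x₀ ζ (fun x => (y x : ℂ)) (fun x => (Z x : ℂ))) :
    negEigCount (A - ((3 * c : ℝ) : ℂ) • resolventFour L) ≤ 2 := by
  obtain ⟨χ, hχ, hcond⟩ := P.exists_condition hW hq
  exact_mod_cast S.negEigCount_le hc (η := ![χ, ζ])
    (Fin.forall_fin_two.mpr ⟨hχ, hζ.mem_weakDerivGraph⟩) fun hu hU hU' h =>
      P.re_energyForm_nonneg hW hq hu hU hU' (hcond hu (h 0))
        ((P.eq_zero_or_eq_zero_of_energyForm_jacobi hW hq hζ hu (h 1)).imp_left le_of_eq)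

theorem one_le_negEigCount (S : IsPositiveInverse A (mulOp W)) (hc : 0 < c)
    (hζ : IsLift x₀ ζ (fun x => (y x : ℂ)) (fun x => (Z x : ℂ))) :
    1 ≤ negEigCount (A - ((3 * c : ℝ) : ℂ) • resolventFour L) := by
  obtain ⟨η, hη, hneg, -⟩ := P.exists_neg_direction hW hq hζ
  exact_mod_cast S.le_negEigCount hc (η := ![η]) (Fin.forall_fin_one.mpr hη)
    (Subsingleton.pairwise) (Fin.forall_fin_one.mpr hneg)

theorem two_le_negEigCount (S : IsPositiveInverse A (mulOp W)) (hc : 0 < c)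
    (hζ : IsLift x₀ ζ (fun x => (y x : ℂ)) (fun x => (Z x : ℂ))) (hτ : 0 < τ) :
    2 ≤ negEigCount (A - ((3 * c : ℝ) : ℂ) • resolventFour L) := by
  obtain ⟨η, hη, hneg, hηζ⟩ := P.exists_neg_direction hW hq hζ
  have hζη : energyForm c (mulOp W) ζ η = 0 := by
    rw [← conj_energyForm (isSelfAdjoint_mulOp (isSelfAdjoint_of_forall_coe_eq_ofReal hW)), hηζ,
      map_zero]
  have horth : Pairwise fun i j => energyForm c (mulOp W) (![η, ζ] i) (![η, ζ] j) = 0 := by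
    intro i j hij
    fin_cases i <;> fin_cases j <;> first | exact absurd rfl hij | assumption
  exact_mod_cast S.le_negEigCount hc (η := ![η, ζ])
    (Fin.forall_fin_two.mpr ⟨hη, hζ.mem_weakDerivGraph⟩) horth
    (Fin.forall_fin_two.mpr ⟨hneg, P.re_energyForm_jacobi_neg hW hq hζ hτ⟩)

end NegativeCount

end Profile

end HillIndex

section Kernel

variable {L : ℝ} [hL : Fact (0 < L)] {x₀ x₁ τ c : ℝ} {W : C(AddCircle L, ℂ)} {w q ψ N y Z : ℝ → ℝ}
  {A : L2per L →L[ℂ] L2per L} {ζ ξ : L2per L × L2per L}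

theorem Profile.linearIndependent (P : Profile L x₀ x₁ τ q ψ N y Z)
    (hζ : IsLift x₀ ζ (fun x => (y x : ℂ)) (fun x => (Z x : ℂ)))
    (hξ : IsLift x₀ ξ (fun x => (ψ x : ℂ)) (fun x => (N x : ℂ))) :
    LinearIndependent ℂ ![ζ.1, ξ.1] := by
  rw [LinearIndependent.pair_iff]
  intro r s hrs
  have hsum := (hζ.smul r).add (hξ.smul s)
  have hzero : Represents x₀ (r • ζ.1 + s • ξ.1) 0 := hrs ▸ represents_zero
  have heq := hsum.rep.eqOn hzero hsum.cont continuousOn_const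
  have hr : r = 0 := by
    have hright := heq (Set.right_mem_Ioc.mpr (lt_add_of_pos_right x₀ hL.out))
    have hy : y x₀ ≠ 0 := right_ne_zero_of_mul_eq_one (a := 2 * N x₀) <| by
      linear_combination 2 * P.N_mul_y P.ψ_left
    simpa [P.y_right, P.ψ_right, hy] using hright
  have hmem : (x₀ + x₁) / 2 ∈ Set.Ioo x₀ x₁ :=
    ⟨left_lt_add_div_two.mpr P.lt_left, add_div_two_lt_right.mpr P.lt_left⟩
  have hmid := heq ⟨hmem.1, (hmem.2.trans P.lt_right).le⟩
  refine ⟨hr, ?_⟩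
  simpa [hr, P.ψ_ne_left _ hmem] using hmid

theorem linearIndependent_pair_smul_apply {B : L2per L →L[ℂ] L2per L} (hAB : A * B = 1) {r : ℂ}
    (hr : r ≠ 0) {u v : L2per L} (h : LinearIndependent ℂ ![u, v]) :
    LinearIndependent ℂ ![r • B u, r • B v] := by
  have hinj : Function.Injective (r • B) := (smul_right_injective _ hr).comp <|
    Function.LeftInverse.injective fun v => DFunLike.congr_fun hAB v
  have hmap := h.map' (r • B).toLinearMap (LinearMap.ker_eq_bot.mpr hinj)
  rwa [← FinVec.map_eq] at hmap

namespace Profile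

variable (P : Profile L x₀ x₁ τ q ψ N y Z)
  (hW : ∀ x : ℝ, W (x : AddCircle L) = ((w x)⁻¹ : ℝ)) (hq : ∀ x, q x = 4 - 3 * c / w x)

include P hW hq

theorem exists_eq_of_apply_eq_zero (S : IsPositiveInverse A (mulOp W))
    (hζ : IsLift x₀ ζ (fun x => (y x : ℂ)) (fun x => (Z x : ℂ)))
    (hξ : IsLift x₀ ξ (fun x => (ψ x : ℂ)) (fun x => (N x : ℂ))) {v : L2per L}
    (hv : (A - ((3 * c : ℝ) : ℂ) • resolventFour L) v = 0) :
    ∃ r s : ℂ, (τ = 0 ∨ r = 0) ∧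
      v = r • ((3 * c : ℝ) : ℂ) • mulOp W ζ.1 + s • ((3 * c : ℝ) : ℂ) • mulOp W ξ.1 := by
  obtain ⟨χ, hχ, hcond⟩ := P.exists_condition hW hq
  obtain ⟨u, U, U', huv, hu, hU, hU'⟩ := exists_isLift_resolventFour (x₀ := x₀) v
  have hform : ∀ {η}, η ∈ weakDerivGraph L → energyForm c (mulOp W) η u = 0 := fun hη =>
    energyForm_eq_zero_of_apply_eq_zero S.inv_mul hη hu.mem_weakDerivGraph huv hv
  have hτU := P.eq_zero_or_eq_zero_of_energyForm_jacobi hW hq hζ hu (hform hζ.mem_weakDerivGraph)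
  obtain ⟨s, hs⟩ := (P.le_energyForm hW hq hu hU hU' (hcond hu (hform hχ))).2 <| by
    rw [hform hu.mem_weakDerivGraph]
    rcases hτU with h | h <;> simp [h]
  refine ⟨2 * (N x₀ : ℂ) * U x₀, s, hτU.imp_right fun h => by rw [h, mul_zero], ?_⟩
  have hu₁ : u.1 = ((2 * (N x₀ : ℂ) * U x₀) • ζ + s • ξ).1 :=
    hu.rep.unique (((hζ.smul _).add (hξ.smul s)).rep.congr fun x hx =>
      (hs x (Set.Ioc_subset_Icc_self hx)).symm)
  rw [eq_smul_of_apply_eq_zero S.inv_mul hv, ← huv, hu₁, Prod.fst_add, Prod.smul_fst,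
    Prod.smul_fst, map_add, map_smul, map_smul, smul_add, smul_comm ((3 * c : ℝ) : ℂ),
    smul_comm ((3 * c : ℝ) : ℂ)]

theorem apply_periodic_eq_zero (S : IsPositiveInverse A (mulOp W))
    (hξ : IsLift x₀ ξ (fun x => (ψ x : ℂ)) (fun x => (N x : ℂ))) :
    (A - ((3 * c : ℝ) : ℂ) • resolventFour L) (((3 * c : ℝ) : ℂ) • mulOp W ξ.1) = 0 :=
  apply_eq_zero_of_resolventFour_smul S.mul_inv <|
    resolventFour_smul_of_energyForm_eq_zero hξ.mem_weakDerivGraph fun n =>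
      P.energyForm_periodic hW hq hξ (isLift_fourierPair n)

theorem apply_jacobi_eq_zero (S : IsPositiveInverse A (mulOp W))
    (hζ : IsLift x₀ ζ (fun x => (y x : ℂ)) (fun x => (Z x : ℂ))) (hτ : τ = 0) :
    (A - ((3 * c : ℝ) : ℂ) • resolventFour L) (((3 * c : ℝ) : ℂ) • mulOp W ζ.1) = 0 :=
  apply_eq_zero_of_resolventFour_smul S.mul_inv <|
    resolventFour_smul_of_energyForm_eq_zero hζ.mem_weakDerivGraph fun n => by
      rw [P.energyForm_jacobi hW hq hζ (isLift_fourierPair n), hτ, Complex.ofReal_zero, mul_zero,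
        neg_zero, zero_mul]

theorem eigMult_zero_eq_one (S : IsPositiveInverse A (mulOp W)) (hc : c ≠ 0)
    (hζ : IsLift x₀ ζ (fun x => (y x : ℂ)) (fun x => (Z x : ℂ)))
    (hξ : IsLift x₀ ξ (fun x => (ψ x : ℂ)) (fun x => (N x : ℂ))) (hτ : τ ≠ 0) :
    eigMult (A - ((3 * c : ℝ) : ℂ) • resolventFour L) 0 = 1 := by
  have hne : ((3 * c : ℝ) : ℂ) • mulOp W ξ.1 ≠ 0 :=
    (linearIndependent_pair_smul_apply S.mul_inv (Complex.ofReal_ne_zero.mpr (by positivity))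
      (P.linearIndependent hζ hξ)).ne_zero 1
  have hker : (A - ((3 * c : ℝ) : ℂ) • resolventFour L).toLinearMap.ker =
      Submodule.span ℂ {((3 * c : ℝ) : ℂ) • mulOp W ξ.1} := by
    refine le_antisymm (fun v hv => ?_) ((Submodule.span_singleton_le_iff_mem _ _).mpr
      (P.apply_periodic_eq_zero hW hq S hξ))
    obtain ⟨r, s, hr, rfl⟩ := P.exists_eq_of_apply_eq_zero hW hq S hζ hξ hv
    rw [hr.resolve_left hτ, zero_smul, zero_add]
    exact Submodule.mem_span_singleton.mpr ⟨s, rfl⟩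
  rw [eigMult, Module.End.eigenspace_zero, hker, ← Module.finrank_eq_rank,
    finrank_span_singleton hne, Nat.cast_one]

theorem eigMult_zero_eq_two (S : IsPositiveInverse A (mulOp W)) (hc : c ≠ 0)
    (hζ : IsLift x₀ ζ (fun x => (y x : ℂ)) (fun x => (Z x : ℂ)))
    (hξ : IsLift x₀ ξ (fun x => (ψ x : ℂ)) (fun x => (N x : ℂ))) (hτ : τ = 0) :
    eigMult (A - ((3 * c : ℝ) : ℂ) • resolventFour L) 0 = 2 := by
  have hli := linearIndependent_pair_smul_apply S.mul_inv (r := ((3 * c : ℝ) : ℂ))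
    (Complex.ofReal_ne_zero.mpr (by positivity)) (P.linearIndependent hζ hξ)
  have hker : (A - ((3 * c : ℝ) : ℂ) • resolventFour L).toLinearMap.ker =
      Submodule.span ℂ (Set.range
        ![((3 * c : ℝ) : ℂ) • mulOp W ζ.1, ((3 * c : ℝ) : ℂ) • mulOp W ξ.1]) := by
    rw [Matrix.range_cons_cons_empty]
    refine le_antisymm (fun v hv => ?_) (Submodule.span_le.mpr (Set.pair_subset
      (P.apply_jacobi_eq_zero hW hq S hζ hτ) (P.apply_periodic_eq_zero hW hq S hξ)))
    obtain ⟨r, s, -, h⟩ := P.exists_eq_of_apply_eq_zero hW hq S hζ hξ hv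
    exact Submodule.mem_span_pair.mpr ⟨r, s, h.symm⟩
  rw [eigMult, Module.End.eigenspace_zero, hker, rank_span hli,
    Cardinal.mk_range_eq _ hli.injective, Cardinal.mk_fin]
  exact Nat.cast_ofNat

end Profile

end Kernel

namespace IsSmoothPeriodicWave

variable {c a b L : ℝ} {φ : ℝ → ℝ}

theorem exists_forall_notMem_spectrum_speedMinus [Fact (0 < L)]
    (h : IsSmoothPeriodicWave c a b L φ) :
    ∃ w₀ : ℝ, 0 < w₀ ∧ ∀ r : ℝ, r < w₀ →
      (r : ℂ) ∉ spectrum ℂ (mulOp (speedMinus c h.smooth.continuous h.periodic)) := by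
  have hcont : Continuous fun t : AddCircle L => c - h.periodic.lift t :=
    continuous_const.sub (h.smooth.continuous.quotient_liftOn' _)
  obtain ⟨t₀, -, ht₀⟩ := isCompact_univ.exists_isMinOn Set.univ_nonempty hcont.continuousOn
  refine ⟨c - h.periodic.lift t₀, ?_, fun r hr hmem => ?_⟩
  · induction t₀ using QuotientAddGroup.induction_on with
    | H x => exact h.lt_speed x
  · obtain ⟨t, ht⟩ := spectrum_mulOp_subset_range _ hmem
    exact hr.not_ge ((ht₀ (Set.mem_univ t)).trans_eq (Complex.ofReal_injective ht))

theorem exists_isPositiveInverse_mulOp [Fact (0 < L)] (h : IsSmoothPeriodicWave c a b L φ) :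
    ∃ W : C(AddCircle L, ℂ), (∀ x : ℝ, W (x : AddCircle L) = ((c - φ x)⁻¹ : ℝ)) ∧
      IsPositiveInverse (mulOp (speedMinus c h.smooth.continuous h.periodic)) (mulOp W) := by
  set V := speedMinus c h.smooth.continuous h.periodic
  obtain ⟨w₀, hw₀, hspec⟩ := h.exists_forall_notMem_spectrum_speedMinus
  have hV₀ : ∀ t, V t ≠ 0 := fun t => by
    induction t using QuotientAddGroup.induction_on with
    | H x => exact Complex.ofReal_ne_zero.mpr (h.lt_speed x).ne'
  exact ⟨⟨fun t => (V t)⁻¹, V.continuous.inv₀ hV₀⟩, fun x => (Complex.ofReal_inv _).symm,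
    isSelfAdjoint_mulOp
      (isSelfAdjoint_of_forall_coe_eq_ofReal (f := fun x => c - φ x) fun _ => rfl),
    fun r hr => hspec r (hr.trans hw₀),
    mulOp_mul_mulOp_eq_one (ContinuousMap.ext fun t => mul_inv_cancel₀ (hV₀ t)),
    mulOp_mul_mulOp_eq_one (ContinuousMap.ext fun t => inv_mul_cancel₀ (hV₀ t))⟩

end IsSmoothPeriodicWave

end DPWave

end

theorem lemma4p2 (c a b L : ℝ) [Fact (0 < L)] (φ : ℝ → ℝ) (hc : 0 < c)
    (hab : (a, b) ∈ DPWave.existenceRegion c)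
    (hφ : DPWave.IsSmoothPeriodicWave c a b L φ) :
    DifferentiableAt ℝ (fun a' => DPWave.periodFn c a' b) a ∧
    (0 < deriv (fun a' => DPWave.periodFn c a' b) a →
      DPWave.negEigCount (DPWave.hessian c hφ.smooth.continuous hφ.periodic) = 2 ∧
      DPWave.eigMult (DPWave.hessian c hφ.smooth.continuous hφ.periodic) 0 = 1) ∧
    (deriv (fun a' => DPWave.periodFn c a' b) a = 0 →
      DPWave.negEigCount (DPWave.hessian c hφ.smooth.continuous hφ.periodic) = 1 ∧
      DPWave.eigMult (DPWave.hessian c hφ.smooth.continuous hφ.periodic) 0 = 2) ∧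
    (deriv (fun a' => DPWave.periodFn c a' b) a < 0 →
      DPWave.negEigCount (DPWave.hessian c hφ.smooth.continuous hφ.periodic) = 1 ∧
      DPWave.eigMult (DPWave.hessian c hφ.smooth.continuous hφ.periodic) 0 = 1) ∧
    ∃ δ : ℝ, 0 < δ ∧
      ∀ z ∈ spectrum ℂ (DPWave.hessian c hφ.smooth.continuous hφ.periodic),
        z = 0 ∨
        (∃ r : ℝ, r < 0 ∧ z = (r : ℂ) ∧
          Module.End.HasEigenvalue
            (DPWave.hessian c hφ.smooth.continuous hφ.periodic :
              DPWave.L2per L →ₗ[ℂ] DPWave.L2per L) z) ∨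
        ∃ r : ℝ, δ ≤ r ∧ z = (r : ℂ) := by
  obtain ⟨τ, x₀, x₁, ψ, N, y, Z, hder, P⟩ := hφ.exists_profile hc hab
  obtain ⟨W, hW, S⟩ := hφ.exists_isPositiveInverse_mulOp
  obtain ⟨w₀, hw₀, hspec⟩ := hφ.exists_forall_notMem_spectrum_speedMinus
  obtain ⟨ζ, hζ⟩ := DPWave.exists_isLift_ofReal P.deriv_y P.cont_Z P.y_right
  obtain ⟨ξ, hξ⟩ := DPWave.exists_isLift_ofReal P.deriv_ψ P.cont_N
    (P.ψ_right.trans P.ψ_left.symm)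
  have hq := fun x => Eq.refl (4 - 3 * c / (c - φ x))
  rw [hder.deriv]
  refine ⟨hder.differentiableAt, fun hτ => ⟨le_antisymm ?_ ?_, ?_⟩,
    fun hτ => ⟨le_antisymm ?_ ?_, ?_⟩, fun hτ => ⟨le_antisymm ?_ ?_, ?_⟩,
    DPWave.exists_spectral_gap (DPWave.isSelfAdjoint_sub_smul_resolventFour S.selfAdjoint _)
      (DPWave.isCompactOperator_smul_resolventFour _) hw₀ hspec⟩
  · exact P.negEigCount_le_two hW hq S hc.le hζ
  · exact P.two_le_negEigCount hW hq S hc hζ hτ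
  · exact P.eigMult_zero_eq_one hW hq S hc.ne' hζ hξ hτ.ne'
  · exact P.negEigCount_le_one hW hq S hc.le hτ.le
  · exact P.one_le_negEigCount hW hq S hc hζ
  · exact P.eigMult_zero_eq_two hW hq S hc.ne' hζ hξ hτ
  · exact P.negEigCount_le_one hW hq S hc.le hτ.le
  · exact P.one_le_negEigCount hW hq S hc hζ
  · exact P.eigMult_zero_eq_one hW hq S hc.ne' hζ hξ hτ.ne
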